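/- Let $p$ be a prime, $k\ge 2$, $\Delta$ a finite abelian group of order prime to $p$, and $G$ a topological group isomorphic to $\mathbb{Z}_p^k\times\Delta$. Let $\Lambda=\Lambda(G)=\varprojlim_U\mathbb{Z}_p[G/U]$ be its Iwasawa algebra. For a commutative ring $R$ let $\mathcal{C}_R$ be the Picard category whose objects are the pairs $(P,Q)$ of finitely generated projective $R$-modules, standing for $\mathbf{d}_R(P)\mathbf{d}_R(Q)^{-1}$, and whose morphisms $(P,Q)\to(P',Q')$ are the isomorphisms $P\oplus Q'\oplus S\cong P'\oplus Q\oplus S$ with $S$ finitely generated projective, up to enlarging $S$ and up to automorphisms with trivial class in $K_1(R)$. For a bounded complex $C$ of finitely generated projective $R$-modules put $\mathbf{d}_R(C)=(\bigoplus_i C^{2i},\bigoplus_i C^{2i+1})$. A quasi-isomorphism $f:C\to C'$ induces an isomorphism $\mathbf{d}_R(f):\mathbf{d}_R(C)\to\mathbf{d}_R(C')$, and if $C$ is acyclic there is an isomorphism $\mathrm{acyc}:\mathbf{1}_R=\mathbf{d}_R(0)\to\mathbf{d}_R(C)$. For a module $M$ quasi-isomorphic to such a complex $C$, put $\mathbf{d}_R(M)=\mathbf{d}_R(C)$;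 this is independent of $C$ up to the isomorphisms $\mathbf{d}_R(f)$. Let $M$ be a finitely generated $\Lambda$-module of Krull codimension at least $2$ (every prime in its support has height at least $2$). Then $M$ has a finite resolution by finitely generated projective $\Lambda$-modules, and there is a canonical isomorphism $$\mathrm{can}_M:\ \mathbf{1}_\Lambda\longrightarrow\mathbf{d}_\Lambda(M),$$ namely a unique isomorphism, compatible with the isomorphisms $\mathbf{d}_\Lambda(f)$ for all quasi-isomorphisms $f$ between resolutions of $M$, whose extension of scalars to $\Lambda_{\mathfrak p}$ is, for every prime ideal $\mathfrak p$ of $\Lambda$ of height at most $1$, the isomorphism $\mathrm{acyc}:\mathbf{1}_{\Lambda_{\mathfrak p}}\to\mathbf{d}_{\Lambda_{\mathfrak p}}(M_{\mathfrak p})$ (note that $M_{\mathfrak p}=0$). The same conclusion holds for $M=\mathbb{Z}_p(r)$ for all $r\in\mathbb{Z}$, where, for any continuous character $\kappa:G\to\mathbb{Z}_p^\times$ (for instance the cyclotomic character of a Galois group $G$), $\mathbb{Z}_p(r)$ denotes $\mathbb{Z}_p$ with $G$ acting through $\kappa^r$. -/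

import Mathlib

universe u

noncomputable section

open TensorProduct

namespace DetFunctor

/-- Finitely generated projective modules over a commutative ring. -/
structure FGProj (R : Type u) [CommRing R] where
  carrier : Type u
  [addCommGroup : AddCommGroup carrier]
  [module : Module R carrier]
  [finite : Module.Finite R carrier]
  [projective : Module.Projective R carrier]

namespace FGProj

instance (R : Type u) [CommRing R] : CoeSort (FGProj R) (Type u) := ⟨FGProj.carrier⟩

attribute [instance] addCommGroup module finite projective

variable {R : Type u} [CommRing R]

/-- The zero module. -/
abbrev zero : FGProj R := ⟨PUnit.{u + 1}⟩

instance : Subsingleton (zero : FGProj R) := inferInstanceAs (Subsingleton PUnit)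

/-- The direct sum of two finitely generated projective modules. -/
abbrev prod (P Q : FGProj R) : FGProj R := ⟨P × Q⟩

/-- Extension of scalars. -/
abbrev baseChange (A : Type u) [CommRing A] [Algebra R A] (P : FGProj R) : FGProj A := ⟨A ⊗[R] P⟩

end FGProj

section K1

variable (R : Type u) [CommRing R]

/-- A finitely generated projective module together with an automorphism. -/
structure ProjAut where
  mod : FGProj R
  aut : mod ≃ₗ[R] mod

variable {R}

/-- The defining relations of `K₁(R)`: composition of automorphisms of one module, and short exact
sequences of modules with automorphisms. -/
inductive K1Rel : FreeAbelianGroup (ProjAut R) → Prop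
  | comp (P : FGProj R) (a b : P ≃ₗ[R] P) :
      K1Rel (FreeAbelianGroup.of ⟨P, a.trans b⟩ - FreeAbelianGroup.of ⟨P, a⟩
        - FreeAbelianGroup.of ⟨P, b⟩)
  | exact (P₁ P₂ P₃ : FGProj R) (i : P₁ →ₗ[R] P₂) (q : P₂ →ₗ[R] P₃)
      (hi : Function.Injective i) (hiq : Function.Exact i q) (hq : Function.Surjective q)
      (a₁ : P₁ ≃ₗ[R] P₁) (a₂ : P₂ ≃ₗ[R] P₂) (a₃ : P₃ ≃ₗ[R] P₃)
      (h₁ : ∀ x, a₂ (i x) = i (a₁ x)) (h₂ : ∀ x, q (a₂ x) = a₃ (q x)) :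
      K1Rel (FreeAbelianGroup.of ⟨P₂, a₂⟩ - FreeAbelianGroup.of ⟨P₁, a₁⟩
        - FreeAbelianGroup.of ⟨P₃, a₃⟩)

variable (R) in
/-- The group `K₁(R)` of the exact category of finitely generated projective modules. -/
def K1 : Type (u + 1) :=
  FreeAbelianGroup (ProjAut R) ⧸ AddSubgroup.closure {x | K1Rel (R := R) x}

instance : AddCommGroup (K1 R) :=
  inferInstanceAs (AddCommGroup
    (FreeAbelianGroup (ProjAut R) ⧸ AddSubgroup.closure {x | K1Rel (R := R) x}))

namespace K1

/-- The class in `K₁(R)` of an automorphism of a finitely generated projective module. -/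
def cls (P : FGProj R) (a : P ≃ₗ[R] P) : K1 R :=
  QuotientAddGroup.mk' (AddSubgroup.closure {x | K1Rel (R := R) x})
    (FreeAbelianGroup.of ⟨P, a⟩)

lemma cls_trans (P : FGProj R) (a b : P ≃ₗ[R] P) : cls P (a.trans b) = cls P a + cls P b := by
  have h := (QuotientAddGroup.eq_zero_iff _).2
    (AddSubgroup.subset_closure (show _ ∈ {x | K1Rel (R := R) x} from K1Rel.comp P a b))
  have h' : cls P (a.trans b) - cls P a - cls P b = 0 := h
  rw [sub_sub, sub_eq_zero] at h'
  exact h'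

lemma cls_exact {P₁ P₂ P₃ : FGProj R} (i : P₁ →ₗ[R] P₂) (q : P₂ →ₗ[R] P₃)
    (hi : Function.Injective i) (hiq : Function.Exact i q) (hq : Function.Surjective q)
    (a₁ : P₁ ≃ₗ[R] P₁) (a₂ : P₂ ≃ₗ[R] P₂) (a₃ : P₃ ≃ₗ[R] P₃)
    (h₁ : ∀ x, a₂ (i x) = i (a₁ x)) (h₂ : ∀ x, q (a₂ x) = a₃ (q x)) :
    cls P₂ a₂ = cls P₁ a₁ + cls P₃ a₃ := by
  have h := (QuotientAddGroup.eq_zero_iff _).2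
    (AddSubgroup.subset_closure
      (show _ ∈ {x | K1Rel (R := R) x} from K1Rel.exact P₁ P₂ P₃ i q hi hiq hq a₁ a₂ a₃ h₁ h₂))
  have h' : cls P₂ a₂ - cls P₁ a₁ - cls P₃ a₃ = 0 := h
  rw [sub_sub, sub_eq_zero] at h'
  exact h'

lemma cls_refl (P : FGProj R) : cls P (LinearEquiv.refl R P) = 0 := by
  have h := cls_trans P (LinearEquiv.refl R P) (LinearEquiv.refl R P)
  have h' : (LinearEquiv.refl R P).trans (LinearEquiv.refl R P) = LinearEquiv.refl R P := rfl
  rw [h'] at h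
  simpa using h.symm

lemma cls_conj {P Q : FGProj R} (e : P ≃ₗ[R] Q) (a : P ≃ₗ[R] P) :
    cls Q (e.symm.trans (a.trans e)) = cls P a := by
  have h := cls_exact (P₁ := P) (P₂ := Q) (P₃ := FGProj.zero) e.toLinearMap 0 e.injective
    (fun y => ⟨fun _ => ⟨e.symm y, by simp⟩, fun _ => rfl⟩)
    (fun y => ⟨0, Subsingleton.elim _ _⟩) a (e.symm.trans (a.trans e)) (LinearEquiv.refl R _)
    (fun x => by simp) (fun x => Subsingleton.elim _ _)
  rw [h, cls_refl, add_zero]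

lemma cls_prod_refl (P Q : FGProj R) (a : P ≃ₗ[R] P) :
    cls (P.prod Q) (LinearEquiv.prodCongr a (LinearEquiv.refl R Q)) = cls P a := by
  have h := cls_exact (P₁ := P) (P₂ := P.prod Q) (P₃ := Q) (LinearMap.inl R P Q)
    (LinearMap.snd R P Q) LinearMap.inl_injective Function.Exact.inl_snd
    LinearMap.snd_surjective a (LinearEquiv.prodCongr a (LinearEquiv.refl R Q))
    (LinearEquiv.refl R _) (fun x => by
      change (a x, (0 : Q)) = _
      rfl) (fun x => rfl)
  rw [h, cls_refl, add_zero]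

lemma cls_eq_of_equiv {P Q : FGProj R} (e : P ≃ₗ[R] Q) (a : P ≃ₗ[R] P) (b : Q ≃ₗ[R] Q)
    (h : ∀ x, b (e x) = e (a x)) : cls Q b = cls P a := by
  rw [← cls_conj e a]
  congr 1
  apply LinearEquiv.ext
  intro y
  simpa using h (e.symm y)

lemma cls_eq_of_prod {P N Q : FGProj R} (e : (P × N) ≃ₗ[R] Q) (a : P ≃ₗ[R] P) (b : Q ≃ₗ[R] Q)
    (h : ∀ x, b (e x) = e (a x.1, x.2)) : cls Q b = cls P a := by
  rw [← cls_prod_refl P N a]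
  exact cls_eq_of_equiv (P := P.prod N) e _ b h

/-- If an automorphism has trivial class, then so does its extension of scalars. -/
lemma cls_baseChange (A : Type u) [CommRing A] [Algebra R A] (P : FGProj R) (a : P ≃ₗ[R] P)
    (h : cls P a = 0) :
    cls (P.baseChange A) (LinearEquiv.baseChange R A P P a) = 0 := by
  let F : FreeAbelianGroup (ProjAut R) →+ K1 A :=
    FreeAbelianGroup.lift fun x =>
      cls (x.mod.baseChange A) (LinearEquiv.baseChange R A x.mod x.mod x.aut)
  have hF : AddSubgroup.closure {x | K1Rel (R := R) x} ≤ F.ker := by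
    rw [AddSubgroup.closure_le]
    intro x hx
    change F x = 0
    induction hx with
    | comp P a b =>
      simp only [F, map_sub, FreeAbelianGroup.lift_apply_of]
      rw [sub_sub, sub_eq_zero, ← cls_trans]
      congr 1
      apply LinearEquiv.toLinearMap_injective
      ext x
      rfl
    | exact P₁ P₂ P₃ i q hi hiq hq a₁ a₂ a₃ h₁ h₂ =>
      simp only [F, map_sub, FreeAbelianGroup.lift_apply_of]
      rw [sub_sub, sub_eq_zero]
      obtain ⟨l, hl⟩ := (((Function.Exact.split_tfae' hiq).out 0 1 rfl rfl).1
        ⟨hi, LinearMap.exists_rightInverse_of_surjective q (LinearMap.range_eq_top.2 hq)⟩).2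
      refine cls_exact (P₁ := P₁.baseChange A) (P₂ := P₂.baseChange A) (P₃ := P₃.baseChange A)
        (i.baseChange A) (q.baseChange A) ?_ ?_ ?_ _ _ _ ?_ ?_
      · have : Function.LeftInverse (l.baseChange A) (i.baseChange A) := by
          intro x
          have := congrArg (fun f => f.baseChange A x) hl
          simpa [LinearMap.baseChange_comp] using this
        exact this.injective
      · exact lTensor_exact A hiq hq
      · exact LinearMap.lTensor_surjective A hq
      · intro x
        have : a₂.toLinearMap ∘ₗ i = i ∘ₗ a₁.toLinearMap := LinearMap.ext h₁
        have := congrArg (fun f => f.baseChange A x) this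
        rw [LinearMap.baseChange_comp, LinearMap.baseChange_comp] at this
        exact this
      · intro x
        have : q ∘ₗ a₂.toLinearMap = a₃.toLinearMap ∘ₗ q := LinearMap.ext h₂
        have := congrArg (fun f => f.baseChange A x) this
        rw [LinearMap.baseChange_comp, LinearMap.baseChange_comp] at this
        exact this
  have hx : FreeAbelianGroup.of (⟨P, a⟩ : ProjAut R) ∈
      AddSubgroup.closure {x | K1Rel (R := R) x} := (QuotientAddGroup.eq_zero_iff _).1 h
  have := hF hx
  simpa [F] using this

end K1

end K1

section Virtual

/-- Objects of the Picard category `C_R`: the pair `(P, Q)` stands for `d(P) · d(Q)⁻¹`. -/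
structure VirtObj (R : Type u) [CommRing R] where
  pos : FGProj R
  neg : FGProj R

namespace VirtObj

variable {R : Type u} [CommRing R]

/-- The unit object `1_R = d_R(0)`. -/
abbrev one : VirtObj R := ⟨FGProj.zero, FGProj.zero⟩

/-- Extension of scalars. -/
abbrev baseChange (A : Type u) [CommRing A] [Algebra R A] (X : VirtObj R) : VirtObj A :=
  ⟨X.pos.baseChange A, X.neg.baseChange A⟩

end VirtObj

variable {R : Type u} [CommRing R]

section Isos

variable {A B C D S T N P Q U : Type u}
  [AddCommGroup A] [Module R A] [AddCommGroup B] [Module R B] [AddCommGroup C] [Module R C]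
  [AddCommGroup D] [Module R D] [AddCommGroup S] [Module R S] [AddCommGroup T] [Module R T]
  [AddCommGroup N] [Module R N] [AddCommGroup P] [Module R P] [AddCommGroup Q] [Module R Q]
  [AddCommGroup U] [Module R U]

variable (R A B S N) in
/-- Reassociation of direct sums. -/
def shuffle : (A × B × S × N) ≃ₗ[R] ((A × B × S) × N) where
  toFun x := ((x.1, x.2.1, x.2.2.1), x.2.2.2)
  invFun x := (x.1.1, x.1.2.1, x.1.2.2, x.2)
  map_add' _ _ := rfl
  map_smul' _ _ := rfl
  left_inv _ := rfl
  right_inv _ := rfl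

/-- Replace the isomorphism `φ` with auxiliary module `S` by `φ ⊕ id_N`, with auxiliary module
`S ⊕ N`, and transport it along an isomorphism `S ⊕ N ≅ T`. -/
def extIso (φ : (A × B × S) ≃ₗ[R] (C × D × S)) (e : (S × N) ≃ₗ[R] T) :
    (A × B × T) ≃ₗ[R] (C × D × T) :=
  LinearEquiv.trans
    (LinearEquiv.prodCongr (LinearEquiv.refl R A)
      (LinearEquiv.prodCongr (LinearEquiv.refl R B) e.symm)) <|
    (shuffle R A B S N).trans <|
    (LinearEquiv.prodCongr φ (LinearEquiv.refl R N)).trans <|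
    (shuffle R C D S N).symm.trans <|
    LinearEquiv.prodCongr (LinearEquiv.refl R C)
      (LinearEquiv.prodCongr (LinearEquiv.refl R D) e)

variable (R A B C S T) in
/-- Reordering of direct summands. -/
def compPre : (A × C × B × S × T) ≃ₗ[R] ((A × B × S) × C × T) where
  toFun x := ((x.1, x.2.2.1, x.2.2.2.1), x.2.1, x.2.2.2.2)
  invFun x := (x.1.1, x.2.1, x.1.2.1, x.1.2.2, x.2.2)
  map_add' _ _ := rfl
  map_smul' _ _ := rfl
  left_inv _ := rfl
  right_inv _ := rfl

variable (R A B C S T) in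
/-- Reordering of direct summands. -/
def compMid : ((A × B × S) × C × T) ≃ₗ[R] ((A × C × T) × B × S) where
  toFun x := ((x.1.1, x.2.1, x.2.2), x.1.2.1, x.1.2.2)
  invFun x := ((x.1.1, x.2.1, x.2.2), x.1.2.1, x.1.2.2)
  map_add' _ _ := rfl
  map_smul' _ _ := rfl
  left_inv _ := rfl
  right_inv _ := rfl

variable (R A B C S T) in
/-- Reordering of direct summands, with the sign `-1` on the summand `B`. -/
def compPost : ((A × B × T) × C × S) ≃ₗ[R] (A × C × B × S × T) where
  toFun x := (x.1.1, x.2.1, -x.1.2.1, x.2.2, x.1.2.2)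
  invFun x := ((x.1, -x.2.2.1, x.2.2.2.2), x.2.1, x.2.2.2.1)
  map_add' x y := by simp [add_comm]
  map_smul' a x := by simp
  left_inv x := by simp
  right_inv x := by simp

/-- Composition of `φ : A ⊕ B ⊕ S ≅ C ⊕ D ⊕ S` and `ψ : C ⊕ P ⊕ T ≅ Q ⊕ B ⊕ T`, representing
morphisms `(A, D) ⟶ (C, B) ⟶ (Q, P)`, with auxiliary module `B ⊕ S ⊕ T`: apply `φ` and then `ψ` on
the relevant summands. The copy of `B` in the source is consumed by `φ`, the one in the target is
produced by `ψ`; exchanging two copies of `B` has the class of `-1` on `B` in `K₁(R)`, which the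
sign in `compPost` compensates, so that identities are neutral. -/
def compIso (φ : (A × B × S) ≃ₗ[R] (C × D × S)) (ψ : (C × P × T) ≃ₗ[R] (Q × B × T)) :
    (A × P × B × S × T) ≃ₗ[R] (Q × D × B × S × T) :=
  LinearEquiv.trans (compPre R A B P S T) <|
    (LinearEquiv.prodCongr φ (LinearEquiv.refl R (P × T))).trans <|
    (compMid R C D P S T).trans <|
    (LinearEquiv.prodCongr ψ (LinearEquiv.refl R (D × S))).trans <|
    compPost R Q B D S T

/-- Extension of scalars commutes with threefold direct sums. -/
def prod3 (R' : Type u) [CommRing R'] [Algebra R R'] (A B S : Type u)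
    [AddCommGroup A] [Module R A] [AddCommGroup B] [Module R B] [AddCommGroup S] [Module R S] :
    (R' ⊗[R] (A × B × S)) ≃ₗ[R'] ((R' ⊗[R] A) × (R' ⊗[R] B) × (R' ⊗[R] S)) :=
  (TensorProduct.prodRight R R' R' A (B × S)).trans
    (LinearEquiv.prodCongr (LinearEquiv.refl R' _) (TensorProduct.prodRight R R' R' B S))

/-- Extension of scalars of an isomorphism of threefold direct sums. -/
def bcIso (R' : Type u) [CommRing R'] [Algebra R R'] (φ : (A × B × S) ≃ₗ[R] (C × D × S)) :
    ((R' ⊗[R] A) × (R' ⊗[R] B) × (R' ⊗[R] S)) ≃ₗ[R']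
      ((R' ⊗[R] C) × (R' ⊗[R] D) × (R' ⊗[R] S)) :=
  (prod3 R' A B S).symm.trans <|
    (LinearEquiv.baseChange R R' _ _ φ).trans (prod3 R' C D S)

lemma bcIso_tmul (R' : Type u) [CommRing R'] [Algebra R R'] (φ : (A × B × S) ≃ₗ[R] (C × D × S))
    (a : R') (x : A × B × S) :
    bcIso R' φ (a ⊗ₜ[R] x.1, a ⊗ₜ[R] x.2.1, a ⊗ₜ[R] x.2.2) =
      (a ⊗ₜ[R] (φ x).1, a ⊗ₜ[R] (φ x).2.1, a ⊗ₜ[R] (φ x).2.2) := by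
  have h : (prod3 R' A B S).symm (a ⊗ₜ[R] x.1, a ⊗ₜ[R] x.2.1, a ⊗ₜ[R] x.2.2) = a ⊗ₜ[R] x :=
    (LinearEquiv.symm_apply_eq _).2 rfl
  change prod3 R' C D S (LinearEquiv.baseChange R R' _ _ φ ((prod3 R' A B S).symm _)) = _
  rw [h]
  rfl

lemma prod3_induction (R' : Type u) [CommRing R'] [Algebra R R']
    (f g : ((R' ⊗[R] A) × (R' ⊗[R] B) × (R' ⊗[R] S)) ≃ₗ[R']
      ((R' ⊗[R] C) × (R' ⊗[R] D) × (R' ⊗[R] S)))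
    (h : ∀ (a : R') (x : A × B × S), f (a ⊗ₜ[R] x.1, a ⊗ₜ[R] x.2.1, a ⊗ₜ[R] x.2.2) =
      g (a ⊗ₜ[R] x.1, a ⊗ₜ[R] x.2.1, a ⊗ₜ[R] x.2.2)) : f = g := by
  apply LinearEquiv.ext
  intro y
  obtain ⟨y, rfl⟩ := (prod3 R' A B S).surjective y
  induction y with
  | zero => simp
  | add x y hx hy => simp only [map_add, hx, hy]
  | tmul a x => exact h a x

lemma extIso_bcIso (R' : Type u) [CommRing R'] [Algebra R R']
    (φ : (A × B × S) ≃ₗ[R] (C × D × S)) (e : (S × N) ≃ₗ[R] T) :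
    extIso (bcIso R' φ) ((TensorProduct.prodRight R R' R' S N).symm.trans
      (LinearEquiv.baseChange R R' _ _ e)) = bcIso R' (extIso φ e) := by
  apply prod3_induction
  rintro a ⟨x, y, t⟩
  obtain ⟨⟨s, n⟩, rfl⟩ := e.surjective t
  rw [bcIso_tmul]
  have h1 : ((TensorProduct.prodRight R R' R' S N).symm.trans
      (LinearEquiv.baseChange R R' _ _ e)).symm (a ⊗ₜ[R] e (s, n)) = (a ⊗ₜ[R] s, a ⊗ₜ[R] n) := by
    rw [LinearEquiv.symm_apply_eq, LinearEquiv.trans_apply, TensorProduct.prodRight_symm_tmul]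
    rfl
  have h2 := bcIso_tmul R' φ a (x, y, s)
  simp only at h2
  simp only [extIso, LinearEquiv.trans_apply, LinearEquiv.prodCongr_apply, LinearEquiv.refl_apply,
    h1, shuffle, LinearEquiv.coe_mk, LinearMap.coe_mk, AddHom.coe_mk, LinearEquiv.coe_symm_mk, h2,
    LinearEquiv.symm_apply_apply, TensorProduct.prodRight_symm_tmul]
  rfl

lemma extIso_apply (φ : (A × B × S) ≃ₗ[R] (C × D × S)) (e : (S × N) ≃ₗ[R] T) (x : A × B × T) :
    extIso φ e x = ((φ (x.1, x.2.1, (e.symm x.2.2).1)).1, (φ (x.1, x.2.1, (e.symm x.2.2).1)).2.1,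
      e ((φ (x.1, x.2.1, (e.symm x.2.2).1)).2.2, (e.symm x.2.2).2)) := rfl

lemma compIso_apply (φ : (A × B × S) ≃ₗ[R] (C × D × S)) (ψ : (C × P × T) ≃ₗ[R] (Q × B × T))
    (x : A × P × B × S × T) :
    compIso φ ψ x = compPost R Q B D S T
      (ψ ((φ (x.1, x.2.2.1, x.2.2.2.1)).1, x.2.1, x.2.2.2.2),
        (φ (x.1, x.2.2.1, x.2.2.2.1)).2) := rfl

lemma compPost_apply (x : (A × B × T) × C × S) :
    compPost R A B C S T x = (x.1.1, x.2.1, -x.1.2.1, x.2.2, x.1.2.2) := rfl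

lemma extIso_compIso_left (φ : (A × B × S) ≃ₗ[R] (C × D × S))
    (ψ : (C × P × T) ≃ₗ[R] (Q × B × T)) (e : (S × N) ≃ₗ[R] U) :
    ∃ e' : ((B × S × T) × N) ≃ₗ[R] (B × U × T),
      extIso (compIso φ ψ) e' = compIso (extIso φ e) ψ :=
  ⟨LinearEquiv.trans
      { toFun := fun x => (x.1.1, (x.1.2.1, x.2), x.1.2.2)
        invFun := fun x => ((x.1, x.2.1.1, x.2.2), x.2.1.2)
        map_add' := fun _ _ => rfl
        map_smul' := fun _ _ => rfl
        left_inv := fun _ => rfl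
        right_inv := fun _ => rfl }
      (LinearEquiv.prodCongr (LinearEquiv.refl R B)
        (LinearEquiv.prodCongr e (LinearEquiv.refl R T))), by
    apply LinearEquiv.ext
    rintro ⟨a, p, b, s, t⟩
    rw [extIso_apply, compIso_apply, compIso_apply, compPost_apply, compPost_apply, extIso_apply]
    rfl⟩

lemma extIso_compIso_right (φ : (A × B × S) ≃ₗ[R] (C × D × S))
    (ψ : (C × P × T) ≃ₗ[R] (Q × B × T)) (e : (T × N) ≃ₗ[R] U) :
    ∃ e' : ((B × S × T) × N) ≃ₗ[R] (B × S × U),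
      extIso (compIso φ ψ) e' = compIso φ (extIso ψ e) :=
  ⟨LinearEquiv.trans
      { toFun := fun x => (x.1.1, x.1.2.1, x.1.2.2, x.2)
        invFun := fun x => ((x.1, x.2.1, x.2.2.1), x.2.2.2)
        map_add' := fun _ _ => rfl
        map_smul' := fun _ _ => rfl
        left_inv := fun _ => rfl
        right_inv := fun _ => rfl }
      (LinearEquiv.prodCongr (LinearEquiv.refl R B)
        (LinearEquiv.prodCongr (LinearEquiv.refl R S) e)), by
    apply LinearEquiv.ext
    rintro ⟨a, p, b, s, t⟩
    rw [extIso_apply, compIso_apply, compIso_apply, compPost_apply, compPost_apply, extIso_apply]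
    rfl⟩

end Isos

/-- A representative of a morphism `(P, Q) ⟶ (P', Q')`: an isomorphism
`P ⊕ Q' ⊕ S ≅ P' ⊕ Q ⊕ S` with `S` finitely generated projective. It exists if and only if
`[P] - [Q] = [P'] - [Q']` in `K₀(R)`. -/
structure StableIso (X Y : VirtObj R) where
  stab : FGProj R
  iso : (X.pos × Y.neg × stab) ≃ₗ[R] (Y.pos × X.neg × stab)

namespace StableIso

variable {X Y Z : VirtObj R}

/-- Two representatives are identified if, after enlarging the auxiliary module of the first one,
they differ by an automorphism whose class in `K₁(R)` is trivial. -/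
def Rel (f g : StableIso X Y) : Prop :=
  ∃ (N : FGProj R) (e : (f.stab × N) ≃ₗ[R] g.stab),
    K1.cls (X.pos.prod (Y.neg.prod g.stab)) ((extIso f.iso e).trans g.iso.symm) = 0

/-- Composition of representatives. -/
def comp (f : StableIso X Y) (g : StableIso Y Z) : StableIso X Z where
  stab := Y.neg.prod (f.stab.prod g.stab)
  iso := compIso f.iso g.iso

lemma comp_rel_left {f f' : StableIso X Y} (h : f.Rel f') (g : StableIso Y Z) :
    (f.comp g).Rel (f'.comp g) := by
  obtain ⟨N, e, h⟩ := h
  obtain ⟨e', he'⟩ := extIso_compIso_left f.iso g.iso e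
  refine ⟨N, e', Eq.trans ?_ h⟩
  change K1.cls (X.pos.prod (Z.neg.prod (Y.neg.prod (f'.stab.prod g.stab))))
    ((extIso (compIso f.iso g.iso) e').trans (compIso f'.iso g.iso).symm) = _
  rw [he']
  refine K1.cls_eq_of_prod (P := X.pos.prod (Y.neg.prod f'.stab)) (N := Z.neg.prod g.stab)
    (Q := X.pos.prod (Z.neg.prod (Y.neg.prod (f'.stab.prod g.stab))))
    (compPre R X.pos Y.neg Z.neg f'.stab g.stab).symm _ _ ?_
  intro x
  rw [LinearEquiv.trans_apply, LinearEquiv.symm_apply_eq]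
  simp [compIso]

lemma comp_rel_right (f : StableIso X Y) {g g' : StableIso Y Z} (h : g.Rel g') :
    (f.comp g).Rel (f.comp g') := by
  obtain ⟨N, e, h⟩ := h
  obtain ⟨e', he'⟩ := extIso_compIso_right f.iso g.iso e
  refine ⟨N, e', Eq.trans ?_ h⟩
  change K1.cls (X.pos.prod (Z.neg.prod (Y.neg.prod (f.stab.prod g'.stab))))
    ((extIso (compIso f.iso g.iso) e').trans (compIso f.iso g'.iso).symm) = _
  rw [he']
  refine K1.cls_eq_of_prod (P := Y.pos.prod (Z.neg.prod g'.stab)) (N := X.neg.prod f.stab)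
    (Q := X.pos.prod (Z.neg.prod (Y.neg.prod (f.stab.prod g'.stab))))
    ((compPre R X.pos Y.neg Z.neg f.stab g'.stab).trans
      ((LinearEquiv.prodCongr f.iso (LinearEquiv.refl R (Z.neg × g'.stab))).trans
      (compMid R Y.pos X.neg Z.neg f.stab g'.stab))).symm _ _ ?_
  intro x
  rw [LinearEquiv.trans_apply, LinearEquiv.symm_apply_eq]
  simp [compIso]

/-- Extension of scalars. -/
def baseChange (R' : Type u) [CommRing R'] [Algebra R R'] (f : StableIso X Y) :
    StableIso (X.baseChange R') (Y.baseChange R') where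
  stab := f.stab.baseChange R'
  iso := bcIso R' f.iso

lemma baseChange_rel (R' : Type u) [CommRing R'] [Algebra R R'] {f g : StableIso X Y}
    (h : f.Rel g) : (f.baseChange R').Rel (g.baseChange R') := by
  obtain ⟨N, e, h⟩ := h
  obtain ⟨e', he'⟩ : ∃ e' : ((R' ⊗[R] f.stab) × (R' ⊗[R] N)) ≃ₗ[R'] (R' ⊗[R] g.stab),
      extIso (bcIso R' f.iso) e' = bcIso R' (extIso f.iso e) := ⟨_, extIso_bcIso R' f.iso e⟩
  refine ⟨N.baseChange R', e', Eq.trans ?_ (K1.cls_baseChange R' _ _ h)⟩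
  change K1.cls ((X.pos.baseChange R').prod ((Y.neg.baseChange R').prod (g.stab.baseChange R')))
    ((extIso (bcIso R' f.iso) e').trans (bcIso R' g.iso).symm) = _
  rw [he']
  refine K1.cls_eq_of_equiv (P := (X.pos.prod (Y.neg.prod g.stab)).baseChange R')
    (Q := (X.pos.baseChange R').prod ((Y.neg.baseChange R').prod (g.stab.baseChange R')))
    (prod3 R' X.pos Y.neg g.stab) _ _ ?_
  intro x
  rw [LinearEquiv.trans_apply, LinearEquiv.symm_apply_eq]
  simp only [bcIso, LinearEquiv.trans_apply, LinearEquiv.symm_apply_apply]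
  congr 1
  induction x using TensorProduct.induction_on with
  | zero => simp
  | add x y hx hy => simp only [map_add, hx, hy]
  | tmul a m =>
    change a ⊗ₜ[R] (extIso f.iso e m) =
      a ⊗ₜ[R] (g.iso (g.iso.symm (extIso f.iso e m)))
    rw [LinearEquiv.apply_symm_apply]

end StableIso

/-- Morphisms of the Picard category `C_R`. -/
def Mor (X Y : VirtObj R) : Type (u + 1) := Quot (StableIso.Rel (X := X) (Y := Y))

namespace Mor

variable {X Y Z : VirtObj R}

/-- The morphism given by a representative. -/
def mk (f : StableIso X Y) : Mor X Y := Quot.mk _ f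

/-- Composition of morphisms, in diagrammatic order. -/
def comp (f : Mor X Y) (g : Mor Y Z) : Mor X Z :=
  Quot.map₂ StableIso.comp (fun f _ _ h => StableIso.comp_rel_right f h)
    (fun _ _ g h => StableIso.comp_rel_left h g) f g

/-- Extension of scalars. -/
def baseChange (A : Type u) [CommRing A] [Algebra R A] (f : Mor X Y) :
    Mor (X.baseChange A) (Y.baseChange A) :=
  Quot.map (StableIso.baseChange A) (fun _ _ h => StableIso.baseChange_rel A h) f

end Mor

end Virtual

section Folded

/-- A `ℤ/2`-graded complex of finitely generated projective modules. -/
structure FoldedComplex (R : Type u) [CommRing R] where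
  even : FGProj R
  odd : FGProj R
  dEven : even →ₗ[R] odd
  dOdd : odd →ₗ[R] even
  dOdd_dEven : dOdd ∘ₗ dEven = 0
  dEven_dOdd : dEven ∘ₗ dOdd = 0

namespace FoldedComplex

variable {R : Type u} [CommRing R]

/-- Extension of scalars. -/
def baseChange (R' : Type u) [CommRing R'] [Algebra R R'] (F : FoldedComplex R) :
    FoldedComplex R' where
  even := F.even.baseChange R'
  odd := F.odd.baseChange R'
  dEven := F.dEven.baseChange R'
  dOdd := F.dOdd.baseChange R'
  dOdd_dEven := by rw [← LinearMap.baseChange_comp, F.dOdd_dEven, LinearMap.baseChange_zero]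
  dEven_dOdd := by rw [← LinearMap.baseChange_comp, F.dEven_dOdd, LinearMap.baseChange_zero]

/-- The determinant of a complex is `d(even part) · d(odd part)⁻¹`. -/
abbrev det (F : FoldedComplex R) : VirtObj R := ⟨F.even, F.odd⟩

/-- A contracting homotopy `s` of square zero. -/
structure Contraction (F : FoldedComplex R) where
  sEven : F.even →ₗ[R] F.odd
  sOdd : F.odd →ₗ[R] F.even
  homotopy_even : F.dOdd ∘ₗ sEven + sOdd ∘ₗ F.dEven = LinearMap.id
  homotopy_odd : F.dEven ∘ₗ sOdd + sEven ∘ₗ F.dOdd = LinearMap.id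
  sOdd_sEven : sOdd ∘ₗ sEven = 0
  sEven_sOdd : sEven ∘ₗ sOdd = 0

/-- For a contraction `s` the map `d + s` from the odd to the even part is an isomorphism,
with inverse `d + s`. -/
def Contraction.equiv {F : FoldedComplex R} (s : F.Contraction) : F.odd ≃ₗ[R] F.even :=
  LinearEquiv.ofLinearMap (F.dOdd + s.sOdd) (F.dEven + s.sEven)
    (by
      rw [LinearMap.add_comp, LinearMap.comp_add, LinearMap.comp_add, F.dOdd_dEven, s.sOdd_sEven,
        zero_add, add_zero, s.homotopy_even])
    (by
      rw [LinearMap.add_comp, LinearMap.comp_add, LinearMap.comp_add, F.dEven_dOdd, s.sEven_sOdd,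
        zero_add, add_zero, s.homotopy_odd])

/-- The isomorphism `1_R ⟶ d_R(F)` attached to an acyclic complex `F` with contraction `s`. If
`F` is a complex `[P ⟶ P]` given by an isomorphism `φ`, in degrees `0` and `1`, it is `φ⁻¹`. The
unit object is allowed to be any pair `X` of zero modules, since extension of scalars turns `one`
into such a pair. -/
def Contraction.triv {F : FoldedComplex R} (s : F.Contraction) (X : VirtObj R)
    [Subsingleton X.pos] [Subsingleton X.neg] : Mor X F.det :=
  Mor.mk
    { stab := FGProj.zero
      iso :=
        { toFun := fun x => (s.equiv x.2.1, 0, x.2.2)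
          invFun := fun x => (0, s.equiv.symm x.1, x.2.2)
          map_add' := fun x y => by simp
          map_smul' := fun a x => by simp
          left_inv := fun x => Prod.ext (Subsingleton.elim _ _) (by simp)
          right_inv := fun x => Prod.ext (by simp) (Prod.ext (Subsingleton.elim _ _) rfl) } }

/-- Morphisms of `ℤ/2`-graded complexes. -/
structure Hom (F F' : FoldedComplex R) where
  even : F.even →ₗ[R] F'.even
  odd : F.odd →ₗ[R] F'.odd
  comm_even : F'.dEven ∘ₗ even = odd ∘ₗ F.dEven
  comm_odd : F'.dOdd ∘ₗ odd = even ∘ₗ F.dOdd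

/-- The mapping cone, with underlying graded module `F' ⊕ F[1]`. -/
def cone {F F' : FoldedComplex R} (f : Hom F F') : FoldedComplex R where
  even := F'.even.prod F.odd
  odd := F'.odd.prod F.even
  dEven := (F'.dEven.coprod f.odd).prod (-(F.dOdd ∘ₗ LinearMap.snd R _ _))
  dOdd := (F'.dOdd.coprod f.even).prod (-(F.dEven ∘ₗ LinearMap.snd R _ _))
  dOdd_dEven := by
    have h1 := LinearMap.congr_fun F'.dOdd_dEven
    have h2 := LinearMap.congr_fun F.dEven_dOdd
    have h3 := LinearMap.congr_fun f.comm_odd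
    simp only [LinearMap.comp_apply, LinearMap.zero_apply] at h1 h2 h3
    apply LinearMap.ext
    rintro ⟨x, y⟩
    simp [h1, h2, h3]
  dEven_dOdd := by
    have h1 := LinearMap.congr_fun F'.dEven_dOdd
    have h2 := LinearMap.congr_fun F.dOdd_dEven
    have h3 := LinearMap.congr_fun f.comm_even
    simp only [LinearMap.comp_apply, LinearMap.zero_apply] at h1 h2 h3
    apply LinearMap.ext
    rintro ⟨x, y⟩
    simp [h1, h2, h3]

/-- The isomorphism `d_R(f) : d_R(F) ⟶ d_R(F')` attached to a morphism `f` with contractible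
cone: it is the trivialisation of `d_R(cone f) = d_R(F') · d_R(F)⁻¹`. -/
def detMap {F F' : FoldedComplex R} (f : Hom F F') (s : (cone f).Contraction) :
    Mor F.det F'.det :=
  Mor.mk
    { stab := FGProj.zero
      iso := (LinearEquiv.prodAssoc R F.even F'.odd _).symm.trans <|
        (LinearEquiv.prodCongr ((LinearEquiv.prodComm R F.even F'.odd).trans s.equiv)
          (LinearEquiv.refl R _)).trans (LinearEquiv.prodAssoc R F'.even F.odd _) }

end FoldedComplex

end Folded

section Complexes

open CategoryTheory

/-- Strictly perfect complexes: bounded cochain complexes of finitely generated projective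
modules. -/
structure StrictlyPerfect (R : Type u) [CommRing R] where
  cpx : CochainComplex (ModuleCat.{u} R) ℤ
  finite : ∀ i, Module.Finite R (cpx.X i)
  projective : ∀ i, Module.Projective R (cpx.X i)
  bounded : ∃ a b : ℤ, ∀ i, i < a ∨ b < i → Subsingleton (cpx.X i)

namespace StrictlyPerfect

variable {R : Type u} [CommRing R]

attribute [instance] finite projective

lemma finite_directSum (C : StrictlyPerfect R) (p : ℤ → Prop) :
    Module.Finite R (DirectSum {i : ℤ // p i} fun i => C.cpx.X i) := by
  classical
  obtain ⟨a, b, hab⟩ := C.bounded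
  let t : Set {i : ℤ // p i} := {i | i.1 ∈ Set.Icc a b}
  have ht : t.Finite := (Set.finite_Icc a b).preimage Subtype.val_injective.injOn
  have h : (⨆ i ∈ ht.toFinset,
      LinearMap.range (DirectSum.lof R {i : ℤ // p i} (fun i => C.cpx.X i) i)) = ⊤ := by
    rw [eq_top_iff]
    intro x _
    induction x using DirectSum.induction_on with
    | zero => exact Submodule.zero_mem _
    | add x y hx hy => exact Submodule.add_mem _ (hx trivial) (hy trivial)
    | of i x =>
      by_cases hi : i ∈ t
      · exact Submodule.mem_iSup_of_mem i
          (Submodule.mem_iSup_of_mem (ht.mem_toFinset.2 hi) ⟨x, rfl⟩)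
      · have := hab i.1 (by
          by_contra hcon
          push Not at hcon
          exact hi ⟨hcon.1, hcon.2⟩)
        rw [Subsingleton.elim x 0, map_zero]
        exact Submodule.zero_mem _
  refine ⟨h ▸ Submodule.fg_biSup _ _ fun i _ => ?_⟩
  rw [LinearMap.range_eq_map]
  exact Submodule.FG.map _ Module.Finite.fg_top

/-- The direct sum of the terms of even degree. -/
abbrev evenPart (C : StrictlyPerfect R) : FGProj R :=
  letI := C.finite_directSum Even
  ⟨DirectSum {i : ℤ // Even i} fun i => C.cpx.X i⟩

/-- The direct sum of the terms of odd degree. -/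
abbrev oddPart (C : StrictlyPerfect R) : FGProj R :=
  letI := C.finite_directSum Odd
  ⟨DirectSum {i : ℤ // Odd i} fun i => C.cpx.X i⟩

/-- The differential from even to odd degrees. -/
def dEven (C : StrictlyPerfect R) : (DirectSum {i : ℤ // Even i} fun i => C.cpx.X i) →ₗ[R]
    DirectSum {i : ℤ // Odd i} fun i => C.cpx.X i :=
  DirectSum.toModule R _ _ fun i =>
    (DirectSum.lof R {i : ℤ // Odd i} (fun i => C.cpx.X i) ⟨i.1 + 1, i.2.add_one⟩) ∘ₗ
      (C.cpx.d i.1 (i.1 + 1)).hom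

/-- The differential from odd to even degrees. -/
def dOdd (C : StrictlyPerfect R) : (DirectSum {i : ℤ // Odd i} fun i => C.cpx.X i) →ₗ[R]
    DirectSum {i : ℤ // Even i} fun i => C.cpx.X i :=
  DirectSum.toModule R _ _ fun i =>
    (DirectSum.lof R {i : ℤ // Even i} (fun i => C.cpx.X i) ⟨i.1 + 1, i.2.add_one⟩) ∘ₗ
      (C.cpx.d i.1 (i.1 + 1)).hom

lemma dOdd_dEven (C : StrictlyPerfect R) : C.dOdd ∘ₗ C.dEven = 0 := by
  refine DirectSum.linearMap_ext _ fun i => LinearMap.ext fun x => ?_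
  have h := congrArg (fun f => f.hom x) (C.cpx.d_comp_d i.1 (i.1 + 1) (i.1 + 1 + 1))
  simp only [ModuleCat.hom_comp, LinearMap.comp_apply] at h
  simp [dEven, dOdd, DirectSum.toModule_lof, h]

lemma dEven_dOdd (C : StrictlyPerfect R) : C.dEven ∘ₗ C.dOdd = 0 := by
  refine DirectSum.linearMap_ext _ fun i => LinearMap.ext fun x => ?_
  have h := congrArg (fun f => f.hom x) (C.cpx.d_comp_d i.1 (i.1 + 1) (i.1 + 1 + 1))
  simp only [ModuleCat.hom_comp, LinearMap.comp_apply] at h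
  simp [dEven, dOdd, DirectSum.toModule_lof, h]

/-- The complex, regarded as a `ℤ/2`-graded complex. -/
def fold (C : StrictlyPerfect R) : FoldedComplex R where
  even := C.evenPart
  odd := C.oddPart
  dEven := C.dEven
  dOdd := C.dOdd
  dOdd_dEven := C.dOdd_dEven
  dEven_dOdd := C.dEven_dOdd

/-- The sum of the components in the degrees satisfying `p` of a morphism of complexes. -/
def mapPart {C C' : StrictlyPerfect R} (f : C.cpx ⟶ C'.cpx) (p : ℤ → Prop) :
    (DirectSum {i : ℤ // p i} fun i => C.cpx.X i) →ₗ[R]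
      DirectSum {i : ℤ // p i} fun i => C'.cpx.X i :=
  DirectSum.lmap fun i => (f.f i.1).hom

lemma mapPart_even {C C' : StrictlyPerfect R} (f : C.cpx ⟶ C'.cpx) :
    C'.dEven ∘ₗ mapPart f Even = mapPart f Odd ∘ₗ C.dEven := by
  refine DirectSum.linearMap_ext _ fun i => LinearMap.ext fun x => ?_
  have h := congrArg (fun f => f.hom x) (f.comm i.1 (i.1 + 1))
  simp only [ModuleCat.hom_comp, LinearMap.comp_apply] at h
  simp [dEven, mapPart, DirectSum.toModule_lof, DirectSum.lmap_lof, h]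

lemma mapPart_odd {C C' : StrictlyPerfect R} (f : C.cpx ⟶ C'.cpx) :
    C'.dOdd ∘ₗ mapPart f Odd = mapPart f Even ∘ₗ C.dOdd := by
  refine DirectSum.linearMap_ext _ fun i => LinearMap.ext fun x => ?_
  have h := congrArg (fun f => f.hom x) (f.comm i.1 (i.1 + 1))
  simp only [ModuleCat.hom_comp, LinearMap.comp_apply] at h
  simp [dOdd, mapPart, DirectSum.toModule_lof, DirectSum.lmap_lof, h]

/-- The morphism of `ℤ/2`-graded complexes given by a morphism of complexes. -/
def foldMap {C C' : StrictlyPerfect R} (f : C.cpx ⟶ C'.cpx) :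
    FoldedComplex.Hom C.fold C'.fold where
  even := mapPart f Even
  odd := mapPart f Odd
  comm_even := mapPart_even f
  comm_odd := mapPart_odd f

/-- The determinant `d_R(C)` of a strictly perfect complex. -/
abbrev det (C : StrictlyPerfect R) : VirtObj R := C.fold.det

end StrictlyPerfect

/-- A strictly perfect complex with a quasi-isomorphism to the module `M` placed in degree `0`,
so that `d_R(M) = d_R(C)`. -/
structure Resolution (R : Type u) [CommRing R] (M : Type u) [AddCommGroup M] [Module R M] where
  C : StrictlyPerfect R
  π : C.cpx ⟶ (HomologicalComplex.single (ModuleCat.{u} R) (ComplexShape.up ℤ) 0).obj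
    (ModuleCat.of R M)
  quasiIso : QuasiIso π

variable {R : Type u} [CommRing R] {M : Type u} [AddCommGroup M] [Module R M]

/-- A morphism `1_R ⟶ d_R(M)`: since `d_R(M)` is computed by any strictly perfect resolution of
`M`, this is a family of morphisms `1_R ⟶ d_R(C)`, one for each resolution `C`, which is compatible
with the isomorphisms `d_R(f)` for all quasi-isomorphisms `f` between resolutions. -/
def IsNatural (c : ∀ ρ : Resolution R M, Mor VirtObj.one ρ.C.det) : Prop :=
  ∀ (ρ ρ' : Resolution R M) (f : ρ.C.cpx ⟶ ρ'.C.cpx), QuasiIso f →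
    ∃ s : (FoldedComplex.cone (StrictlyPerfect.foldMap f)).Contraction,
      (c ρ).comp (FoldedComplex.detMap (StrictlyPerfect.foldMap f) s) = c ρ'

/-- For every prime ideal `𝔭` of height at most one, the localisation of the morphism at `𝔭` is
the trivialisation of `d_{R_𝔭}(M_𝔭)` by acyclicity (so in particular `M_𝔭 = 0`). -/
def IsLocallyAcyclic (c : ∀ ρ : Resolution R M, Mor VirtObj.one ρ.C.det) : Prop :=
  ∀ (ρ : Resolution R M) (𝔭 : Ideal R) [𝔭.IsPrime], 𝔭.height ≤ 1 →
    ∃ s : (ρ.C.fold.baseChange (Localization.AtPrime 𝔭)).Contraction,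
      (c ρ).baseChange (Localization.AtPrime 𝔭) =
        s.triv (VirtObj.one.baseChange (Localization.AtPrime 𝔭))

variable (R M) in
/-- `M` is perfect, so that `d_R(M)` is defined, and there is exactly one morphism
`1_R ⟶ d_R(M)` which at all primes of height at most one is the trivialisation by acyclicity. -/
def HasCanonicalTrivialization : Prop :=
  Nonempty (Resolution R M) ∧
    ∃! c : ∀ ρ : Resolution R M, Mor VirtObj.one ρ.C.det, IsNatural c ∧ IsLocallyAcyclic c

end Complexes

/-- The Krull codimension of a module: the infimum of the heights of the primes in its support. -/
def krullCodim (R : Type u) [CommRing R] (M : Type u) [AddCommGroup M] [Module R M] : ℕ∞ :=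
  ⨅ 𝔭 ∈ Module.support R M, 𝔭.asIdeal.height

end DetFunctor

namespace Iwasawa

section Algebra

variable (p : ℕ) [Fact p.Prime] (G : Type u) [CommGroup G] [TopologicalSpace G]

/-- The transition maps `ℤ_p[G/U] → ℤ_p[G/V]` for open subgroups `U ≤ V`. -/
def transition (U V : OpenSubgroup G) (h : U ≤ V) :
    MonoidAlgebra ℤ_[p] (G ⧸ (U : Subgroup G)) →+* MonoidAlgebra ℤ_[p] (G ⧸ (V : Subgroup G)) :=
  MonoidAlgebra.mapDomainRingHom ℤ_[p]
    (QuotientGroup.map (U : Subgroup G) (V : Subgroup G) (MonoidHom.id G) h)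

/-- The Iwasawa algebra `Λ(G) = lim ℤ_p[G/U]`, the limit over the open subgroups of the
commutative topological group `G`. -/
def iwasawaSubring :
    Subring (∀ U : OpenSubgroup G, MonoidAlgebra ℤ_[p] (G ⧸ (U : Subgroup G))) where
  carrier := {x | ∀ (U V : OpenSubgroup G) (h : U ≤ V), transition p G U V h (x U) = x V}
  mul_mem' hx hy U V h := by simp [hx U V h, hy U V h]
  one_mem' U V h := by simp
  add_mem' hx hy U V h := by simp [hx U V h, hy U V h]
  zero_mem' U V h := by simp
  neg_mem' hx U V h := by simp [hx U V h]

/-- The Iwasawa algebra `Λ(G)`. -/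
abbrev IwasawaAlgebra : Type u := iwasawaSubring p G

/-- The projection `Λ(G) → ℤ_p[G/U]`. -/
def proj (U : OpenSubgroup G) :
    IwasawaAlgebra p G →+* MonoidAlgebra ℤ_[p] (G ⧸ (U : Subgroup G)) :=
  (Pi.evalRingHom _ U).comp (iwasawaSubring p G).subtype

end Algebra

section Character

variable {p : ℕ} [Fact p.Prime] {G : Type u} [CommGroup G] [TopologicalSpace G]

/-- The reduction of a character `χ : G → ℤ_pˣ` modulo `p ^ n`. -/
def charMod (χ : G →ₜ* ℤ_[p]ˣ) (n : ℕ) : G →* ZMod (p ^ n) :=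
  ((PadicInt.toZModPow (p := p) n).toMonoidHom.comp (Units.coeHom ℤ_[p])).comp χ.toMonoidHom

/-- The open subgroup of all `g` with `χ(g) ≡ 1` modulo `p ^ n`. -/
def charKer (χ : G →ₜ* ℤ_[p]ˣ) (n : ℕ) : OpenSubgroup G where
  toSubgroup := (charMod χ n).toHomUnits.ker
  isOpen' := by
    have h : (((charMod χ n).toHomUnits.ker : Subgroup G) : Set G) =
        (fun g => ((χ g : ℤ_[p]ˣ) : ℤ_[p]) - 1) ⁻¹' {x | ‖x‖ < (p : ℝ) ^ (-(n : ℤ) + 1)} := by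
      ext g
      rw [Set.mem_preimage, Set.mem_ofPred_eq, PadicInt.norm_lt_pow_iff_norm_le_pow_sub_one,
        add_sub_cancel_right, PadicInt.norm_le_pow_iff_mem_span_pow, ← PadicInt.ker_toZModPow,
        RingHom.mem_ker, map_sub, map_one, sub_eq_zero, SetLike.mem_coe, MonoidHom.mem_ker,
        Units.ext_iff]
      rfl
    change IsOpen (((charMod χ n).toHomUnits.ker : Subgroup G) : Set G)
    rw [h]
    refine IsOpen.preimage ?_ (isOpen_lt continuous_norm continuous_const)
    exact (Units.continuous_val.comp χ.continuous_toFun).sub continuous_const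

/-- The character of `G / charKer χ n` induced by `χ` modulo `p ^ n`. -/
def charQuot (χ : G →ₜ* ℤ_[p]ˣ) (n : ℕ) :
    (G ⧸ ((charKer χ n : OpenSubgroup G) : Subgroup G)) →* ZMod (p ^ n) :=
  (Units.coeHom _).comp (QuotientGroup.lift _ (charMod χ n).toHomUnits fun _ h => h)

/-- The ring homomorphism `Λ(G) → ℤ/p^n` induced by `χ`. -/
def charHomMod (χ : G →ₜ* ℤ_[p]ˣ) (n : ℕ) : IwasawaAlgebra p G →+* ZMod (p ^ n) :=
  (MonoidAlgebra.liftNCRingHom (PadicInt.toZModPow (p := p) n) (charQuot χ n)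
    (fun _ _ => Commute.all _ _)).comp (proj p G (charKer χ n))

lemma charHomMod_compat (χ : G →ₜ* ℤ_[p]ˣ) (m n : ℕ) (h : m ≤ n) :
    (ZMod.castHom (pow_dvd_pow p h) (ZMod (p ^ m))).comp (charHomMod χ n) = charHomMod χ m := by
  have hle : charKer χ n ≤ charKer χ m := by
    intro g hg
    have hg' : PadicInt.toZModPow (p := p) n (χ g : ℤ_[p]ˣ) = 1 := congrArg Units.val hg
    refine Units.ext (?_ : PadicInt.toZModPow (p := p) m (χ g : ℤ_[p]ˣ) = 1)
    rw [← PadicInt.zmod_cast_comp_toZModPow m n h, RingHom.comp_apply, hg', map_one]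
  have key : (ZMod.castHom (pow_dvd_pow p h) (ZMod (p ^ m))).comp
      (MonoidAlgebra.liftNCRingHom (PadicInt.toZModPow (p := p) n) (charQuot χ n)
        (fun _ _ => Commute.all _ _)) =
      (MonoidAlgebra.liftNCRingHom (PadicInt.toZModPow (p := p) m) (charQuot χ m)
        (fun _ _ => Commute.all _ _)).comp (transition p G _ _ hle) := by
    apply MonoidAlgebra.ringHom_ext
    · intro r
      have := RingHom.congr_fun (PadicInt.zmod_cast_comp_toZModPow (p := p) m n h) r
      simpa [transition, MonoidAlgebra.liftNCRingHom] using this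
    · intro g
      induction g using QuotientGroup.induction_on with
      | H g =>
        have := RingHom.congr_fun (PadicInt.zmod_cast_comp_toZModPow (p := p) m n h)
          (χ g : ℤ_[p]ˣ)
        simp [transition, MonoidAlgebra.liftNCRingHom] at this ⊢
        exact this
  apply RingHom.ext
  intro x
  have hx := RingHom.congr_fun key (proj p G (charKer χ n) x)
  rw [RingHom.comp_apply] at hx
  refine hx.trans ?_
  rw [RingHom.comp_apply]
  exact congrArg _ (x.2 _ _ hle)

/-- The ring homomorphism `Λ(G) → ℤ_p` which extends the continuous character `χ : G → ℤ_pˣ`. -/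
def charHom (χ : G →ₜ* ℤ_[p]ˣ) : IwasawaAlgebra p G →+* ℤ_[p] :=
  PadicInt.lift (f := charHomMod χ) fun m n h => charHomMod_compat χ m n h

/-- The `Λ(G)`-module `ℤ_p(r)`: the group `ℤ_p` (lifted to the universe of `G`), with `G` acting
through the `r`-th power of the character `κ`. -/
def TateTwist (_κ : G →ₜ* ℤ_[p]ˣ) (_r : ℤ) : Type u := ULift.{u} ℤ_[p]

instance (κ : G →ₜ* ℤ_[p]ˣ) (r : ℤ) : AddCommGroup (TateTwist κ r) :=
  inferInstanceAs (AddCommGroup (ULift.{u} ℤ_[p]))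

instance (κ : G →ₜ* ℤ_[p]ˣ) (r : ℤ) : Module (IwasawaAlgebra p G) (TateTwist κ r) :=
  Module.compHom (ULift.{u} ℤ_[p]) (charHom (κ ^ r))

end Character

end Iwasawa

end

/-! The argument has two halves. The first proves the theorem over any ring `R` that is noetherian,
semilocal and such that every finitely generated module has finite projective dimension
(`IsRegularSemilocal`), for a module whose annihilator lies in no prime of height at most one. The
second shows that `Λ` is such a ring and that the modules in question satisfy the condition.

Over a semilocal ring an automorphism of determinant one is trivial in `K₁` (stable range one and
Gaussian elimination). Let `C` be a resolution of `M`. Its odd and even parts have the same rank,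
hence are isomorphic, and once an isomorphism is fixed the morphisms from `1` to `d(C)` correspond
to units of `R` through a determinant. At a prime `q` of height at most one, `C_q` is contractible,
and the determinant of `d + s` is a unit of `R_q` which does not depend on the contraction `s`. The
annihilator of `M` contains a nonzerodivisor, so `C` is also contractible over the total ring of
fractions, and all local units are given by one fraction `a/b` (`Resolution.exists_unit_relDet`).

Finite projective dimension forces the associated primes of `R/(b)`, for `b` zero or regular, to
have height at most one, by an argument in the style of Auslander and Buchsbaum
(`free_of_hasProjectiveDimensionLE`). Hence equality of elements and membership in `(b)` can be
tested at these primes. So `a/b` lies in `R`, is a unit, and is determined by its localisations: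
this is existence and uniqueness. Naturality follows from uniqueness, since at the primes in
question both complexes are contractible and the cone of a map between them has a triangular
contraction (`triv_comp_detMap`).

For `Λ` one inducts on the rank of the group. If `γ` generates a direct factor `ℤ_p`, then `γ - 1`
is regular and the quotient by it is the Iwasawa algebra of the remaining factors; at rank zero the
quotient by `p` is `𝔽_p[Δ]`, which is semisimple because `p` does not divide the order of `Δ`.
Compactness of `Λ` and separatedness for the powers of the element divided out let the three
properties be lifted from the quotient.

For `ℤ_p(r)` with character `χ`, two independent directions `γ₁`, `γ₂` exist as `k ≥ 2`. The
elements `γᵢ - χ(γᵢ)` form a regular sequence in the annihilator once the `γᵢ` are chosen with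
`χ(γᵢ) ≡ 1` modulo `p`, so primes containing the annihilator have height at least two. -/

noncomputable section

open TensorProduct

namespace DetFunctor

/-! ### Determinants of endomorphisms of finitely generated projective modules. -/

section ProjectiveDeterminant

variable {R : Type*} [CommRing R]

/-- The Weinstein–Aronszajn identity for linear maps. -/
lemma linearMap_det_one_add_comm {M N : Type*} [AddCommGroup M] [Module R M] [Module.Free R M]
    [Module.Finite R M] [AddCommGroup N] [Module R N] [Module.Free R N] [Module.Finite R N]
    (f : M →ₗ[R] N) (g : N →ₗ[R] M) :
    LinearMap.det (LinearMap.id + f ∘ₗ g) = LinearMap.det (LinearMap.id + g ∘ₗ f) := by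
  classical
  let b := Module.Free.chooseBasis R M
  let c := Module.Free.chooseBasis R N
  rw [← LinearMap.det_toMatrix b, ← LinearMap.det_toMatrix c, map_add, map_add,
    LinearMap.toMatrix_id, LinearMap.toMatrix_id, LinearMap.toMatrix_comp c b c,
    LinearMap.toMatrix_comp b c b, Matrix.det_one_add_mul_comm]

variable {P Q : Type*} [AddCommGroup P] [Module R P] [AddCommGroup Q] [Module R Q]
  [Module.Finite R P] [Module.Projective R P] [Module.Finite R Q] [Module.Projective R Q]

variable (R P) in
lemma exists_retract_of_projective :
    ∃ (n : ℕ) (s : P →ₗ[R] (Fin n → R)) (π : (Fin n → R) →ₗ[R] P), π ∘ₗ s = LinearMap.id := by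
  obtain ⟨n, π, hπ⟩ := Module.Finite.exists_fin' R P
  obtain ⟨s, hs⟩ := Module.projective_lifting_property π LinearMap.id hπ
  exact ⟨n, s, π, hs⟩

/-- The determinant of an endomorphism of a finitely generated projective module. -/
def pdet (a : P →ₗ[R] P) : R :=
  LinearMap.det (LinearMap.id + (exists_retract_of_projective R P).choose_spec.choose ∘ₗ
    (a - LinearMap.id) ∘ₗ (exists_retract_of_projective R P).choose_spec.choose_spec.choose)

/-- On the image of `s` the map `id + s (a - 1) π` acts as `a`, and on the kernel of `π` it is the
identity. For two retractions the perturbations are products of the same two maps in opposite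
orders, so the Weinstein–Aronszajn identity gives independence of the choice. -/
lemma pdet_eq_of_retract {F : Type*} [AddCommGroup F] [Module R F] [Module.Free R F]
    [Module.Finite R F] (s : P →ₗ[R] F) (π : F →ₗ[R] P) (h : π ∘ₗ s = LinearMap.id)
    (a : P →ₗ[R] P) :
    pdet a = LinearMap.det (LinearMap.id + s ∘ₗ (a - LinearMap.id) ∘ₗ π) := by
  have h' := (exists_retract_of_projective R P).choose_spec.choose_spec.choose_spec
  rw [pdet]
  set s' := (exists_retract_of_projective R P).choose_spec.choose
  set π' := (exists_retract_of_projective R P).choose_spec.choose_spec.choose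
  have e : s' ∘ₗ (a - LinearMap.id) ∘ₗ π' =
      (s' ∘ₗ (a - LinearMap.id) ∘ₗ π) ∘ₗ (s ∘ₗ π') := by
    ext x : 2
    simp [fun x => show π (s x) = x from LinearMap.congr_fun h x]
  have e' : s ∘ₗ (a - LinearMap.id) ∘ₗ π =
      (s ∘ₗ π') ∘ₗ (s' ∘ₗ (a - LinearMap.id) ∘ₗ π) := by
    ext x : 2
    simp [fun x => show π' (s' x) = x from LinearMap.congr_fun h' x]
  rw [e, e', linearMap_det_one_add_comm]

/-- Conjugation invariance, the vanishing of unipotent corrections and multiplicativity in exact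
sequences are all drawn from this identity. -/
lemma pdet_one_add_comm (f : P →ₗ[R] Q) (g : Q →ₗ[R] P) :
    pdet (LinearMap.id + f ∘ₗ g) = pdet (LinearMap.id + g ∘ₗ f) := by
  obtain ⟨n, s, π, h⟩ := exists_retract_of_projective R P
  obtain ⟨m, t, τ, h'⟩ := exists_retract_of_projective R Q
  rw [pdet_eq_of_retract s π h, pdet_eq_of_retract t τ h', add_sub_cancel_left,
    add_sub_cancel_left]
  have e : t ∘ₗ (f ∘ₗ g) ∘ₗ τ = (t ∘ₗ f ∘ₗ π) ∘ₗ (s ∘ₗ g ∘ₗ τ) := by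
    ext x : 2
    simp [fun x => show π (s x) = x from LinearMap.congr_fun h x]
  have e' : s ∘ₗ (g ∘ₗ f) ∘ₗ π = (s ∘ₗ g ∘ₗ τ) ∘ₗ (t ∘ₗ f ∘ₗ π) := by
    ext x : 2
    simp [fun x => show τ (t x) = x from LinearMap.congr_fun h' x]
  rw [e, e', linearMap_det_one_add_comm]

@[simp] lemma pdet_id : pdet (LinearMap.id : P →ₗ[R] P) = 1 := by
  obtain ⟨n, s, π, h⟩ := exists_retract_of_projective R P
  rw [pdet_eq_of_retract s π h]
  simp

lemma pdet_one_add_of_comp_eq_zero (f : P →ₗ[R] Q) (g : Q →ₗ[R] P) (h : g ∘ₗ f = 0) :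
    pdet (LinearMap.id + f ∘ₗ g) = 1 := by
  rw [pdet_one_add_comm, h, add_zero, pdet_id]

lemma pdet_comp (a b : P →ₗ[R] P) : pdet (a ∘ₗ b) = pdet a * pdet b := by
  obtain ⟨n, s, π, h⟩ := exists_retract_of_projective R P
  rw [pdet_eq_of_retract s π h, pdet_eq_of_retract s π h, pdet_eq_of_retract s π h,
    ← LinearMap.det_comp]
  congr 1
  have h' := fun x => LinearMap.congr_fun h x
  ext x : 2
  simp only [LinearMap.comp_apply, LinearMap.id_apply] at h'
  simp only [LinearMap.add_apply, LinearMap.comp_apply, LinearMap.sub_apply, LinearMap.id_apply,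
    map_add, map_sub, h', LinearMap.single_apply]
  abel

lemma pdet_conj (e : P ≃ₗ[R] Q) (a : P →ₗ[R] P) :
    pdet (e.toLinearMap ∘ₗ a ∘ₗ e.symm.toLinearMap) = pdet a := by
  have h1 : e.toLinearMap ∘ₗ a ∘ₗ e.symm.toLinearMap =
      LinearMap.id + (e.toLinearMap ∘ₗ (a - LinearMap.id)) ∘ₗ e.symm.toLinearMap := by
    ext x; simp
  have h2 : a = LinearMap.id + e.symm.toLinearMap ∘ₗ (e.toLinearMap ∘ₗ (a - LinearMap.id)) := by
    ext x; simp
  conv_rhs => rw [h2]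
  rw [h1, pdet_one_add_comm]

lemma pdet_eq_of_equiv (e : P ≃ₗ[R] Q) (a : P →ₗ[R] P) (b : Q →ₗ[R] Q)
    (h : ∀ x, b (e x) = e (a x)) : pdet b = pdet a := by
  rw [← pdet_conj e a]
  congr 1
  ext y
  simpa using h (e.symm y)

lemma pdet_eq_det [Module.Free R P] (a : P →ₗ[R] P) : pdet a = LinearMap.det a := by
  rw [pdet_eq_of_retract LinearMap.id LinearMap.id rfl a]
  congr 1
  ext x; simp

lemma pdet_prodMap (a : P →ₗ[R] P) (b : Q →ₗ[R] Q) :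
    pdet (a.prodMap b) = pdet a * pdet b := by
  obtain ⟨n, s, π, h⟩ := exists_retract_of_projective R P
  obtain ⟨m, t, τ, h'⟩ := exists_retract_of_projective R Q
  rw [pdet_eq_of_retract s π h, pdet_eq_of_retract t τ h',
    pdet_eq_of_retract (s.prodMap t) (π.prodMap τ)
      (by rw [LinearMap.prodMap_comp, h, h', LinearMap.prodMap_id]), ← LinearMap.det_prodMap]
  congr 1

lemma pdet_prodMap_id (a : P →ₗ[R] P) :
    pdet (a.prodMap (LinearMap.id : Q →ₗ[R] Q)) = pdet a := by
  rw [pdet_prodMap, pdet_id, mul_one]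

lemma pdet_baseChange (A : Type*) [CommRing A] [Algebra R A] (a : P →ₗ[R] P) :
    pdet (a.baseChange A) = algebraMap R A (pdet a) := by
  obtain ⟨n, s, π, h⟩ := exists_retract_of_projective R P
  rw [pdet_eq_of_retract (s.baseChange A) (π.baseChange A)
      (by rw [← LinearMap.baseChange_comp, h, LinearMap.baseChange_id]),
    pdet_eq_of_retract s π h, ← LinearMap.det_baseChange]
  congr 1
  simp only [LinearMap.baseChange_add, LinearMap.baseChange_comp, LinearMap.baseChange_sub,
    LinearMap.baseChange_id]

lemma isUnit_pdet (a : P ≃ₗ[R] P) : IsUnit (pdet a.toLinearMap) := by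
  refine IsUnit.of_mul_eq_one (pdet a.symm.toLinearMap) ?_
  rw [← pdet_comp]
  simp

/-- The sequence splits because `P₃` is projective, and in a splitting `a₂` is block triangular. -/
lemma pdet_eq_mul_of_exact {P₁ P₂ P₃ : Type*} [AddCommGroup P₁] [Module R P₁] [AddCommGroup P₂]
    [Module R P₂] [AddCommGroup P₃] [Module R P₃] [Module.Finite R P₁] [Module.Projective R P₁]
    [Module.Finite R P₂] [Module.Projective R P₂] [Module.Finite R P₃] [Module.Projective R P₃]
    (i : P₁ →ₗ[R] P₂) (q : P₂ →ₗ[R] P₃)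
    (hi : Function.Injective i) (hiq : Function.Exact i q) (hq : Function.Surjective q)
    (a₁ : P₁ ≃ₗ[R] P₁) (a₂ : P₂ ≃ₗ[R] P₂) (a₃ : P₃ ≃ₗ[R] P₃)
    (h₁ : ∀ x, a₂ (i x) = i (a₁ x)) (h₂ : ∀ x, q (a₂ x) = a₃ (q x)) :
    pdet a₂.toLinearMap = pdet a₁.toLinearMap * pdet a₃.toLinearMap := by
  obtain ⟨r, hr⟩ := Module.projective_lifting_property q LinearMap.id hq
  have hr' : ∀ x, q (r x) = x := fun x => LinearMap.congr_fun hr x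
  have hl : ∀ y, ∃ x, i x = y - r (q y) := fun y => (hiq _).1 (by simp [hr'])
  choose l hl using hl
  let l' : P₂ →ₗ[R] P₁ :=
    { toFun := l
      map_add' := fun x y => hi (by simp only [map_add, hl]; abel)
      map_smul' := fun c x => hi (by simp [hl, smul_sub]) }
  have hl' : ∀ y, i (l' y) = y - r (q y) := hl
  have hli : ∀ x, l' (i x) = x := fun x => hi (by rw [hl', hiq.apply_apply_eq_zero, map_zero,
    sub_zero])
  have hlr : ∀ x, l' (r x) = 0 := fun x => hi (by rw [hl', hr', sub_self, map_zero])
  -- Block factorisation: `a₁` on the image of `i`, then `a₃` on the image of the section `r`, then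
  -- a unipotent factor carrying the off-diagonal entry, corrected by `a₁⁻¹` because `a₁` is applied
  -- after it.
  have e : a₂.toLinearMap =
      (LinearMap.id + i ∘ₗ ((a₁.toLinearMap - LinearMap.id) ∘ₗ l')) ∘ₗ
      (LinearMap.id + r ∘ₗ ((a₃.toLinearMap - LinearMap.id) ∘ₗ q)) ∘ₗ
      (LinearMap.id + (i ∘ₗ a₁.symm.toLinearMap ∘ₗ l' ∘ₗ a₂.toLinearMap ∘ₗ r) ∘ₗ q) := by
    ext y
    have h0 : y = i (l' y) + r (q y) := by rw [hl']; abel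
    have h3 : a₂ (r (q y)) = i (l' (a₂ (r (q y)))) + r (a₃ (q y)) := by
      rw [hl', h₂, hr']; abel
    have h4 : a₂ y = i (a₁ (l' y)) + (i (l' (a₂ (r (q y)))) + r (a₃ (q y))) := by
      rw [← h3, ← h₁, ← map_add, ← h0]
    simp only [LinearEquiv.coe_coe, LinearMap.comp_apply, LinearMap.add_apply, LinearMap.id_apply,
      LinearMap.sub_apply, map_add, map_sub, hli, hlr, hiq.apply_apply_eq_zero, map_zero,
      LinearEquiv.apply_symm_apply]
    rw [h4]
    conv_rhs => rw [h0]
    simp only [map_add, hli, hlr, hiq.apply_apply_eq_zero, hr', map_zero]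
    abel
  have e1 : ((a₁.toLinearMap - LinearMap.id) ∘ₗ l') ∘ₗ i = a₁.toLinearMap - LinearMap.id := by
    ext x; simp [hli]
  have e2 : ((a₃.toLinearMap - LinearMap.id) ∘ₗ q) ∘ₗ r = a₃.toLinearMap - LinearMap.id := by
    ext x; simp [hr']
  rw [e, pdet_comp, pdet_comp, pdet_one_add_comm i, pdet_one_add_comm r, e1, e2,
    pdet_one_add_of_comp_eq_zero, mul_one, add_sub_cancel, add_sub_cancel]
  ext x
  simp [hiq.apply_apply_eq_zero]

end ProjectiveDeterminant

/-! ### `K₁` of a semilocal ring is detected by the determinant. -/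

section K1

variable {R : Type u} [CommRing R]

/-- `pdet` respects both kinds of defining relations, so it factors through `K₁(R)`. -/
lemma K1.pdet_eq_of_cls_eq {P Q : FGProj R} {a : P ≃ₗ[R] P} {b : Q ≃ₗ[R] Q}
    (h : K1.cls P a = K1.cls Q b) : pdet a.toLinearMap = pdet b.toLinearMap := by
  let F : FreeAbelianGroup (ProjAut R) →+ Additive Rˣ :=
    FreeAbelianGroup.lift fun x => Additive.ofMul (isUnit_pdet x.aut).unit
  have hF : AddSubgroup.closure {x | K1Rel (R := R) x} ≤ F.ker := by
    rw [AddSubgroup.closure_le]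
    intro x hx
    change F x = 0
    induction hx with
    | comp P a b =>
      simp only [F, map_sub, FreeAbelianGroup.lift_apply_of]
      rw [sub_sub, sub_eq_zero, ← ofMul_mul]
      congr 1
      ext
      change pdet (b.toLinearMap ∘ₗ a.toLinearMap) = _
      rw [pdet_comp, mul_comm]
      rfl
    | exact P₁ P₂ P₃ i q hi hiq hq a₁ a₂ a₃ h₁ h₂ =>
      simp only [F, map_sub, FreeAbelianGroup.lift_apply_of]
      rw [sub_sub, sub_eq_zero, ← ofMul_mul]
      congr 1
      ext
      exact pdet_eq_mul_of_exact i q hi hiq hq a₁ a₂ a₃ h₁ h₂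
  have h' := hF (QuotientAddGroup.eq.1 h)
  have h'' : - F (.of ⟨P, a⟩) + F (.of ⟨Q, b⟩) = 0 := by
    rw [← map_neg, ← map_add]; exact h'
  rw [neg_add_eq_zero] at h''
  simp only [F, FreeAbelianGroup.lift_apply_of] at h''
  exact congrArg Units.val (Additive.ofMul.injective h'')

lemma K1.pdet_eq_one_of_cls_eq_zero {P : FGProj R} {a : P ≃ₗ[R] P}
    (h : K1.cls P a = 0) : pdet a.toLinearMap = 1 := by
  rw [← K1.cls_refl P] at h
  rw [K1.pdet_eq_of_cls_eq h]
  exact pdet_id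

/-- A semilocal ring has stable range one. -/
lemma exists_isUnit_add_mul [Finite (MaximalSpectrum R)] {a b : R}
    (h : Ideal.span {a} ⊔ Ideal.span {b} = ⊤) : ∃ t, IsUnit (a + t * b) := by
  classical
  have hco : Pairwise fun m n : MaximalSpectrum R => IsCoprime m.asIdeal n.asIdeal :=
    fun m n hmn => Ideal.isCoprime_of_isMaximal (fun h => hmn (MaximalSpectrum.ext h))
  -- By the Chinese remainder theorem `t` can be taken to be `1` modulo the maximal ideals
  -- containing `a` and `0` modulo the others. Then `a + t b` lies in none of them.
  obtain ⟨t, ht⟩ := Ideal.pi_mkQ_surjective hco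
    (fun m => if a ∈ m.asIdeal then Submodule.Quotient.mk 1 else 0)
  refine ⟨t, ?_⟩
  by_contra hu
  obtain ⟨m, hm, hmem⟩ := exists_max_ideal_of_mem_nonunits hu
  have htm := congrFun ht ⟨m, hm⟩
  simp only [LinearMap.pi_apply, Submodule.mkQ_apply] at htm
  by_cases ha : a ∈ m
  · rw [if_pos ha, Submodule.Quotient.eq] at htm
    have hb : b ∈ m := by
      have h1 : t * b ∈ m := by simpa using m.sub_mem hmem ha
      have h2 : t * b - b ∈ m := by simpa [sub_mul] using m.mul_mem_right b htm
      simpa using m.sub_mem h1 h2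
    refine hm.ne_top (top_le_iff.1 (h ▸ sup_le ?_ ?_)) <;>
      rwa [Ideal.span_singleton_le_iff_mem]
  · rw [if_neg ha, Submodule.Quotient.mk_eq_zero] at htm
    exact ha (by simpa using m.sub_mem hmem (m.mul_mem_right b htm))

/-- The automorphism of `R` given by a unit. -/
def unitAut (v : Rˣ) : (⟨R⟩ : FGProj R) ≃ₗ[R] (⟨R⟩ : FGProj R) :=
  LinearEquiv.smulOfUnit v

@[simp] lemma unitAut_apply (v : Rˣ) (x : R) : unitAut v x = (v : R) * x := rfl

/-- Addition of a linear function of the second coordinate to the first. -/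
def shearFst {P Q : Type*} [AddCommGroup P] [Module R P] [AddCommGroup Q] [Module R Q]
    (w : Q →ₗ[R] P) : (P × Q) ≃ₗ[R] (P × Q) where
  toFun x := (x.1 + w x.2, x.2)
  invFun x := (x.1 - w x.2, x.2)
  map_add' x y := by ext <;> simp; abel
  map_smul' c x := by ext <;> simp
  left_inv x := by simp
  right_inv x := by simp

/-- Addition of a linear function of the first coordinate to the second. -/
def shearSnd {P Q : Type*} [AddCommGroup P] [Module R P] [AddCommGroup Q] [Module R Q]
    (w : P →ₗ[R] Q) : (P × Q) ≃ₗ[R] (P × Q) where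
  toFun x := (x.1, x.2 + w x.1)
  invFun x := (x.1, x.2 - w x.1)
  map_add' x y := by ext <;> simp; abel
  map_smul' c x := by ext <;> simp
  left_inv x := by simp
  right_inv x := by simp

lemma K1.cls_shearFst (P Q : FGProj R) (w : Q →ₗ[R] P) :
    K1.cls (P.prod Q) (shearFst w) = 0 := by
  rw [K1.cls_exact (P₁ := P) (P₂ := P.prod Q) (P₃ := Q) (LinearMap.inl R P Q)
    (LinearMap.snd R P Q) LinearMap.inl_injective Function.Exact.inl_snd
    LinearMap.snd_surjective (LinearEquiv.refl R P) (shearFst w)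
    (LinearEquiv.refl R Q) (fun x => by
      change (x + w 0, (0 : Q)) = (x, 0); simp) (fun x => rfl), K1.cls_refl, K1.cls_refl, add_zero]

lemma K1.cls_shearSnd (P Q : FGProj R) (w : P →ₗ[R] Q) :
    K1.cls (P.prod Q) (shearSnd w) = 0 := by
  rw [K1.cls_exact (P₁ := Q) (P₂ := P.prod Q) (P₃ := P) (LinearMap.inr R P Q)
    (LinearMap.fst R P Q) LinearMap.inr_injective Function.Exact.inr_fst
    LinearMap.fst_surjective (LinearEquiv.refl R Q) (shearSnd w)
    (LinearEquiv.refl R P) (fun x => by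
      change ((0 : P), x + w 0) = (0, x); simp) (fun x => rfl), K1.cls_refl, K1.cls_refl, add_zero]

/-- Gaussian elimination for one column. -/
lemma K1.exists_cls_eq_add [Finite (MaximalSpectrum R)] (F : FGProj R)
    (a : ((⟨R⟩ : FGProj R).prod F) ≃ₗ[R] ((⟨R⟩ : FGProj R).prod F)) :
    ∃ (v : Rˣ) (b : F ≃ₗ[R] F),
      K1.cls ((⟨R⟩ : FGProj R).prod F) a = K1.cls ⟨R⟩ (unitAut v) + K1.cls F b := by
  let α : R := (a (1, 0)).1
  let y : F := (a (1, 0)).2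
  let g : (R × F) →ₗ[R] R := LinearMap.fst R R F ∘ₗ a.symm.toLinearMap
  -- The first column `(α, y)` is unimodular: the first coordinate `g` of the inverse sends it to
  -- `1`. Stable range one then replaces `α` by a unit, using a multiple of `g (0, y)`.
  have hg : α * g (1, 0) + g (0, y) = 1 := by
    rw [← smul_eq_mul, ← map_smul, ← map_add]
    have : α • ((1 : R), (0 : F)) + (0, y) = a (1, 0) := by ext <;> simp [α, y]
    rw [this]
    simp [g]
  obtain ⟨t, ht⟩ := exists_isUnit_add_mul (a := α) (b := g (0, y)) (by
    rw [Ideal.eq_top_iff_one, ← hg]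
    exact add_mem (Ideal.mem_sup_left (Ideal.mem_span_singleton.2 ⟨_, rfl⟩))
      (Ideal.mem_sup_right (Ideal.mem_span_singleton_self _)))
  obtain ⟨v, hv⟩ := ht
  let w : F →ₗ[R] R := t • (g ∘ₗ LinearMap.inr R R F)
  let w' : R →ₗ[R] F := LinearMap.toSpanSingleton R F (-((v⁻¹ : Rˣ) : R) • y)
  let a' : (R × F) ≃ₗ[R] (R × F) := (a.trans (shearFst w)).trans (shearSnd w')
  have ha' : a' (1, 0) = ((v : R), 0) := by
    have h1 : a (1, 0) = (α, y) := rfl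
    simp only [a', LinearEquiv.trans_apply, h1]
    have h2 : shearFst w (α, y) = ((v : R), y) := by
      rw [hv]; rfl
    rw [h2]
    change ((v : R), y + (v : R) • (-((v⁻¹ : Rˣ) : R) • y)) = _
    rw [smul_smul, mul_neg, Units.mul_inv, neg_one_smul, add_neg_cancel]
  have ha'x : ∀ x : R, a' (x, 0) = ((v : R) * x, 0) := by
    intro x
    have : ((x, 0) : R × F) = x • (1, 0) := by ext <;> simp
    rw [this, map_smul, ha']
    ext <;> simp [mul_comm]
  -- Since `a'` is block upper triangular with invertible corner `v`, its lower right block is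
  -- invertible, with inverse the lower right block of `a'⁻¹`.
  have hinv : ∀ z, (a'.symm (0, (a' (0, z)).2)).2 = z := by
    intro z
    have h3 : ((0 : R), (a' (0, z)).2) = a' (0, z) - a' (((v⁻¹ : Rˣ) : R) * (a' (0, z)).1, 0) := by
      rw [ha'x]; ext <;> simp
    rw [h3, ← map_sub, LinearEquiv.symm_apply_apply]
    simp
  have hinv' : ∀ z, (a' (0, (a'.symm (0, z)).2)).2 = z := by
    intro z
    have h3 : ((0 : R), (a'.symm (0, z)).2) = a'.symm (0, z) - ((a'.symm (0, z)).1, 0) := by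
      ext <;> simp
    rw [h3, map_sub, ha'x]
    simp
  let b : F ≃ₗ[R] F :=
    LinearEquiv.ofLinearMap (LinearMap.snd R R F ∘ₗ a'.toLinearMap ∘ₗ LinearMap.inr R R F)
      (LinearMap.snd R R F ∘ₗ a'.symm.toLinearMap ∘ₗ LinearMap.inr R R F)
      (by ext z; exact hinv' z) (by ext z; exact hinv z)
  refine ⟨v, b, ?_⟩
  have hcls : K1.cls ((⟨R⟩ : FGProj R).prod F) a' = K1.cls ((⟨R⟩ : FGProj R).prod F) a := by
    rw [show K1.cls ((⟨R⟩ : FGProj R).prod F) a' = _ from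
      K1.cls_trans ((⟨R⟩ : FGProj R).prod F) (a.trans (shearFst w)) (shearSnd w'),
      K1.cls_trans ((⟨R⟩ : FGProj R).prod F) a (shearFst w)]
    have h1 := K1.cls_shearFst ⟨R⟩ F w
    have h2 := K1.cls_shearSnd ⟨R⟩ F w'
    rw [h1, h2, add_zero, add_zero]
  rw [← hcls]
  refine K1.cls_exact (P₁ := ⟨R⟩) (P₂ := (⟨R⟩ : FGProj R).prod F) (P₃ := F) (LinearMap.inl R R F)
    (LinearMap.snd R R F) LinearMap.inl_injective Function.Exact.inl_snd
    LinearMap.snd_surjective _ _ _ (fun x => ?_) (fun x => ?_)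
  · exact ha'x x
  · have hx : x = (x.1, 0) + (0, x.2) := by ext <;> simp
    change (a' x).2 = (a' (0, x.2)).2
    conv_lhs => rw [hx, map_add, ha'x]
    simp

/-- Each elimination step splits off one unit, and the classes of the units are combined by
composing them on `R`. -/
lemma K1.exists_cls_eq_unitAut [Finite (MaximalSpectrum R)] (n : ℕ)
    (a : (⟨Fin n → R⟩ : FGProj R) ≃ₗ[R] (⟨Fin n → R⟩ : FGProj R)) :
    ∃ v : Rˣ, K1.cls ⟨Fin n → R⟩ a = K1.cls ⟨R⟩ (unitAut v) := by
  induction n with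
  | zero =>
    refine ⟨1, ?_⟩
    have h1 : a = LinearEquiv.refl R _ := by
      ext x i; exact i.elim0
    have h2 : unitAut (1 : Rˣ) = LinearEquiv.refl R _ := by
      apply LinearEquiv.ext; intro x; exact one_mul x
    rw [h1, h2, K1.cls_refl, K1.cls_refl]
  | succ n ih =>
    let e : (R × (Fin n → R)) ≃ₗ[R] (Fin (n + 1) → R) := Fin.consLinearEquiv R (fun _ => R)
    obtain ⟨v, b, hb⟩ := K1.exists_cls_eq_add ⟨Fin n → R⟩ (e.trans (a.trans e.symm))
    obtain ⟨w, hw⟩ := ih b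
    refine ⟨v * w, ?_⟩
    have h1 := K1.cls_eq_of_equiv (P := (⟨R⟩ : FGProj R).prod ⟨Fin n → R⟩)
      (Q := ⟨Fin (n + 1) → R⟩) e (e.trans (a.trans e.symm)) a (fun x => by simp)
    rw [h1, hb, hw, ← K1.cls_trans]
    congr 1
    apply LinearEquiv.ext
    intro x
    change (w : R) * ((v : R) * x) = ((v * w : Rˣ) : R) * x
    rw [Units.val_mul]; ring

lemma pdet_unitAut (v : Rˣ) : pdet (unitAut v).toLinearMap = (v : R) := by
  rw [pdet_eq_det (P := R)]
  exact (LinearMap.det_ring _).trans (mul_one _)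

/-- Over a semilocal ring, automorphisms of determinant one are trivial in `K₁`. -/
lemma K1.cls_eq_zero_of_pdet_eq_one [Finite (MaximalSpectrum R)] (P : FGProj R) (a : P ≃ₗ[R] P)
    (h : pdet a.toLinearMap = 1) : K1.cls P a = 0 := by
  obtain ⟨n, s, π, hs⟩ := exists_retract_of_projective R P
  have hs' : ∀ x, π (s x) = x := fun x => LinearMap.congr_fun hs x
  -- Adding the identity on the complement `N` moves the automorphism to a free module without
  -- changing its class. There the class is that of a unit, which the determinant identifies as `1`.
  let N : Submodule R (Fin n → R) := LinearMap.ker π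
  let r : (Fin n → R) →ₗ[R] N := LinearMap.codRestrict N (LinearMap.id - s ∘ₗ π)
    (fun x => by simp [N, hs'])
  have hr : ∀ x : N, r x = x := fun x => Subtype.ext (by
    have hx : π x = 0 := x.2
    simp [r, hx])
  have : Module.Projective R N := Module.Projective.of_split N.subtype r (by ext1 x; exact hr x)
  have : Module.Finite R N := Module.Finite.of_surjective r (fun x => ⟨x, hr x⟩)
  let e : (P × N) ≃ₗ[R] (Fin n → R) :=
    LinearEquiv.ofLinearMap (s.coprod N.subtype) (π.prod r)
      (by ext1 x; simp [r])
      (by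
        apply LinearMap.ext
        rintro ⟨x, y⟩
        have hy : π y = 0 := y.2
        refine Prod.ext ?_ ?_
        · simp [hs', hy]
        · apply Subtype.ext
          simp [r, hs', hy])
  let a' : (Fin n → R) ≃ₗ[R] (Fin n → R) :=
    e.symm.trans ((LinearEquiv.prodCongr a (LinearEquiv.refl R N)).trans e)
  have hcls := K1.cls_eq_of_prod (P := P) (N := ⟨N⟩) (Q := ⟨Fin n → R⟩) e a a'
    (fun x => by simp [a'])
  obtain ⟨v, hv⟩ := K1.exists_cls_eq_unitAut n a'
  rw [hcls] at hv
  have := K1.pdet_eq_of_cls_eq hv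
  rw [h, pdet_unitAut] at this
  have hv1 : v = 1 := Units.ext this.symm
  have h2 : unitAut (1 : Rˣ) = LinearEquiv.refl R _ := by
    apply LinearEquiv.ext; intro x; exact one_mul x
  rw [hv, hv1, h2, K1.cls_refl]

end K1

end DetFunctor

end

/-! ### Morphisms of the Picard category measured by determinants. -/

noncomputable section

open TensorProduct

namespace DetFunctor

section ReferenceDeterminant

variable {R : Type u} [CommRing R] {X Y Z : VirtObj R}

/-- The isomorphism of threefold direct sums given by an isomorphism on the first two summands. -/
def extendRef {A B C D : Type*} [AddCommGroup A] [Module R A] [AddCommGroup B] [Module R B]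
    [AddCommGroup C] [Module R C] [AddCommGroup D] [Module R D] (h : (A × B) ≃ₗ[R] (C × D))
    (S : Type*) [AddCommGroup S] [Module R S] : (A × B × S) ≃ₗ[R] (C × D × S) :=
  (LinearEquiv.prodAssoc R A B S).symm.trans
    ((LinearEquiv.prodCongr h (LinearEquiv.refl R S)).trans (LinearEquiv.prodAssoc R C D S))

section

variable {A B C D : Type*} [AddCommGroup A] [Module R A] [AddCommGroup B] [Module R B]
    [AddCommGroup C] [Module R C] [AddCommGroup D] [Module R D] (h : (A × B) ≃ₗ[R] (C × D))
    {S : Type*} [AddCommGroup S] [Module R S]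

lemma extendRef_apply (x : A × B × S) :
    extendRef h S x = ((h (x.1, x.2.1)).1, (h (x.1, x.2.1)).2, x.2.2) := rfl

lemma extendRef_symm_apply (x : C × D × S) :
    (extendRef h S).symm x = ((h.symm (x.1, x.2.1)).1, (h.symm (x.1, x.2.1)).2, x.2.2) := rfl

end

namespace Mor

lemma mk_ext (f : StableIso X Y) (N T : FGProj R) (e : (f.stab × N) ≃ₗ[R] T) :
    Mor.mk f = Mor.mk ⟨T, extIso f.iso e⟩ := by
  refine Quot.sound ⟨N, e, ?_⟩
  have : (extIso f.iso e).trans (extIso f.iso e).symm = LinearEquiv.refl R _ :=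
    LinearEquiv.self_trans_symm _
  change K1.cls (X.pos.prod (Y.neg.prod T)) ((extIso f.iso e).trans (extIso f.iso e).symm) = 0
  rw [this]
  exact K1.cls_refl _

lemma mk_eq_of_cls {S : FGProj R} (φ ψ : (X.pos × Y.neg × S) ≃ₗ[R] (Y.pos × X.neg × S))
    (h : K1.cls (X.pos.prod (Y.neg.prod S)) (φ.trans ψ.symm) = 0) :
    (Mor.mk ⟨S, φ⟩ : Mor X Y) = Mor.mk ⟨S, ψ⟩ := by
  refine Quot.sound ⟨FGProj.zero, LinearEquiv.prodUnique, ?_⟩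
  exact h

lemma pdet_trans {P Q : Type*} [AddCommGroup P] [Module R P] [Module.Finite R P]
    [Module.Projective R P] [AddCommGroup Q] [Module R Q]
    (a : P ≃ₗ[R] Q) (b : P ≃ₗ[R] Q) (c : P ≃ₗ[R] Q) :
    pdet (a.trans c.symm).toLinearMap =
      pdet (a.trans b.symm).toLinearMap * pdet (b.trans c.symm).toLinearMap := by
  rw [mul_comm, ← pdet_comp]
  congr 1
  ext x
  simp

/-- The determinant of a representative relative to a reference isomorphism. -/
def preDet (h : (X.pos × Y.neg) ≃ₗ[R] (Y.pos × X.neg)) (f : StableIso X Y) : R :=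
  pdet (f.iso.trans (extendRef h f.stab).symm).toLinearMap

/-- Enlarging the auxiliary module adds an identity summand on `N`, which has determinant one. -/
lemma preDet_ext (h : (X.pos × Y.neg) ≃ₗ[R] (Y.pos × X.neg)) (f : StableIso X Y)
    (N T : FGProj R) (e : (f.stab × N) ≃ₗ[R] T) :
    preDet h ⟨T, extIso f.iso e⟩ = preDet h f := by
  unfold preDet
  refine Eq.trans ?_ (pdet_prodMap_id (Q := N) _)
  let E : ((X.pos × Y.neg × f.stab) × N) ≃ₗ[R] (X.pos × Y.neg × T) :=
    (shuffle R X.pos Y.neg f.stab N).symm.trans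
      (LinearEquiv.prodCongr (LinearEquiv.refl R _)
        (LinearEquiv.prodCongr (LinearEquiv.refl R _) e))
  refine pdet_eq_of_equiv E _ _ ?_
  rintro ⟨⟨x, y, s⟩, n⟩
  have hE : E ((x, y, s), n) = (x, y, e (s, n)) := rfl
  rw [hE]
  simp only [LinearEquiv.coe_coe, LinearEquiv.trans_apply, extIso_apply,
    LinearEquiv.symm_apply_apply, extendRef_symm_apply, LinearMap.prodMap_apply]
  rfl

/-- The quotient of the two determinants is the determinant of an automorphism with trivial class in
`K₁`, hence is one. -/
lemma preDet_rel (h : (X.pos × Y.neg) ≃ₗ[R] (Y.pos × X.neg)) (f g : StableIso X Y)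
    (hfg : f.Rel g) : preDet h f = preDet h g := by
  obtain ⟨N, e, he⟩ := hfg
  rw [← preDet_ext h f N g.stab e]
  unfold preDet
  rw [pdet_trans (extIso f.iso e) g.iso (extendRef h g.stab)]
  have := K1.pdet_eq_one_of_cls_eq_zero he
  change pdet ((extIso f.iso e).trans g.iso.symm).toLinearMap = 1 at this
  rw [this, one_mul]

/-- The determinant of a morphism relative to a reference isomorphism. -/
def det (h : (X.pos × Y.neg) ≃ₗ[R] (Y.pos × X.neg)) : Mor X Y → R :=
  Quot.lift (preDet h) (preDet_rel h)

lemma det_mk (h : (X.pos × Y.neg) ≃ₗ[R] (Y.pos × X.neg)) (f : StableIso X Y) :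
    det h (Mor.mk f) = pdet (f.iso.trans (extendRef h f.stab).symm).toLinearMap := rfl

lemma mk_eq_of_pdet [Finite (MaximalSpectrum R)] {S : FGProj R}
    (φ ψ : (X.pos × Y.neg × S) ≃ₗ[R] (Y.pos × X.neg × S))
    (h : pdet (φ.trans ψ.symm).toLinearMap = 1) :
    (Mor.mk ⟨S, φ⟩ : Mor X Y) = Mor.mk ⟨S, ψ⟩ :=
  mk_eq_of_cls φ ψ (K1.cls_eq_zero_of_pdet_eq_one (X.pos.prod (Y.neg.prod S)) _ h)

/-- Over a semilocal ring a morphism is determined by its determinant relative to a reference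
isomorphism. -/
lemma eq_of_det_eq [Finite (MaximalSpectrum R)] (h : (X.pos × Y.neg) ≃ₗ[R] (Y.pos × X.neg))
    (c c' : Mor X Y) (hc : det h c = det h c') : c = c' := by
  induction c using Quot.ind with | mk f => ?_
  induction c' using Quot.ind with | mk g => ?_
  change det h (Mor.mk f) = det h (Mor.mk g) at hc
  change Mor.mk f = Mor.mk g
  -- Both representatives are first brought to the common auxiliary module `f.stab ⊕ g.stab`. Their
  -- discrepancy then has determinant one after cancelling the unit determinant of the second.
  rw [mk_ext f g.stab (f.stab.prod g.stab) (LinearEquiv.refl R _),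
    mk_ext g f.stab (f.stab.prod g.stab) (LinearEquiv.prodComm R g.stab f.stab)] at hc ⊢
  apply mk_eq_of_pdet
  rw [det_mk, det_mk] at hc
  simp only at hc
  rw [pdet_trans _ (extIso g.iso (LinearEquiv.prodComm R g.stab f.stab))] at hc
  refine (isUnit_pdet (P := X.pos × Y.neg × f.stab × g.stab)
    ((extIso g.iso (LinearEquiv.prodComm R g.stab f.stab)).trans
      (extendRef h (f.stab × g.stab)).symm)).mul_right_cancel (hc.trans (one_mul _).symm)

/-- Extension of scalars of a reference isomorphism. -/
def refBaseChange (A : Type u) [CommRing A] [Algebra R A] {P Q P' Q' : Type u}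
    [AddCommGroup P] [Module R P] [AddCommGroup Q] [Module R Q] [AddCommGroup P'] [Module R P']
    [AddCommGroup Q'] [Module R Q'] (h : (P × Q) ≃ₗ[R] (P' × Q')) :
    ((A ⊗[R] P) × (A ⊗[R] Q)) ≃ₗ[A] ((A ⊗[R] P') × (A ⊗[R] Q')) :=
  (TensorProduct.prodRight R A A P Q).symm.trans
    ((LinearEquiv.baseChange R A _ _ h).trans (TensorProduct.prodRight R A A P' Q'))

lemma refBaseChange_tmul (A : Type u) [CommRing A] [Algebra R A] {P Q P' Q' : Type u}
    [AddCommGroup P] [Module R P] [AddCommGroup Q] [Module R Q] [AddCommGroup P'] [Module R P']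
    [AddCommGroup Q'] [Module R Q'] (h : (P × Q) ≃ₗ[R] (P' × Q')) (a : A) (x : P) (y : Q) :
    refBaseChange A h (a ⊗ₜ[R] x, a ⊗ₜ[R] y) =
      (a ⊗ₜ[R] (h (x, y)).1, a ⊗ₜ[R] (h (x, y)).2) := by
  simp only [refBaseChange, LinearEquiv.trans_apply, TensorProduct.prodRight_symm_tmul]
  rfl

lemma bcIso_extendRef (A : Type u) [CommRing A] [Algebra R A] {P Q P' Q' S : Type u}
    [AddCommGroup P] [Module R P] [AddCommGroup Q] [Module R Q] [AddCommGroup P'] [Module R P']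
    [AddCommGroup Q'] [Module R Q'] [AddCommGroup S] [Module R S] (h : (P × Q) ≃ₗ[R] (P' × Q')) :
    bcIso A (extendRef h S) = extendRef (refBaseChange A h) (A ⊗[R] S) := by
  apply prod3_induction
  rintro a ⟨x, y, s⟩
  rw [bcIso_tmul, extendRef_apply, extendRef_apply]
  dsimp only
  rw [refBaseChange_tmul]

lemma pdet_bcIso (A : Type u) [CommRing A] [Algebra R A] {P Q P' Q' S : Type u}
    [AddCommGroup P] [Module R P] [AddCommGroup Q] [Module R Q] [AddCommGroup P'] [Module R P']
    [AddCommGroup Q'] [Module R Q'] [AddCommGroup S] [Module R S]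
    [Module.Finite R P] [Module.Finite R Q] [Module.Finite R S]
    [Module.Projective R P] [Module.Projective R Q] [Module.Projective R S]
    (φ ψ : (P × Q × S) ≃ₗ[R] (P' × Q' × S)) :
    pdet ((bcIso A φ).trans (bcIso A ψ).symm).toLinearMap =
      algebraMap R A (pdet (φ.trans ψ.symm).toLinearMap) := by
  rw [← pdet_baseChange]
  refine pdet_eq_of_equiv (prod3 A P Q S) _ _ ?_
  intro x
  rw [LinearEquiv.coe_coe, LinearEquiv.trans_apply, LinearEquiv.symm_apply_eq]
  simp only [bcIso, LinearEquiv.trans_apply, LinearEquiv.symm_apply_apply]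
  congr 1
  induction x using TensorProduct.induction_on with
  | zero => simp
  | add x y hx hy => simp only [map_add, hx, hy]
  | tmul a m =>
    change a ⊗ₜ[R] (φ m) = a ⊗ₜ[R] (ψ (ψ.symm (φ m)))
    rw [LinearEquiv.apply_symm_apply]

lemma det_baseChange (A : Type u) [CommRing A] [Algebra R A]
    (h : (X.pos × Y.neg) ≃ₗ[R] (Y.pos × X.neg)) (c : Mor X Y) :
    det (X := X.baseChange A) (Y := Y.baseChange A) (refBaseChange A h) (c.baseChange A) =
      algebraMap R A (det h c) := by
  induction c using Quot.ind with | mk f => ?_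
  change det (X := X.baseChange A) (Y := Y.baseChange A) (refBaseChange A h)
    (Mor.mk (f.baseChange A)) = algebraMap R A (det h (Mor.mk f))
  rw [det_mk, det_mk, ← pdet_bcIso, bcIso_extendRef]
  rfl

/-- The two sides have auxiliary modules `A ⊗ (B ⊕ S ⊕ T)` and `(A ⊗ B) ⊕ (A ⊗ S) ⊕ (A ⊗ T)`. After
transport along `e` the isomorphisms agree on pure tensors, hence everywhere. -/
lemma baseChange_comp (A : Type u) [CommRing A] [Algebra R A] (c : Mor X Y) (d : Mor Y Z) :
    (c.comp d).baseChange A = (c.baseChange A).comp (d.baseChange A) := by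
  induction c using Quot.ind with | mk f => ?_
  induction d using Quot.ind with | mk g => ?_
  change Mor.mk ((f.comp g).baseChange A) = Mor.mk ((f.baseChange A).comp (g.baseChange A))
  let e : ((A ⊗[R] (Y.neg × f.stab × g.stab)) × (FGProj.zero : FGProj A)) ≃ₗ[A]
      ((A ⊗[R] Y.neg) × (A ⊗[R] f.stab) × (A ⊗[R] g.stab)) :=
    LinearEquiv.prodUnique.trans (prod3 A Y.neg f.stab g.stab)
  rw [mk_ext ((f.comp g).baseChange A) FGProj.zero
    ((Y.neg.baseChange A).prod ((f.stab.baseChange A).prod (g.stab.baseChange A))) e]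
  refine congrArg (fun i => (Mor.mk (X := X.baseChange A) (Y := Z.baseChange A)
    ⟨((Y.neg.baseChange A).prod ((f.stab.baseChange A).prod (g.stab.baseChange A))), i⟩)) ?_
  change extIso (bcIso A (compIso f.iso g.iso)) e = compIso (bcIso A f.iso) (bcIso A g.iso)
  apply LinearEquiv.ext
  intro y
  obtain ⟨y, rfl⟩ := ((prod3 A X.pos Z.neg (Y.neg × f.stab × g.stab)).trans
    (LinearEquiv.prodCongr (LinearEquiv.refl A _) (LinearEquiv.prodCongr (LinearEquiv.refl A _)
      (prod3 A Y.neg f.stab g.stab)))).surjective y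
  induction y with
  | zero => simp only [map_zero]
  | add x y hx hy => simp only [map_add, hx, hy]
  | tmul a x =>
    obtain ⟨x, z, y, s, t⟩ := x
    change extIso _ e (a ⊗ₜ[R] x, a ⊗ₜ[R] z, a ⊗ₜ[R] y, a ⊗ₜ[R] s, a ⊗ₜ[R] t) =
      compIso _ _ (a ⊗ₜ[R] x, a ⊗ₜ[R] z, a ⊗ₜ[R] y, a ⊗ₜ[R] s, a ⊗ₜ[R] t)
    have he : e.symm (a ⊗ₜ[R] y, a ⊗ₜ[R] s, a ⊗ₜ[R] t) = (a ⊗ₜ[R] (y, s, t), 0) :=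
      (LinearEquiv.symm_apply_eq _).2 rfl
    have h1 := bcIso_tmul A (compIso f.iso g.iso) a (x, z, y, s, t)
    have h2 := bcIso_tmul A f.iso a (x, y, s)
    dsimp only at h1 h2
    rw [extIso_apply, compIso_apply]
    dsimp only
    rw [he]
    dsimp only
    rw [h1, h2]
    have h3 := bcIso_tmul A g.iso a ((f.iso (x, y, s)).1, z, t)
    dsimp only at h3 ⊢
    rw [h3, compPost_apply, compIso_apply, compPost_apply]
    dsimp only
    rw [← TensorProduct.tmul_neg]
    rfl

end Mor

end ReferenceDeterminant

end DetFunctor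

end

/-! ### Contractions of `ℤ/2`-graded complexes, mapping cones and extension of scalars. -/

noncomputable section

open TensorProduct

namespace DetFunctor

namespace FoldedComplex

variable {R : Type u} [CommRing R] {F F' : FoldedComplex R}

namespace Contraction

lemma dOdd_sEven (t : F.Contraction) (x : F.even) :
    F.dOdd (t.sEven x) = x - t.sOdd (F.dEven x) :=
  eq_sub_of_add_eq (LinearMap.congr_fun t.homotopy_even x)

lemma dEven_sOdd (t : F.Contraction) (x : F.odd) :
    F.dEven (t.sOdd x) = x - t.sEven (F.dOdd x) :=
  eq_sub_of_add_eq (LinearMap.congr_fun t.homotopy_odd x)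

lemma sOdd_sEven_apply (t : F.Contraction) (x : F.even) : t.sOdd (t.sEven x) = 0 :=
  LinearMap.congr_fun t.sOdd_sEven x

lemma sEven_sOdd_apply (t : F.Contraction) (x : F.odd) : t.sEven (t.sOdd x) = 0 :=
  LinearMap.congr_fun t.sEven_sOdd x

lemma equiv_apply (t : F.Contraction) (x : F.odd) : t.equiv x = F.dOdd x + t.sOdd x := rfl

lemma equiv_symm_apply (t : F.Contraction) (x : F.even) :
    t.equiv.symm x = F.dEven x + t.sEven x := rfl

end Contraction

lemma dEven_dOdd_apply (F : FoldedComplex R) (x : F.odd) : F.dEven (F.dOdd x) = 0 :=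
  LinearMap.congr_fun F.dEven_dOdd x

lemma dOdd_dEven_apply (F : FoldedComplex R) (x : F.even) : F.dOdd (F.dEven x) = 0 :=
  LinearMap.congr_fun F.dOdd_dEven x

/-- The isomorphisms attached to two contractions of one complex differ by an automorphism of
determinant one. -/
lemma Contraction.pdet_equiv_trans_symm (t t' : F.Contraction) :
    pdet (t.equiv.trans t'.equiv.symm).toLinearMap = 1 := by
  -- The composite `(d + t')(d + t)` is a product of two maps `id + f g` with `g f = 0`. For the
  -- first factor this uses `d t d = d = d t' d`, for the second `t t = 0`.
  have key : (t.equiv.trans t'.equiv.symm).toLinearMap =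
      (LinearMap.id + ((t'.sEven - t.sEven) ∘ₗ F.dOdd) ∘ₗ (t.sEven ∘ₗ F.dOdd)) ∘ₗ
      (LinearMap.id + t.sEven ∘ₗ (-(t'.sOdd ∘ₗ F.dEven ∘ₗ t.sOdd))) := by
    apply LinearMap.ext
    intro x
    simp only [LinearEquiv.coe_coe, LinearEquiv.trans_apply, equiv_apply, equiv_symm_apply,
      LinearMap.comp_apply, LinearMap.add_apply, LinearMap.sub_apply, LinearMap.neg_apply,
      LinearMap.id_apply, map_add, map_sub, map_neg, dOdd_sEven, dEven_sOdd, sOdd_sEven_apply,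
      sEven_sOdd_apply, dEven_dOdd_apply, dOdd_dEven_apply, map_zero, sub_zero, add_zero, zero_add,
      zero_sub, neg_zero, neg_neg]
    abel
  rw [key, pdet_comp, pdet_one_add_of_comp_eq_zero, pdet_one_add_of_comp_eq_zero, one_mul]
  · apply LinearMap.ext
    intro x
    simp [dOdd_sEven, dEven_sOdd, sOdd_sEven_apply, sEven_sOdd_apply, dOdd_dEven_apply,
      dEven_dOdd_apply]
  · apply LinearMap.ext
    intro x
    simp [dOdd_sEven, dEven_sOdd, sOdd_sEven_apply, sEven_sOdd_apply, dOdd_dEven_apply,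
      dEven_dOdd_apply]

section Cone

lemma Hom.comm_even_apply (f : Hom F F') (x : F.even) :
    F'.dEven (f.even x) = f.odd (F.dEven x) := LinearMap.congr_fun f.comm_even x

lemma Hom.comm_odd_apply (f : Hom F F') (x : F.odd) :
    F'.dOdd (f.odd x) = f.even (F.dOdd x) := LinearMap.congr_fun f.comm_odd x

lemma _root_.DetFunctor.Mor.mk_comp_mk {X Y Z : VirtObj R} (f : StableIso X Y)
    (g : StableIso Y Z) : (Mor.mk f).comp (Mor.mk g) = Mor.mk (f.comp g) := rfl

/-- The contraction of the mapping cone given by contractions of source and target. -/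
def Contraction.cone (f : Hom F F') (t : F.Contraction) (t' : F'.Contraction) :
    (FoldedComplex.cone f).Contraction where
  sEven := (t'.sEven.coprod (t'.sEven ∘ₗ f.even ∘ₗ t.sOdd)).prod
    (-(t.sOdd ∘ₗ LinearMap.snd R F'.even F.odd))
  sOdd := (t'.sOdd.coprod (t'.sOdd ∘ₗ f.odd ∘ₗ t.sEven)).prod
    (-(t.sEven ∘ₗ LinearMap.snd R F'.odd F.even))
  homotopy_even := by
    apply LinearMap.ext
    rintro ⟨x, y⟩
    refine Prod.ext ?_ ?_
    · change F'.dOdd (t'.sEven x + t'.sEven (f.even (t.sOdd y))) + f.even (-(t.sOdd y)) +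
        (t'.sOdd (F'.dEven x + f.odd y) + t'.sOdd (f.odd (t.sEven (-F.dOdd y)))) = x
      simp only [map_add, map_neg, dOdd_sEven, Hom.comm_even_apply, dEven_sOdd, map_sub]
      abel
    · change -F.dEven (-(t.sOdd y)) + -(t.sEven (-F.dOdd y)) = y
      simp only [map_neg, dEven_sOdd]
      abel
  homotopy_odd := by
    apply LinearMap.ext
    rintro ⟨x, y⟩
    refine Prod.ext ?_ ?_
    · change F'.dEven (t'.sOdd x + t'.sOdd (f.odd (t.sEven y))) + f.odd (-(t.sEven y)) +
        (t'.sEven (F'.dOdd x + f.even y) + t'.sEven (f.even (t.sOdd (-F.dEven y)))) = x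
      simp only [map_add, map_neg, dOdd_sEven, Hom.comm_odd_apply, dEven_sOdd, map_sub]
      abel
    · change -F.dOdd (-(t.sEven y)) + -(t.sOdd (-F.dEven y)) = y
      simp only [map_neg, dOdd_sEven]
      abel
  sOdd_sEven := by
    apply LinearMap.ext
    rintro ⟨x, y⟩
    refine Prod.ext ?_ ?_
    · change t'.sOdd (t'.sEven x + t'.sEven (f.even (t.sOdd y))) +
        t'.sOdd (f.odd (t.sEven (-(t.sOdd y)))) = 0
      simp only [map_add, map_neg, sEven_sOdd_apply, sOdd_sEven_apply, map_zero, neg_zero, add_zero]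
    · change -(t.sEven (-(t.sOdd y))) = 0
      simp only [map_neg, sEven_sOdd_apply, neg_zero]
  sEven_sOdd := by
    apply LinearMap.ext
    rintro ⟨x, y⟩
    refine Prod.ext ?_ ?_
    · change t'.sEven (t'.sOdd x + t'.sOdd (f.odd (t.sEven y))) +
        t'.sEven (f.even (t.sOdd (-(t.sEven y)))) = 0
      simp only [map_add, map_neg, sEven_sOdd_apply, sOdd_sEven_apply, map_zero, neg_zero, add_zero]
    · change -(t.sOdd (-(t.sEven y))) = 0
      simp only [map_neg, sOdd_sEven_apply, neg_zero]

/-- In block form the map is triangular with diagonal entries `t'.equiv` and `-t.equiv.symm`. The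
minus sign is the one that `compPost` cancels when `d(f)` is composed with the trivialisation of
`F`. -/
lemma Contraction.cone_equiv_apply (f : Hom F F') (t : F.Contraction) (t' : F'.Contraction)
    (x : F'.odd) (y : F.even) :
    (Contraction.cone f t t').equiv (x, y) =
      (t'.equiv x + (f.even y + t'.sOdd (f.odd (t.sEven y))), - t.equiv.symm y) := by
  refine Prod.ext ?_ ?_
  · change (F'.dOdd x + f.even y) + (t'.sOdd x + t'.sOdd (f.odd (t.sEven y))) = _
    rw [equiv_apply]; abel
  · change -F.dEven y + -(t.sEven y) = _
    rw [equiv_symm_apply]; abel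

/-- Two contractions of the cone differ by an automorphism of determinant one, which is trivial in
`K₁` over a semilocal ring. Hence `d(f)` depends only on `f`. -/
lemma detMap_eq [Finite (MaximalSpectrum R)] (f : Hom F F')
    (s s' : (FoldedComplex.cone f).Contraction) : detMap f s = detMap f s' := by
  apply Mor.mk_eq_of_pdet
  rw [← Contraction.pdet_equiv_trans_symm s s']
  refine pdet_eq_of_equiv (P := F'.odd × F.even)
    (((LinearEquiv.prodComm R F'.odd F.even).trans LinearEquiv.prodUnique.symm).trans
      (LinearEquiv.prodAssoc R F.even F'.odd (FGProj.zero : FGProj R))) _ _ ?_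
  rintro ⟨x, y⟩
  rfl

/-- The isomorphism on determinants attached to a morphism of contractible complexes is compatible
with the trivialisations by acyclicity. -/
lemma Contraction.triv_comp_detMap [Finite (MaximalSpectrum R)] (f : Hom F F')
    (s : (FoldedComplex.cone f).Contraction) (t : F.Contraction) (t' : F'.Contraction)
    (X : VirtObj R) [Subsingleton X.pos] [Subsingleton X.neg] :
    (t.triv X).comp (detMap f s) = t'.triv X := by
  -- By independence of `s`, the cone may be contracted by the triangular contraction built from `t`
  -- and `t'`.
  rw [detMap_eq f s (Contraction.cone f t t')]
  let h : (X.pos × F'.odd) ≃ₗ[R] (F'.even × X.neg) :=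
    { toFun := fun x => (t'.equiv x.2, 0)
      invFun := fun x => (0, t'.equiv.symm x.1)
      map_add' := fun x y => by simp
      map_smul' := fun a x => by simp
      left_inv := fun x => Prod.ext (Subsingleton.elim _ _) (by simp)
      right_inv := fun x => Prod.ext (by simp) (Subsingleton.elim _ _) }
  apply Mor.eq_of_det_eq h
  have h1 : Mor.det h (t'.triv X) = 1 := by
    rw [Contraction.triv, Mor.det_mk]
    refine Eq.trans ?_ (pdet_id (R := R) (P := X.pos × F'.odd × (FGProj.zero : FGProj R)))
    congr 1
    apply LinearMap.ext
    intro x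
    refine Prod.ext (Subsingleton.elim _ _) (Prod.ext ?_ rfl)
    exact t'.equiv.symm_apply_apply x.2.1
  rw [h1, Contraction.triv, detMap, Mor.mk_comp_mk, Mor.det_mk]
  -- Relative to `h` the composite is the identity plus the off-diagonal term `L`, which goes from
  -- the summand `F.odd` to the summand `F'.odd` and so does not affect the determinant.
  let L : F.odd →ₗ[R] F'.odd := t'.equiv.symm.toLinearMap ∘ₗ
    (f.even + t'.sOdd ∘ₗ f.odd ∘ₗ t.sEven) ∘ₗ t.equiv.toLinearMap
  let W : FGProj R := X.pos.prod (F'.odd.prod (F.odd.prod (FGProj.zero.prod FGProj.zero)))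
  let i : F'.odd →ₗ[R] W := LinearMap.inr R _ _ ∘ₗ LinearMap.inl R _ _
  let q : W →ₗ[R] F.odd := LinearMap.fst R _ _ ∘ₗ LinearMap.snd R _ _ ∘ₗ LinearMap.snd R _ _
  have hq : q ∘ₗ (i ∘ₗ L) = 0 := by
    apply LinearMap.ext
    intro x
    rfl
  refine Eq.trans ?_ (pdet_one_add_of_comp_eq_zero (i ∘ₗ L) q hq)
  congr 1
  apply LinearMap.ext
  rintro ⟨a, p, b, z, z'⟩
  have hcone := Contraction.cone_equiv_apply f t t' p (t.equiv b)
  refine Prod.ext (Subsingleton.elim _ _) (Prod.ext ?_ (Prod.ext ?_ (Subsingleton.elim _ _)))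
  · change t'.equiv.symm ((Contraction.cone f t t').equiv (p, t.equiv b)).1 = p + L b
    rw [hcone, map_add, LinearEquiv.symm_apply_apply]
    rfl
  · change -((Contraction.cone f t t').equiv (p, t.equiv b)).2 = b + 0
    rw [hcone]
    simp

end Cone

section BaseChange

variable (A : Type u) [CommRing A] [Algebra R A]

/-- Extension of scalars of a contraction. -/
def Contraction.baseChange (t : F.Contraction) : (F.baseChange A).Contraction where
  sEven := t.sEven.baseChange A
  sOdd := t.sOdd.baseChange A
  homotopy_even := by
    have h := congrArg (LinearMap.baseChange A) t.homotopy_even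
    rw [LinearMap.baseChange_add, LinearMap.baseChange_comp, LinearMap.baseChange_comp,
      LinearMap.baseChange_id] at h
    exact h
  homotopy_odd := by
    have h := congrArg (LinearMap.baseChange A) t.homotopy_odd
    rw [LinearMap.baseChange_add, LinearMap.baseChange_comp, LinearMap.baseChange_comp,
      LinearMap.baseChange_id] at h
    exact h
  sOdd_sEven := by
    have h := congrArg (LinearMap.baseChange A) t.sOdd_sEven
    rw [LinearMap.baseChange_comp, LinearMap.baseChange_zero] at h
    exact h
  sEven_sOdd := by
    have h := congrArg (LinearMap.baseChange A) t.sEven_sOdd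
    rw [LinearMap.baseChange_comp, LinearMap.baseChange_zero] at h
    exact h

lemma Contraction.baseChange_equiv (t : F.Contraction) :
    (t.baseChange A).equiv.toLinearMap = t.equiv.toLinearMap.baseChange A := by
  exact (LinearMap.baseChange_add F.dOdd t.sOdd).symm

/-- Extension of scalars of a morphism. -/
def Hom.baseChange (f : Hom F F') : Hom (F.baseChange A) (F'.baseChange A) where
  even := f.even.baseChange A
  odd := f.odd.baseChange A
  comm_even := by
    change F'.dEven.baseChange A ∘ₗ f.even.baseChange A =
      f.odd.baseChange A ∘ₗ F.dEven.baseChange A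
    rw [← LinearMap.baseChange_comp, ← LinearMap.baseChange_comp, f.comm_even]
  comm_odd := by
    change F'.dOdd.baseChange A ∘ₗ f.odd.baseChange A =
      f.even.baseChange A ∘ₗ F.dOdd.baseChange A
    rw [← LinearMap.baseChange_comp, ← LinearMap.baseChange_comp, f.comm_odd]

/-- Transport of a contraction along an isomorphism of complexes. -/
def Contraction.transport (t : F.Contraction) (e : F.even ≃ₗ[R] F'.even) (o : F.odd ≃ₗ[R] F'.odd)
    (he : ∀ x, F'.dEven (e x) = o (F.dEven x)) (ho : ∀ x, F'.dOdd (o x) = e (F.dOdd x)) :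
    F'.Contraction where
  sEven := o.toLinearMap ∘ₗ t.sEven ∘ₗ e.symm.toLinearMap
  sOdd := e.toLinearMap ∘ₗ t.sOdd ∘ₗ o.symm.toLinearMap
  homotopy_even := by
    apply LinearMap.ext
    intro x
    obtain ⟨x, rfl⟩ := e.surjective x
    simp [he, ho, dOdd_sEven]
  homotopy_odd := by
    apply LinearMap.ext
    intro x
    obtain ⟨x, rfl⟩ := o.surjective x
    simp [he, ho, dEven_sOdd]
  sOdd_sEven := by
    apply LinearMap.ext
    intro x
    simp [sOdd_sEven_apply]
  sEven_sOdd := by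
    apply LinearMap.ext
    intro x
    simp [sEven_sOdd_apply]

lemma Contraction.transport_equiv (t : F.Contraction) (e : F.even ≃ₗ[R] F'.even)
    (o : F.odd ≃ₗ[R] F'.odd) (he : ∀ x, F'.dEven (e x) = o (F.dEven x))
    (ho : ∀ x, F'.dOdd (o x) = e (F.dOdd x)) (x : F.odd) :
    (t.transport e o he ho).equiv (o x) = e (t.equiv x) := by
  rw [equiv_apply, equiv_apply, ho, map_add]
  congr 1
  simp [transport]

/-- The cone of the extended map and the extension of the cone have different underlying modules.
`prodRight` identifies them compatibly with the differentials, so contractions can be carried over.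
-/
lemma cone_baseChange_dEven (f : Hom F F') (x : A ⊗[R] (F'.even × F.odd)) :
    (cone (f.baseChange A)).dEven (TensorProduct.prodRight R A A F'.even F.odd x) =
      TensorProduct.prodRight R A A F'.odd F.even ((cone f).dEven.baseChange A x) := by
  let L : (A ⊗[R] (F'.even × F.odd)) →ₗ[A] ((A ⊗[R] F'.odd) × (A ⊗[R] F.even)) :=
    (cone (f.baseChange A)).dEven ∘ₗ (TensorProduct.prodRight R A A F'.even F.odd).toLinearMap
  let L' : (A ⊗[R] (F'.even × F.odd)) →ₗ[A] ((A ⊗[R] F'.odd) × (A ⊗[R] F.even)) :=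
    (TensorProduct.prodRight R A A F'.odd F.even).toLinearMap ∘ₗ (cone f).dEven.baseChange A
  have h : L = L' := by
    refine TensorProduct.AlgebraTensorModule.ext fun a x => Prod.ext ?_ ?_
    · exact (TensorProduct.tmul_add a (F'.dEven x.1) (f.odd x.2)).symm
    · exact (TensorProduct.tmul_neg a (F.dOdd x.2)).symm
  exact LinearMap.congr_fun h x

lemma cone_baseChange_dOdd (f : Hom F F') (x : A ⊗[R] (F'.odd × F.even)) :
    (cone (f.baseChange A)).dOdd (TensorProduct.prodRight R A A F'.odd F.even x) =
      TensorProduct.prodRight R A A F'.even F.odd ((cone f).dOdd.baseChange A x) := by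
  let L : (A ⊗[R] (F'.odd × F.even)) →ₗ[A] ((A ⊗[R] F'.even) × (A ⊗[R] F.odd)) :=
    (cone (f.baseChange A)).dOdd ∘ₗ (TensorProduct.prodRight R A A F'.odd F.even).toLinearMap
  let L' : (A ⊗[R] (F'.odd × F.even)) →ₗ[A] ((A ⊗[R] F'.even) × (A ⊗[R] F.odd)) :=
    (TensorProduct.prodRight R A A F'.even F.odd).toLinearMap ∘ₗ (cone f).dOdd.baseChange A
  have h : L = L' := by
    refine TensorProduct.AlgebraTensorModule.ext fun a x => Prod.ext ?_ ?_
    · exact (TensorProduct.tmul_add a (F'.dOdd x.1) (f.even x.2)).symm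
    · exact (TensorProduct.tmul_neg a (F.dEven x.2)).symm
  exact LinearMap.congr_fun h x

/-- Extension of scalars of a contraction of a mapping cone. -/
def Contraction.coneBaseChange {f : Hom F F'} (s : (FoldedComplex.cone f).Contraction) :
    (FoldedComplex.cone (f.baseChange A)).Contraction :=
  (s.baseChange A).transport (F' := FoldedComplex.cone (f.baseChange A))
    (TensorProduct.prodRight R A A F'.even F.odd)
    (TensorProduct.prodRight R A A F'.odd F.even)
    (cone_baseChange_dEven A f) (cone_baseChange_dOdd A f)

lemma Contraction.coneBaseChange_equiv {f : Hom F F'}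
    (s : (FoldedComplex.cone f).Contraction) (x : A ⊗[R] (F'.odd × F.even)) :
    (s.coneBaseChange A).equiv (TensorProduct.prodRight R A A F'.odd F.even x) =
      TensorProduct.prodRight R A A F'.even F.odd (s.equiv.toLinearMap.baseChange A x) := by
  have h := (s.baseChange A).transport_equiv (F' := FoldedComplex.cone (f.baseChange A))
    (TensorProduct.prodRight R A A F'.even F.odd)
    (TensorProduct.prodRight R A A F'.odd F.even)
    (cone_baseChange_dEven A f) (cone_baseChange_dOdd A f) x
  refine Eq.trans h ?_
  rw [← Contraction.baseChange_equiv]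
  rfl

/-- The left side has auxiliary module `A ⊗ 0` instead of `0`, which `e` removes. What remains is
the formula for the transported contraction, compared on pure tensors. -/
lemma detMap_baseChange (f : Hom F F') (s : (FoldedComplex.cone f).Contraction) :
    (detMap f s).baseChange A = detMap (f.baseChange A) (s.coneBaseChange A) := by
  let g : StableIso F.det F'.det :=
    { stab := FGProj.zero
      iso := (LinearEquiv.prodAssoc R F.even F'.odd _).symm.trans <|
        (LinearEquiv.prodCongr ((LinearEquiv.prodComm R F.even F'.odd).trans s.equiv)
          (LinearEquiv.refl R _)).trans (LinearEquiv.prodAssoc R F'.even F.odd _) }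
  change Mor.mk (g.baseChange A) = _
  let e : ((A ⊗[R] (FGProj.zero : FGProj R)) × (FGProj.zero : FGProj A)) ≃ₗ[A]
      (FGProj.zero : FGProj A) :=
    LinearEquiv.prodUnique.trans (LinearEquiv.ofSubsingleton _ _)
  rw [Mor.mk_ext (g.baseChange A) FGProj.zero FGProj.zero e]
  refine congrArg (fun i => (Mor.mk (X := F.det.baseChange A) (Y := F'.det.baseChange A)
    ⟨FGProj.zero, i⟩)) ?_
  let ψ : ((A ⊗[R] F.even) × (A ⊗[R] F'.odd) × (FGProj.zero : FGProj A)) ≃ₗ[A]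
      ((A ⊗[R] F'.even) × (A ⊗[R] F.odd) × (FGProj.zero : FGProj A)) :=
    (LinearEquiv.prodAssoc A _ _ _).symm.trans <|
        (LinearEquiv.prodCongr ((LinearEquiv.prodComm A _ _).trans (s.coneBaseChange A).equiv)
          (LinearEquiv.refl A _)).trans (LinearEquiv.prodAssoc A _ _ _)
  change extIso (bcIso A g.iso) e = ψ
  have hpt : ∀ w : A ⊗[R] (F.even × F'.odd),
      extIso (bcIso A g.iso) e ((TensorProduct.prodRight R A A F.even F'.odd w).1,
        (TensorProduct.prodRight R A A F.even F'.odd w).2, 0) =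
      ψ ((TensorProduct.prodRight R A A F.even F'.odd w).1,
        (TensorProduct.prodRight R A A F.even F'.odd w).2, 0) := by
    intro w
    induction w with
    | zero =>
      rw [map_zero]
      exact (map_zero _).trans (map_zero _).symm
    | add w w' hw hw' =>
      have h : ∀ w w' : A ⊗[R] (F.even × F'.odd),
          ((TensorProduct.prodRight R A A F.even F'.odd (w + w')).1,
            (TensorProduct.prodRight R A A F.even F'.odd (w + w')).2,
            (0 : (FGProj.zero : FGProj A))) =
          ((TensorProduct.prodRight R A A F.even F'.odd w).1,
            (TensorProduct.prodRight R A A F.even F'.odd w).2, 0) +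
          ((TensorProduct.prodRight R A A F.even F'.odd w').1,
            (TensorProduct.prodRight R A A F.even F'.odd w').2, 0) := by
        intro w w'
        rw [map_add, Prod.mk_add_mk, Prod.mk_add_mk]
        rfl
      rw [h]
      refine (map_add _ _ _).trans ?_
      rw [hw, hw']
      exact (map_add _ _ _).symm
    | tmul a x =>
      obtain ⟨x, y⟩ := x
      change extIso (bcIso A g.iso) e (a ⊗ₜ[R] x, a ⊗ₜ[R] y, 0) = ψ (a ⊗ₜ[R] x, a ⊗ₜ[R] y, 0)
      have he : e.symm 0 = (a ⊗ₜ[R] 0, 0) := Subsingleton.elim _ _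
      have h1 := bcIso_tmul A g.iso a (x, y, 0)
      dsimp only at h1
      rw [extIso_apply]
      dsimp only
      rw [he, h1]
      have h2 := Contraction.coneBaseChange_equiv A s (a ⊗ₜ[R] (y, x))
      refine Prod.ext ?_ (Prod.ext ?_ (Subsingleton.elim _ _))
      · exact (congrArg Prod.fst h2).symm
      · exact (congrArg Prod.snd h2).symm
  apply LinearEquiv.ext
  rintro ⟨x, y, z⟩
  have := hpt ((TensorProduct.prodRight R A A F.even F'.odd).symm (x, y))
  rw [LinearEquiv.apply_symm_apply] at this
  exact this

end BaseChange

end FoldedComplex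

end DetFunctor

end

/-! ### Finite projective dimension: contractibility of exact complexes, and tests at primes of
height at most one. -/

noncomputable section

open TensorProduct CategoryTheory

namespace DetFunctor

/-- Every finitely generated module has finite projective dimension. -/
def HasFiniteProjDims (R : Type u) [CommRing R] : Prop :=
  ∀ (M : Type u) [AddCommGroup M] [Module R M] [Module.Finite R M],
    ∃ n, HasProjectiveDimensionLE (ModuleCat.of R M) n

section Dimension

variable {R : Type u} [CommRing R]

lemma hasProjectiveDimensionLE_ker_of_succ {P N : Type u} [AddCommGroup P] [Module R P]
    [AddCommGroup N] [Module R N] [Module.Projective R P] {f : P →ₗ[R] N}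
    (hf : Function.Surjective f) {n : ℕ}
    (h : HasProjectiveDimensionLE (ModuleCat.of R N) (n + 1)) :
    HasProjectiveDimensionLE (ModuleCat.of R (LinearMap.ker f)) n := by
  have hS := LinearMap.shortExact_shortComplexKer hf
  have : Projective (ModuleCat.of R P) := (IsProjective.iff_projective P).1 inferInstance
  exact (hS.hasProjectiveDimensionLT_X₃_iff n this).1 h

lemma projective_of_hasProjectiveDimensionLE_zero {N : Type u} [AddCommGroup N] [Module R N]
    (h : HasProjectiveDimensionLE (ModuleCat.of R N) 0) : Module.Projective R N := by
  simp only [HasProjectiveDimensionLE, zero_add] at h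
  exact (IsProjective.iff_projective N).2 (projective_iff_hasProjectiveDimensionLT_one.2 h)

/-- Two modules which are syzygies of each other are projective. -/
lemma projective_of_mutual_syzygies {P Q : Type u} [AddCommGroup P] [Module R P]
    [AddCommGroup Q] [Module R Q] [Module.Projective R P] [Module.Projective R Q]
    {K L : Type u} [AddCommGroup K] [Module R K] [AddCommGroup L] [Module R L]
    {f : P →ₗ[R] L} (hf : Function.Surjective f) (e : LinearMap.ker f ≃ₗ[R] K)
    {g : Q →ₗ[R] K} (hg : Function.Surjective g) (e' : LinearMap.ker g ≃ₗ[R] L)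
    {m n : ℕ} (hK : HasProjectiveDimensionLE (ModuleCat.of R K) m)
    (hL : HasProjectiveDimensionLE (ModuleCat.of R L) n) :
    Module.Projective R K ∧ Module.Projective R L := by
  -- Passing to kernels lowers a common bound by one and merely exchanges the two modules, so the
  -- bound can be brought down to zero.
  have key : ∀ d : ℕ, HasProjectiveDimensionLE (ModuleCat.of R K) d →
      HasProjectiveDimensionLE (ModuleCat.of R L) d →
      Module.Projective R K ∧ Module.Projective R L := by
    intro d
    induction d with
    | zero =>
      exact fun h h' => ⟨projective_of_hasProjectiveDimensionLE_zero h,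
        projective_of_hasProjectiveDimensionLE_zero h'⟩
    | succ d ih =>
      intro h h'
      have h1 := hasProjectiveDimensionLE_ker_of_succ hf h'
      have h2 := hasProjectiveDimensionLE_ker_of_succ hg h
      exact ih (ModuleCat.hasProjectiveDimensionLE_of_linearEquiv
          (M := ModuleCat.of R (LinearMap.ker f)) (N := ModuleCat.of R K) e d)
        (ModuleCat.hasProjectiveDimensionLE_of_linearEquiv
          (M := ModuleCat.of R (LinearMap.ker g)) (N := ModuleCat.of R L) e' d)
  refine key (max m n) ?_ ?_
  · exact hasProjectiveDimensionLT_of_ge _ (m + 1) _ (by omega)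
  · exact hasProjectiveDimensionLT_of_ge _ (n + 1) _ (by omega)

/-- A periodic exact complex of projectives need not split, as it has no end from which to start.
Here the even and odd cycles are syzygies of each other, so finite projective dimension makes both
projective, and sections of the differentials onto the cycles give the contraction. -/
lemma FoldedComplex.nonempty_contraction_of_exact [IsNoetherianRing R] (hR : HasFiniteProjDims R)
    (F : FoldedComplex R) (he : ∀ x, F.dEven x = 0 → ∃ y, F.dOdd y = x)
    (ho : ∀ y, F.dOdd y = 0 → ∃ x, F.dEven x = y) : Nonempty F.Contraction := by
  let f : F.even →ₗ[R] LinearMap.ker F.dOdd :=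
    F.dEven.codRestrict _ fun x => F.dOdd_dEven_apply x
  let g : F.odd →ₗ[R] LinearMap.ker F.dEven :=
    F.dOdd.codRestrict _ fun x => F.dEven_dOdd_apply x
  have hf : Function.Surjective f := fun y => by
    obtain ⟨x, hx⟩ := ho y.1 y.2
    exact ⟨x, Subtype.ext hx⟩
  have hg : Function.Surjective g := fun y => by
    obtain ⟨x, hx⟩ := he y.1 y.2
    exact ⟨x, Subtype.ext hx⟩
  obtain ⟨m, hm⟩ := hR (LinearMap.ker F.dEven)
  obtain ⟨n, hn⟩ := hR (LinearMap.ker F.dOdd)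
  obtain ⟨h1, h2⟩ := projective_of_mutual_syzygies hf
    (LinearEquiv.ofEq _ _ (LinearMap.ker_codRestrict _ _ _)) hg
    (LinearEquiv.ofEq _ _ (LinearMap.ker_codRestrict _ _ _)) hm hn
  obtain ⟨σ, hσ⟩ := Module.projective_lifting_property f LinearMap.id hf
  obtain ⟨τ, hτ⟩ := Module.projective_lifting_property g LinearMap.id hg
  have hσ' : ∀ y, F.dEven (σ y) = y := fun y => congrArg Subtype.val (LinearMap.congr_fun hσ y)
  have hτ' : ∀ y, F.dOdd (τ y) = y := fun y => congrArg Subtype.val (LinearMap.congr_fun hτ y)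
  have h3 : ∀ x, F.dEven (x - σ (f x)) = 0 := fun x => by
    rw [map_sub, hσ', sub_eq_zero]
    rfl
  have h4 : ∀ x, F.dOdd (x - τ (g x)) = 0 := fun x => by
    rw [map_sub, hτ', sub_eq_zero]
    rfl
  -- The sections split each part into cycles and a complement; `a` and `b` are the projections onto
  -- the cycles, and the contraction projects to cycles and then applies a section. The square is
  -- zero because `a σ = 0` and `b τ = 0`.
  let a : F.even →ₗ[R] LinearMap.ker F.dEven := (LinearMap.id - σ ∘ₗ f).codRestrict _ h3
  let b : F.odd →ₗ[R] LinearMap.ker F.dOdd := (LinearMap.id - τ ∘ₗ g).codRestrict _ h4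
  have ha : ∀ x, (a x : F.even) = x - σ (f x) := fun x => rfl
  have hb : ∀ x, (b x : F.odd) = x - τ (g x) := fun x => rfl
  have hfσ : ∀ y, f (σ y) = y := fun y => LinearMap.congr_fun hσ y
  have hgτ : ∀ y, g (τ y) = y := fun y => LinearMap.congr_fun hτ y
  have haσ : ∀ y, a (σ y) = 0 := fun y => Subtype.ext (by rw [ha, hfσ, sub_self]; rfl)
  have hbτ : ∀ y, b (τ y) = 0 := fun y => Subtype.ext (by rw [hb, hgτ, sub_self]; rfl)
  have hbf : ∀ x, b (F.dEven x) = f x := fun x => Subtype.ext (by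
    have : g (F.dEven x) = 0 := Subtype.ext (F.dOdd_dEven_apply x)
    rw [hb, this, map_zero, sub_zero]
    rfl)
  have hag : ∀ x, a (F.dOdd x) = g x := fun x => Subtype.ext (by
    have : f (F.dOdd x) = 0 := Subtype.ext (F.dEven_dOdd_apply x)
    rw [ha, this, map_zero, sub_zero]
    rfl)
  exact ⟨{
    sEven := τ ∘ₗ a
    sOdd := σ ∘ₗ b
    homotopy_even := LinearMap.ext fun x => by
      simp only [LinearMap.add_apply, LinearMap.comp_apply, LinearMap.id_apply]
      rw [hτ', ha, hbf, sub_add_cancel]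
    homotopy_odd := LinearMap.ext fun x => by
      simp only [LinearMap.add_apply, LinearMap.comp_apply, LinearMap.id_apply]
      rw [hσ', hb, hag, sub_add_cancel]
    sOdd_sEven := LinearMap.ext fun x => by
      simp only [LinearMap.comp_apply, hbτ, map_zero, LinearMap.zero_apply]
    sEven_sOdd := LinearMap.ext fun x => by
      simp only [LinearMap.comp_apply, haσ, map_zero, LinearMap.zero_apply] }⟩

end Dimension

/-! ### Local rings with `𝔪` associated to `A/(b)` have dimension at most one. -/

section Depth

variable {A : Type u} [CommRing A] [IsLocalRing A] [IsNoetherianRing A]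

/-- Lift a basis of `k ⊗ N`. Nakayama gives surjectivity, and linear independence over `k` forces
the coefficients of every relation into the maximal ideal. -/
lemma exists_minimal_cover (N : Type u) [AddCommGroup N] [Module A N] [Module.Finite A N] :
    ∃ (n : ℕ) (f : (Fin n → A) →ₗ[A] N), Function.Surjective f ∧
      ∀ x, f x = 0 → ∀ i, x i ∈ IsLocalRing.maximalIdeal A := by
  let k := A ⧸ IsLocalRing.maximalIdeal A
  letI : Field k := Ideal.Quotient.field _
  let b := Module.finBasis k (k ⊗[A] N)
  have hs : Function.Surjective (TensorProduct.mk A k N 1) :=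
    TensorProduct.mk_surjective A N k Ideal.Quotient.mk_surjective
  choose v hv using fun i => hs (b i)
  refine ⟨_, Fintype.linearCombination A v, ?_, ?_⟩
  · rw [← LinearMap.range_eq_top, Fintype.range_linearCombination]
    exact IsLocalRing.span_eq_top_of_tmul_eq_basis v b hv
  · intro x hx i
    rw [Fintype.linearCombination_apply] at hx
    have h1 : ∑ i, (Ideal.Quotient.mk (IsLocalRing.maximalIdeal A) (x i) : k) • b i = 0 := by
      have := congrArg (TensorProduct.mk A k N 1) hx
      rw [map_sum, map_zero] at this
      rw [← this]
      refine Finset.sum_congr rfl fun j _ => ?_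
      rw [map_smul, hv]
      rfl
    exact Ideal.Quotient.eq_zero_iff_mem.1
      (Fintype.linearIndependent_iff.1 b.linearIndependent _ h1 i)

/-- If the maximal ideal multiplies `s ∉ (b)` into `(b)`, then modules of finite projective
dimension on which `b` is zero or regular are free. -/
lemma free_of_hasProjectiveDimensionLE (b s : A) (hb : b = 0 ∨ IsSMulRegular A b)
    (hs : s ∉ Ideal.span {b}) (hms : ∀ m ∈ IsLocalRing.maximalIdeal A, m * s ∈ Ideal.span {b})
    (d : ℕ) (N : Type u) [AddCommGroup N] [Module A N] [Module.Finite A N]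
    (hN : b = 0 ∨ IsSMulRegular N b) (h : HasProjectiveDimensionLE (ModuleCat.of A N) d) :
    Module.Free A N := by
  induction d generalizing N with
  | zero =>
    have := projective_of_hasProjectiveDimensionLE_zero h
    exact Module.free_of_flat_of_isLocalRing
  | succ d ih =>
    obtain ⟨n, f, hf, hmin⟩ := exists_minimal_cover (A := A) N
    have hfree : Module.Free A (LinearMap.ker f) := by
      refine ih (LinearMap.ker f) ?_ (hasProjectiveDimensionLE_ker_of_succ hf h)
      refine hb.imp_right fun hb x y hxy => Subtype.ext (funext fun i => hb ?_)
      exact congrFun (congrArg Subtype.val hxy) i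
    -- The coordinates of `x` lie in `𝔪`, so `s` carries them into `(b)`. For `b ≠ 0`, the quotient
    -- by `b` is again in the kernel because `b` is regular on `N`.
    have hsK : ∀ x : LinearMap.ker f, ∃ y : LinearMap.ker f, s • x = b • y := by
      intro x
      rcases eq_or_ne b 0 with h0 | h0
      · refine ⟨0, Subtype.ext (funext fun i => ?_)⟩
        have := hms _ (hmin x.1 x.2 i)
        rw [h0, Ideal.span_singleton_zero, Ideal.mem_bot] at this
        simpa [mul_comm] using this
      · choose y hy using fun i => Ideal.mem_span_singleton'.1 (hms _ (hmin x.1 x.2 i))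
        have hxy : s • x.1 = b • y := funext fun i => by
          simp only [Pi.smul_apply, smul_eq_mul]
          rw [mul_comm b, hy, mul_comm]
        refine ⟨⟨y, ?_⟩, Subtype.ext hxy⟩
        refine (hN.resolve_left h0) (?_ : b • f y = b • 0)
        rw [← map_smul, ← hxy, map_smul, x.2, smul_zero, smul_zero]
    -- The kernel is free by induction. A basis vector `e i` would satisfy `s e i = b y`, and its
    -- coordinate would give `s ∈ (b)`; so there is none.
    have hK : Subsingleton (LinearMap.ker f) := by
      let e := Module.Free.chooseBasis A (LinearMap.ker f)
      rw [e.repr.toEquiv.subsingleton_congr]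
      refine (isEmpty_or_nonempty (Module.Free.ChooseBasisIndex A (LinearMap.ker f))).elim
        (fun _ => inferInstance) fun ⟨i⟩ => (hs ?_).elim
      obtain ⟨y, hy⟩ := hsK (e i)
      refine Ideal.mem_span_singleton'.2 ⟨e.repr y i, ?_⟩
      have := congrArg (fun z => e.repr z i) hy
      simpa [mul_comm] using this.symm
    have hinj : Function.Injective f := LinearMap.ker_eq_bot.1
      ((Submodule.subsingleton_iff_eq_bot).1 hK)
    exact Module.Free.of_equiv (LinearEquiv.ofBijective f ⟨hinj, hf⟩)

/-- The preceding result applies to `𝔪` itself, as regularity of `b` passes to ideals. A free ideal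
has at most one basis element, so `𝔪` is principal and Krull's theorem bounds its height. -/
lemma maximalIdeal_height_le_one (hA : HasFiniteProjDims A) (b s : A)
    (hb : b = 0 ∨ IsSMulRegular A b) (hs : s ∉ Ideal.span {b})
    (hms : ∀ m ∈ IsLocalRing.maximalIdeal A, m * s ∈ Ideal.span {b}) :
    (IsLocalRing.maximalIdeal A).height ≤ 1 := by
  obtain ⟨d, hd⟩ := hA (IsLocalRing.maximalIdeal A)
  have hfree := free_of_hasProjectiveDimensionLE b s hb hs hms d (IsLocalRing.maximalIdeal A)
    (hb.imp_right fun h x y hxy => Subtype.ext (h (congrArg Subtype.val hxy))) hd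
  let e := Module.Free.chooseBasis A (IsLocalRing.maximalIdeal A)
  have hsub : Subsingleton (Module.Free.ChooseBasisIndex A (IsLocalRing.maximalIdeal A)) := by
    by_contra hcon
    rw [not_subsingleton_iff_nontrivial] at hcon
    obtain ⟨i, j, hij⟩ := hcon
    -- Two elements of an ideal always satisfy this relation, which contradicts independence of
    -- distinct basis elements.
    have h1 : (e j : A) • e i = (e i : A) • e j := Subtype.ext (mul_comm _ _)
    have h2 := congrArg (fun z => e.repr z i) h1
    have h3 : (e j : A) = 0 := by simpa [Finsupp.single_apply, hij.symm] using h2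
    exact e.ne_zero j (Subtype.ext h3)
  have hprin : (IsLocalRing.maximalIdeal A).IsPrincipal := by
    rcases isEmpty_or_nonempty (Module.Free.ChooseBasisIndex A (IsLocalRing.maximalIdeal A)) with
      hι | ⟨⟨i⟩⟩
    · refine ⟨0, le_antisymm (fun x hx => ?_) (by simp)⟩
      have : Subsingleton (IsLocalRing.maximalIdeal A) :=
        e.repr.toEquiv.subsingleton_congr.2 inferInstance
      have h0 := congrArg Subtype.val
        (Subsingleton.elim (⟨x, hx⟩ : IsLocalRing.maximalIdeal A) 0)
      rw [show x = 0 from h0]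
      exact Submodule.zero_mem _
    · refine ⟨(e i : A), le_antisymm (fun x hx => ?_) ?_⟩
      · letI : Unique (Module.Free.ChooseBasisIndex A (IsLocalRing.maximalIdeal A)) :=
          ⟨⟨i⟩, fun _ => Subsingleton.elim _ _⟩
        have h1 := e.sum_repr ⟨x, hx⟩
        rw [Fintype.sum_unique] at h1
        exact Submodule.mem_span_singleton.2 ⟨_, congrArg Subtype.val h1⟩
      · rw [Submodule.span_singleton_le_iff_mem]
        exact (e i).2
  exact Ideal.height_le_one_of_isPrincipal_of_mem_minimalPrimes (IsLocalRing.maximalIdeal A) _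
    (by rw [Ideal.minimalPrimes_eq_subsingleton_self]; rfl)

end Depth

/-! ### Reduction to primes of height at most one. -/

section Localization

variable {R : Type u} [CommRing R] (S : Submonoid R)

/-- A finitely generated module over the localisation is the localisation of the `R`-submodule
spanned by finitely many generators, and localisation does not raise projective dimension. -/
lemma HasFiniteProjDims.localization [IsNoetherianRing R] (hR : HasFiniteProjDims R) :
    HasFiniteProjDims (Localization S) := by
  intro N _ _ _
  letI : Module R N := Module.compHom N (algebraMap R (Localization S))
  haveI : IsScalarTower R (Localization S) N := IsScalarTower.of_algebraMap_smul fun _ _ => rfl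
  obtain ⟨s, hs⟩ := (Module.Finite.fg_top : (⊤ : Submodule (Localization S) N).FG)
  let N₀ : Submodule R N := Submodule.span R s
  have : Module.Finite R N₀ := Module.Finite.of_fg ⟨s, rfl⟩
  obtain ⟨n, hn⟩ := hR N₀
  refine ⟨n, ?_⟩
  have h1 := ModuleCat.localizedModule_hasProjectiveDimensionLE n S (ModuleCat.of R N₀)
  have hid := isLocalizedModule_id S N (Localization S)
  have htop : N₀.localized' (Localization S) S (LinearMap.id : N →ₗ[R] N) = ⊤ := by
    rw [Submodule.localized'_eq_span, eq_top_iff, ← hs]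
    exact Submodule.span_mono fun x hx => ⟨x, Submodule.subset_span hx, rfl⟩
  let g := N₀.toLocalized' (Localization S) S (LinearMap.id : N →ₗ[R] N)
  have := ModuleCat.localizedModule_isLocalizedModule (ModuleCat.of R N₀) S
  let e₁ : (ModuleCat.of R N₀).localizedModule S ≃ₗ[R]
      N₀.localized' (Localization S) S (LinearMap.id : N →ₗ[R] N) :=
    IsLocalizedModule.linearEquiv S ((ModuleCat.of R N₀).localizedModuleMkLinearMap S) g
  let e₂ := (e₁.extendScalarsOfIsLocalization S (Localization S)).trans
    (LinearEquiv.ofTop _ htop)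
  exact ModuleCat.hasProjectiveDimensionLE_of_linearEquiv (N := ModuleCat.of (Localization S) N)
    e₂ n

lemma exists_mul_mem_of_algebraMap_mem {R : Type u} [CommRing R] (q : Ideal R) [q.IsPrime]
    {a b : R} (h : algebraMap R (Localization.AtPrime q) a ∈
      Ideal.span {algebraMap R (Localization.AtPrime q) b}) :
    ∃ u ∉ q, u * a ∈ Ideal.span {b} := by
  rw [← Set.image_singleton, ← Ideal.map_span,
    IsLocalization.algebraMap_mem_map_algebraMap_iff q.primeCompl] at h
  obtain ⟨u, hu, h⟩ := h
  exact ⟨u, hu, h⟩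

variable [IsNoetherianRing R]

/-- Associated primes of `R / (b)`, for `b` zero or regular, have height at most one. -/
lemma height_le_one_of_colon (hR : HasFiniteProjDims R) (q : Ideal R) [q.IsPrime] (b c : R)
    (hb : b = 0 ∨ b ∈ nonZeroDivisors R) (hq : ∀ r, r ∈ q ↔ r * c ∈ Ideal.span {b}) :
    q.height ≤ 1 := by
  have h1 := IsLocalization.AtPrime.ringKrullDim_eq_height q (Localization.AtPrime q)
  rw [← IsLocalRing.maximalIdeal_height_eq_ringKrullDim, WithBot.coe_inj] at h1
  rw [← h1]
  refine maximalIdeal_height_le_one (hR.localization _) (algebraMap R _ b) (algebraMap R _ c)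
    ?_ ?_ ?_
  · rcases hb with rfl | hb
    · exact Or.inl (map_zero _)
    · refine Or.inr (IsSMulRegular.of_flat fun x y hxy => ?_)
      have h2 : b * (x - y) = 0 := by rw [mul_sub, sub_eq_zero]; exact hxy
      exact sub_eq_zero.1 ((mul_left_mem_nonZeroDivisors_eq_zero_iff hb).1 h2)
  · intro hc
    obtain ⟨u, hu, huc⟩ := exists_mul_mem_of_algebraMap_mem q hc
    exact hu ((hq u).2 huc)
  · intro m hm
    obtain ⟨r, s, rfl⟩ := IsLocalization.exists_mk'_eq q.primeCompl m
    have hr := (hq r).1 ((IsLocalization.AtPrime.mk'_mem_maximal_iff _ q r s).1 hm)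
    obtain ⟨z, hz⟩ := Ideal.mem_span_singleton'.1 hr
    refine Ideal.mem_span_singleton'.2 ⟨IsLocalization.mk' _ z s, ?_⟩
    rw [mul_comm, IsLocalization.mul_mk'_eq_mk'_of_mul, mul_comm b, hz, mul_comm r,
      ← IsLocalization.mul_mk'_eq_mk'_of_mul, mul_comm]

/-- The annihilator of the nonzero class of `a` in `R/(b)` lies in an associated prime of `R/(b)`,
the annihilator of the class of some `c`. -/
lemma exists_colon_prime {a b : R} (h : a ∉ Ideal.span {b}) :
    ∃ (q : Ideal R) (c : R), q.IsPrime ∧ (∀ r, r ∈ q ↔ r * c ∈ Ideal.span {b}) ∧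
      ∀ r, r * a ∈ Ideal.span {b} → r ∈ q := by
  have ha : (Ideal.Quotient.mk (Ideal.span {b}) a) ≠ 0 := fun h' =>
    h (Ideal.Quotient.eq_zero_iff_mem.1 h')
  obtain ⟨q, hq, hle⟩ := exists_le_isAssociatedPrime_of_isNoetherianRing R
    (Ideal.Quotient.mk (Ideal.span {b}) a) ha
  rw [isAssociatedPrime_iff] at hq
  obtain ⟨hq, x, rfl⟩ := hq
  obtain ⟨c, rfl⟩ := Ideal.Quotient.mk_surjective x
  have key : ∀ r y : R, r ∈ Submodule.colon (⊥ : Submodule R (R ⧸ Ideal.span {b}))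
      {Ideal.Quotient.mk (Ideal.span {b}) y} ↔ r * y ∈ Ideal.span {b} := fun r y => by
    rw [Submodule.mem_colon_singleton, Submodule.mem_bot, ← Ideal.Quotient.eq_zero_iff_mem,
      map_mul]
    rfl
  exact ⟨_, c, hq, fun r => key r c, fun r hr => hle ((key r a).2 hr)⟩

/-- If `a ∉ (b)`, the ideal of all `r` with `r a ∈ (b)` lies in an associated prime of `R/(b)`. That
prime has height at most one, and membership fails after localising there. -/
lemma mem_span_of_height_le_one (hR : HasFiniteProjDims R) {a b : R}
    (hb : b = 0 ∨ b ∈ nonZeroDivisors R)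
    (h : ∀ (q : Ideal R) [q.IsPrime], q.height ≤ 1 → algebraMap R (Localization.AtPrime q) a ∈
      Ideal.span {algebraMap R (Localization.AtPrime q) b}) : a ∈ Ideal.span {b} := by
  by_contra hab
  obtain ⟨q, c, hq, hc, ha⟩ := exists_colon_prime hab
  obtain ⟨u, hu, hua⟩ := exists_mul_mem_of_algebraMap_mem q
    (h q (height_le_one_of_colon hR q b c hb hc))
  exact hu (ha u hua)

/-- A noetherian ring of finite projective dimensions embeds into the product of its
localisations at the primes of height at most one. -/
lemma eq_of_height_le_one (hR : HasFiniteProjDims R) {a b : R}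
    (h : ∀ (q : Ideal R) [q.IsPrime], q.height ≤ 1 →
      algebraMap R (Localization.AtPrime q) a = algebraMap R (Localization.AtPrime q) b) :
    a = b := by
  have := mem_span_of_height_le_one hR (a := a - b) (b := 0) (Or.inl rfl) fun q _ hq => by
    rw [map_sub, h q hq, sub_self]
    exact Submodule.zero_mem _
  rwa [Ideal.span_singleton_zero, Ideal.mem_bot, sub_eq_zero] at this

/-- Otherwise `I` lies in the union of the finitely many associated primes of `R`, hence in one of
them by prime avoidance. These have height at most one, by the case `b = 0` of
`height_le_one_of_colon`. -/
lemma exists_mem_nonZeroDivisors (hR : HasFiniteProjDims R) (I : Ideal R)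
    (hI : ∀ (q : Ideal R) [q.IsPrime], q.height ≤ 1 → ¬ I ≤ q) :
    ∃ b ∈ I, b ∈ nonZeroDivisors R := by
  by_contra! hcon
  have h1 : (I : Set R) ⊆ ⋃ q ∈ associatedPrimes R R, (q : Set R) := by
    rw [biUnion_associatedPrimes_eq_compl_nonZeroDivisors]
    exact fun b hb => hcon b hb
  have h2 := (Ideal.subset_union_prime_finite (associatedPrimes.finite R R) (f := id) ⊥ ⊥
    (fun q hq _ _ => hq.isPrime)).1 h1
  obtain ⟨q, hq, hle⟩ := h2
  have := hq.isPrime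
  rw [AssociatedPrimes.mem_iff, isAssociatedPrime_iff] at hq
  obtain ⟨_, x, hx⟩ := hq
  refine hI q (height_le_one_of_colon hR q 0 x (Or.inl rfl) fun r => ?_) hle
  rw [hx, Submodule.mem_colon_singleton, Submodule.mem_bot, Ideal.span_singleton_zero,
    Ideal.mem_bot, smul_eq_mul]

end Localization

end DetFunctor

end

/-! ### Quasi-isomorphisms, folded by parity, and their contractible cones. -/

noncomputable section

open TensorProduct CategoryTheory

namespace DetFunctor

variable {R : Type u} [CommRing R]

section QuasiIso

/-- Injectivity and surjectivity on homology, spelled out on elements by computing homology as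
cycles modulo boundaries. -/
lemma ShortComplex.exists_of_quasiIso {S T : ShortComplex (ModuleCat.{u} R)} (φ : S ⟶ T)
    (h : ShortComplex.QuasiIso φ) :
    (∀ x : S.X₂, S.g.hom x = 0 → (∃ z, T.f.hom z = φ.τ₂.hom x) → ∃ y, S.f.hom y = x) ∧
    ∀ z : T.X₂, T.g.hom z = 0 → ∃ x w, S.g.hom x = 0 ∧ z = φ.τ₂.hom x + T.f.hom w := by
  let h₁ := S.moduleCatLeftHomologyData
  let h₂ := T.moduleCatLeftHomologyData
  obtain ⟨γ⟩ : Nonempty (ShortComplex.LeftHomologyMapData φ h₁ h₂) := inferInstance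
  have hiso : IsIso γ.φH := (ShortComplex.LeftHomologyMapData.quasiIso_iff γ).1 h
  have hbij := (ConcreteCategory.isIso_iff_bijective γ.φH).1 hiso
  let k : LinearMap.ker S.g.hom →ₗ[R] LinearMap.ker T.g.hom := γ.φK.hom
  let l : (LinearMap.ker S.g.hom ⧸ LinearMap.range S.moduleCatToCycles) →ₗ[R]
    (LinearMap.ker T.g.hom ⧸ LinearMap.range T.moduleCatToCycles) := γ.φH.hom
  have hl : Function.Bijective l := hbij
  have hi : ∀ x : LinearMap.ker S.g.hom, (k x : T.X₂) = φ.τ₂.hom x := fun x =>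
    congrArg (fun f => f.hom x) γ.commi
  have hπ : ∀ x : LinearMap.ker S.g.hom,
      l (Submodule.Quotient.mk x) = Submodule.Quotient.mk (k x) := fun x =>
    congrArg (fun f => f.hom x) γ.commπ
  constructor
  · rintro x hx ⟨z, hz⟩
    have h0 : l (Submodule.Quotient.mk ⟨x, LinearMap.mem_ker.2 hx⟩) = 0 := by
      rw [hπ, Submodule.Quotient.mk_eq_zero]
      exact ⟨z, Subtype.ext (hz.trans (hi ⟨x, LinearMap.mem_ker.2 hx⟩).symm)⟩
    rw [← map_zero l] at h0
    obtain ⟨y, hy⟩ := (Submodule.Quotient.mk_eq_zero _).1 (hl.1 h0)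
    exact ⟨y, congrArg Subtype.val hy⟩
  · intro z hz
    obtain ⟨q, hq⟩ := hl.2 (Submodule.Quotient.mk ⟨z, LinearMap.mem_ker.2 hz⟩)
    obtain ⟨x, rfl⟩ := Submodule.mkQ_surjective _ q
    rw [Submodule.mkQ_apply, hπ] at hq
    obtain ⟨w, hw⟩ := (Submodule.Quotient.eq _).1 hq.symm
    refine ⟨x, w, x.2, ?_⟩
    have h2 : T.f.hom w = z - (k x : T.X₂) := congrArg Subtype.val hw
    rw [h2, hi]
    abel

lemma quasiIso_injective {K L : CochainComplex (ModuleCat.{u} R) ℤ} (f : K ⟶ L) (hf : QuasiIso f)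
    (i : ℤ) (x : K.X (i + 1)) (hx : (K.d (i + 1) (i + 1 + 1)).hom x = 0) (z : L.X i)
    (hz : (L.d i (i + 1)).hom z = (f.f (i + 1)).hom x) : ∃ y, (K.d i (i + 1)).hom y = x :=
  (ShortComplex.exists_of_quasiIso _ ((quasiIsoAt_iff' f i (i + 1) (i + 1 + 1) (by simp)
    (by simp)).1 inferInstance)).1 x hx ⟨z, hz⟩

lemma quasiIso_surjective {K L : CochainComplex (ModuleCat.{u} R) ℤ} (f : K ⟶ L) (hf : QuasiIso f)
    (i : ℤ) (z : L.X (i + 1)) (hz : (L.d (i + 1) (i + 1 + 1)).hom z = 0) :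
    ∃ x w, (K.d (i + 1) (i + 1 + 1)).hom x = 0 ∧
      z = (f.f (i + 1)).hom x + (L.d i (i + 1)).hom w :=
  (ShortComplex.exists_of_quasiIso _ ((quasiIsoAt_iff' f i (i + 1) (i + 1 + 1) (by simp)
    (by simp)).1 inferInstance)).2 z hz

end QuasiIso

namespace StrictlyPerfect

section Parts

variable (C C' : StrictlyPerfect R) (p q : ℤ → Prop) (hpq : ∀ i, p i → q (i + 1))

/-- The differential from the degrees satisfying `p` to those satisfying `q`. -/
def dPart : (DirectSum {i : ℤ // p i} fun i => C.cpx.X i) →ₗ[R]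
    DirectSum {i : ℤ // q i} fun i => C.cpx.X i :=
  DirectSum.toModule R _ _ fun i =>
    (DirectSum.lof R {i : ℤ // q i} (fun i => C.cpx.X i) ⟨i.1 + 1, hpq _ i.2⟩) ∘ₗ
      (C.cpx.d i.1 (i.1 + 1)).hom

lemma dPart_lof (i : {i : ℤ // p i}) (x : C.cpx.X i) :
    C.dPart p q hpq (DirectSum.lof R {i : ℤ // p i} (fun i => C.cpx.X i) i x) =
      DirectSum.lof R {i : ℤ // q i} (fun i => C.cpx.X i) ⟨i.1 + 1, hpq _ i.2⟩
        ((C.cpx.d i.1 (i.1 + 1)).hom x) := by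
  rw [dPart, DirectSum.toModule_lof]
  rfl

lemma dPart_apply (x : DirectSum {i : ℤ // p i} fun i => C.cpx.X i) (i : ℤ) (hi : p i) :
    C.dPart p q hpq x ⟨i + 1, hpq i hi⟩ = (C.cpx.d i (i + 1)).hom (x ⟨i, hi⟩) := by
  induction x using DirectSum.induction_on with
  | zero => simp
  | add x y hx hy => simp only [map_add, DirectSum.add_apply, hx, hy]
  | of j x =>
    obtain ⟨j, hj⟩ := j
    change C.dPart p q hpq (DirectSum.lof R {i : ℤ // p i} (fun i => C.cpx.X i) ⟨j, hj⟩ x)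
      ⟨i + 1, hpq i hi⟩ = (C.cpx.d i (i + 1)).hom
        (DirectSum.lof R {i : ℤ // p i} (fun i => C.cpx.X i) ⟨j, hj⟩ x ⟨i, hi⟩)
    rw [dPart_lof]
    by_cases h : i = j
    · subst h
      rw [DirectSum.lof_apply, DirectSum.lof_apply]
    · rw [DirectSum.lof_eq_of, DirectSum.lof_eq_of, DirectSum.of_eq_of_ne, DirectSum.of_eq_of_ne,
        map_zero]
      · exact fun h' => h (Subtype.mk.inj h')
      · exact fun h' => h (by simpa using Subtype.mk.inj h')

lemma mapPart_apply {C C' : StrictlyPerfect R} (f : C.cpx ⟶ C'.cpx)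
    (x : DirectSum {i : ℤ // p i} fun i => C.cpx.X i) (i : {i : ℤ // p i}) :
    mapPart f p x i = (f.f i.1).hom (x i) := by
  rw [mapPart, DirectSum.lmap_apply]

lemma mapPart_lof {C C' : StrictlyPerfect R} (f : C.cpx ⟶ C'.cpx) (i : {i : ℤ // p i})
    (x : C.cpx.X i) : mapPart f p (DirectSum.lof R {i : ℤ // p i} (fun i => C.cpx.X i) i x) =
      DirectSum.lof R {i : ℤ // p i} (fun i => C'.cpx.X i) i ((f.f i.1).hom x) := by
  rw [mapPart, DirectSum.lmap_lof]

variable (hqp : ∀ i, q (i + 1) → p i) (hqp' : ∀ i, q i → p (i + 1))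

-- An element of a direct sum is the finite sum of its components, so exactness may be checked in
-- each degree. The condition `hqp` puts the degree of the preimage among those satisfying `p`.
include hqp in
lemma mem_range_dPart (x : DirectSum {i : ℤ // q i} fun i => C.cpx.X i)
    (h : ∀ i (hi : q (i + 1)), ∃ y, (C.cpx.d i (i + 1)).hom y = x ⟨i + 1, hi⟩) :
    x ∈ LinearMap.range (C.dPart p q hpq) := by
  classical
  rw [← DirectSum.sum_support_of x]
  refine Submodule.sum_mem _ fun i _ => ?_
  obtain ⟨i, hi⟩ := i
  obtain ⟨j, rfl⟩ : ∃ j, i = j + 1 := ⟨i - 1, by ring⟩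
  obtain ⟨y, hy⟩ := h j hi
  refine ⟨DirectSum.lof R {i : ℤ // p i} (fun i => C.cpx.X i) ⟨j, hqp j hi⟩ y, ?_⟩
  rw [dPart_lof, hy]
  rfl

include hqp in
lemma quasiIso_part_injective {C C' : StrictlyPerfect R} (f : C.cpx ⟶ C'.cpx) (hf : QuasiIso f)
    (x : DirectSum {i : ℤ // q i} fun i => C.cpx.X i) (hx : C.dPart q p hqp' x = 0)
    (z : DirectSum {i : ℤ // p i} fun i => C'.cpx.X i)
    (hz : C'.dPart p q hpq z = mapPart f q x) : ∃ y, C.dPart p q hpq y = x := by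
  refine C.mem_range_dPart p q hpq hqp x fun i hi => ?_
  refine quasiIso_injective f hf i _ ?_ (z ⟨i, hqp i hi⟩) ?_
  · rw [← C.dPart_apply q p hqp' x (i + 1) hi, hx]
    rfl
  · rw [← C'.dPart_apply p q hpq z i (hqp i hi), hz, mapPart_apply]

include hqp in
lemma quasiIso_part_surjective {C C' : StrictlyPerfect R} (f : C.cpx ⟶ C'.cpx) (hf : QuasiIso f)
    (z : DirectSum {i : ℤ // q i} fun i => C'.cpx.X i) (hz : C'.dPart q p hqp' z = 0) :
    ∃ x w, C.dPart q p hqp' x = 0 ∧ z = mapPart f q x + C'.dPart p q hpq w := by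
  classical
  suffices h : z ∈ (LinearMap.ker (C.dPart q p hqp')).map (mapPart f q) ⊔
      LinearMap.range (C'.dPart p q hpq) by
    obtain ⟨_, ⟨x, hx, rfl⟩, _, ⟨w, rfl⟩, h⟩ := Submodule.mem_sup.1 h
    exact ⟨x, w, hx, h.symm⟩
  rw [← DirectSum.sum_support_of z]
  refine Submodule.sum_mem _ fun i _ => ?_
  obtain ⟨i, hi⟩ := i
  obtain ⟨j, rfl⟩ : ∃ j, i = j + 1 := ⟨i - 1, by ring⟩
  have h1 := C'.dPart_apply q p hqp' z (j + 1) hi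
  rw [hz] at h1
  obtain ⟨x, w, hx, hw⟩ := quasiIso_surjective f hf j (z ⟨j + 1, hi⟩) h1.symm
  refine Submodule.mem_sup.2 ⟨_, ⟨DirectSum.lof R {i : ℤ // q i} (fun i => C.cpx.X i)
    ⟨j + 1, hi⟩ x, ?_, rfl⟩, _, ⟨DirectSum.lof R {i : ℤ // p i} (fun i => C'.cpx.X i)
    ⟨j, hqp j hi⟩ w, rfl⟩, ?_⟩
  · rw [SetLike.mem_coe, LinearMap.mem_ker, dPart_lof, hx, map_zero]
  · rw [mapPart_lof, dPart_lof, hw]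
    exact (map_add (DirectSum.lof R {i : ℤ // q i} (fun i => C'.cpx.X i) ⟨j + 1, hi⟩) _ _).symm

end Parts

lemma even_of_odd_succ (i : ℤ) (h : Odd (i + 1)) : Even i := by
  simpa using h.sub_odd odd_one

lemma odd_of_even_succ (i : ℤ) (h : Even (i + 1)) : Odd i := by
  simpa using h.sub_odd odd_one

/-- The diagram chase for exactness of a cone, stated for abstract maps so that it serves both
parities. `hinj` and `hsurj` are injectivity and surjectivity on homology. -/
lemma exists_of_cone_cycle {E O E' O' : Type u} [AddCommGroup E] [AddCommGroup O]
    [AddCommGroup E'] [AddCommGroup O'] [Module R E] [Module R O] [Module R E'] [Module R O']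
    {d : E →ₗ[R] O} {δ : O →ₗ[R] E} {d' : E' →ₗ[R] O'} {δ' : O' →ₗ[R] E'} {f : E →ₗ[R] E'}
    {g : O →ₗ[R] O'} (hfg : d' ∘ₗ f = g ∘ₗ d)
    (hinj : ∀ b, δ b = 0 → ∀ z, d' z = g b → ∃ y, d y = b)
    (hsurj : ∀ z, d' z = 0 → ∃ x w, d x = 0 ∧ z = f x + δ' w) (a : E') (b : O)
    (h1 : d' a + g b = 0) (h2 : δ b = 0) : ∃ w y, δ' w + f y = a ∧ -(d y) = b := by
  have hfg' : ∀ x, d' (f x) = g (d x) := LinearMap.congr_fun hfg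
  obtain ⟨c, rfl⟩ := hinj b h2 (-a) (by rw [map_neg, neg_eq_iff_add_eq_zero]; exact h1)
  obtain ⟨x, w, hx, hw⟩ := hsurj (a + f c) (by rw [map_add, hfg', h1])
  refine ⟨w, x - c, ?_, ?_⟩
  · rw [map_sub, add_comm, sub_add_eq_add_sub, ← hw, add_sub_cancel_right]
  · rw [map_sub, hx]
    abel

/-- The mapping cone of a quasi-isomorphism is contractible. -/
lemma nonempty_contraction_cone [IsNoetherianRing R] (hR : HasFiniteProjDims R)
    {C C' : StrictlyPerfect R} (f : C.cpx ⟶ C'.cpx) (hf : QuasiIso f) :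
    Nonempty (FoldedComplex.cone (foldMap f)).Contraction := by
  refine FoldedComplex.nonempty_contraction_of_exact hR _ ?_ ?_
  · rintro ⟨a, b⟩ hab
    obtain ⟨w, y, h1, h2⟩ := exists_of_cone_cycle (mapPart_even f)
      (quasiIso_part_injective Even Odd (fun _ h => h.add_one) even_of_odd_succ
        (fun _ h => h.add_one) f hf)
      (quasiIso_part_surjective Odd Even (fun _ h => h.add_one)
        odd_of_even_succ (fun _ h => h.add_one) f hf) a b (congrArg Prod.fst hab)
      (neg_eq_zero.1 (congrArg Prod.snd hab))
    exact ⟨(w, y), Prod.ext h1 h2⟩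
  · rintro ⟨a, b⟩ hab
    obtain ⟨w, y, h1, h2⟩ := exists_of_cone_cycle (mapPart_odd f)
      (quasiIso_part_injective Odd Even (fun _ h => h.add_one) odd_of_even_succ
        (fun _ h => h.add_one) f hf)
      (quasiIso_part_surjective Even Odd (fun _ h => h.add_one)
        even_of_odd_succ (fun _ h => h.add_one) f hf) a b (congrArg Prod.fst hab)
      (neg_eq_zero.1 (congrArg Prod.snd hab))
    exact ⟨(w, y), Prod.ext h1 h2⟩

end StrictlyPerfect

/-! ### Elements of the annihilator kill the homology of a resolution. -/

section Annihilator

variable {M : Type u} [AddCommGroup M] [Module R M]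

lemma smul_single_eq_zero {r : R} (hr : r ∈ Module.annihilator R M) (i : ℤ)
    (x : ((HomologicalComplex.single (ModuleCat.{u} R) (ComplexShape.up ℤ) 0).obj
      (ModuleCat.of R M)).X i) : r • x = 0 := by
  by_cases hi : i = 0
  · subst hi
    let e := (HomologicalComplex.singleObjXSelf (ComplexShape.up ℤ) 0
      (ModuleCat.of R M)).toLinearEquiv
    apply e.injective
    rw [map_smul, map_zero]
    exact Module.mem_annihilator.1 hr _
  · have h0 := HomologicalComplex.isZero_single_obj_X (ComplexShape.up ℤ) 0 (ModuleCat.of R M) i hi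
    have := ModuleCat.isZero_iff_subsingleton.1 h0
    exact Subsingleton.elim _ _

/-- For a cycle `x`, the cycle `r x` maps to `r π(x) = 0`, a boundary; injectivity of `π` on
homology makes `r x` a boundary. -/
lemma Resolution.exists_d_eq_smul (ρ : Resolution R M) {r : R}
    (hr : r ∈ Module.annihilator R M) (i : ℤ) (x : ρ.C.cpx.X (i + 1))
    (hx : (ρ.C.cpx.d (i + 1) (i + 1 + 1)).hom x = 0) :
    ∃ y, (ρ.C.cpx.d i (i + 1)).hom y = r • x :=
  quasiIso_injective ρ.π ρ.quasiIso i (r • x) (by rw [map_smul, hx, smul_zero]) 0 (by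
    rw [map_zero, map_smul, smul_single_eq_zero hr])

lemma Resolution.exists_dEven_eq_smul (ρ : Resolution R M) {r : R}
    (hr : r ∈ Module.annihilator R M) (y : ρ.C.fold.odd) (hy : ρ.C.fold.dOdd y = 0) :
    ∃ x, ρ.C.fold.dEven x = r • y := by
  refine ρ.C.mem_range_dPart Even Odd (fun _ h => h.add_one)
    StrictlyPerfect.even_of_odd_succ _ fun i hi => ?_
  refine ρ.exists_d_eq_smul hr i _ ?_
  rw [← ρ.C.dPart_apply Odd Even (fun _ h => h.add_one) y (i + 1) hi]
  exact congrArg (fun z : DirectSum {i : ℤ // Even i} fun i => ρ.C.cpx.X i =>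
    z ⟨i + 1 + 1, hi.add_one⟩) hy

lemma Resolution.exists_dOdd_eq_smul (ρ : Resolution R M) {r : R}
    (hr : r ∈ Module.annihilator R M) (x : ρ.C.fold.even) (hx : ρ.C.fold.dEven x = 0) :
    ∃ y, ρ.C.fold.dOdd y = r • x := by
  refine ρ.C.mem_range_dPart Odd Even (fun _ h => h.add_one)
    StrictlyPerfect.odd_of_even_succ _ fun i hi => ?_
  refine ρ.exists_d_eq_smul hr i _ ?_
  rw [← ρ.C.dPart_apply Even Odd (fun _ h => h.add_one) x (i + 1) hi]
  exact congrArg (fun z : DirectSum {i : ℤ // Odd i} fun i => ρ.C.cpx.X i =>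
    z ⟨i + 1 + 1, hi.add_one⟩) hx

variable (A : Type u) [CommRing A] [Algebra R A]

/-- By flatness, the kernel of the extended map comes from the kernel of `g`. Multiplication by `r`
moves it into the image, and `r` is invertible in `A`. -/
lemma mem_range_baseChange_of_smul [Module.Flat R A] {P Q N : Type u} [AddCommGroup P]
    [Module R P] [AddCommGroup Q] [Module R Q] [AddCommGroup N] [Module R N] (f : P →ₗ[R] Q)
    (g : Q →ₗ[R] N) {r : R} (hr : IsUnit (algebraMap R A r))
    (h : ∀ y, g y = 0 → ∃ x, f x = r • y) (y : A ⊗[R] Q) (hy : g.baseChange A y = 0) :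
    ∃ x, f.baseChange A x = y := by
  have hex := Module.Flat.lTensor_exact A (LinearMap.exact_subtype_ker_map g)
  obtain ⟨z, rfl⟩ := (hex y).1 hy
  obtain ⟨v, hv⟩ := hr
  have key : ∀ z : A ⊗[R] LinearMap.ker g, algebraMap R A r •
      (LinearMap.lTensor A (LinearMap.ker g).subtype z) ∈ LinearMap.range (f.baseChange A) := by
    intro z
    induction z with
    | zero => simp
    | add x y hx hy => rw [map_add, smul_add]; exact Submodule.add_mem _ hx hy
    | tmul a k =>
      obtain ⟨x, hx⟩ := h k k.2
      refine ⟨a ⊗ₜ x, ?_⟩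
      rw [LinearMap.baseChange_tmul, hx, algebraMap_smul, LinearMap.lTensor_tmul,
        TensorProduct.tmul_smul]
      rfl
  obtain ⟨x, hx⟩ := key z
  refine ⟨(↑v⁻¹ : A) • x, ?_⟩
  rw [map_smul, hx, ← hv, smul_smul, Units.inv_mul, one_smul]

/-- A resolution becomes contractible after a flat base change inverting an element of the
annihilator. -/
lemma Resolution.nonempty_contraction_baseChange [IsNoetherianRing A] (hA : HasFiniteProjDims A)
    [Module.Flat R A] (ρ : Resolution R M) {r : R} (hr : r ∈ Module.annihilator R M)
    (hrA : IsUnit (algebraMap R A r)) : Nonempty (ρ.C.fold.baseChange A).Contraction :=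
  FoldedComplex.nonempty_contraction_of_exact hA _
    (mem_range_baseChange_of_smul A _ _ hrA (ρ.exists_dOdd_eq_smul hr))
    (mem_range_baseChange_of_smul A _ _ hrA (ρ.exists_dEven_eq_smul hr))

end Annihilator

/-! ### Existence of finite projective resolutions. -/

section Existence

/-- A finite resolution of `M` by finitely generated projective modules, indexed by `ℕ`. -/
structure FiniteResolution (M : ModuleCat.{u} R) where
  cpx : ChainComplex (ModuleCat.{u} R) ℕ
  ε : cpx.X 0 ⟶ M
  w : cpx.d 1 0 ≫ ε = 0
  finite : ∀ i, Module.Finite R (cpx.X i)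
  projective : ∀ i, Module.Projective R (cpx.X i)
  bounded : ∃ b, ∀ i, b ≤ i → Subsingleton (cpx.X i)
  surjective : Function.Surjective ε.hom
  exact_zero : ∀ x, ε.hom x = 0 → ∃ y, (cpx.d 1 0).hom y = x
  exact_succ : ∀ i x, (cpx.d (i + 1) i).hom x = 0 → ∃ y, (cpx.d (i + 2) (i + 1)).hom y = x


/-- The zero complex as a resolution. -/
def FiniteResolution.ofSubsingleton (M : ModuleCat.{u} R) [Subsingleton M] :
    FiniteResolution M where
  cpx :=
    { X := fun _ => ModuleCat.of R PUnit.{u + 1}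
      d := fun _ _ => 0
      shape := fun _ _ _ => rfl
      d_comp_d' := fun _ _ _ _ _ => Limits.comp_zero }
  ε := 0
  w := by simp
  finite _ := inferInstanceAs (Module.Finite R PUnit.{u + 1})
  projective _ := inferInstanceAs (Module.Projective R PUnit.{u + 1})
  bounded := ⟨0, fun _ _ => inferInstanceAs (Subsingleton PUnit.{u + 1})⟩
  surjective _ := ⟨0, Subsingleton.elim _ _⟩
  exact_zero _ _ := ⟨0, Subsingleton.elim (α := PUnit.{u + 1}) _ _⟩
  exact_succ _ _ _ := ⟨0, Subsingleton.elim (α := PUnit.{u + 1}) _ _⟩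

/-- A resolution of the kernel of a surjection from a projective module yields a resolution of
its target. -/
def FiniteResolution.cons {M P : ModuleCat.{u} R} [Module.Finite R P] [Module.Projective R P]
    (f : P →ₗ[R] M) (hf : Function.Surjective f)
    (ρ : FiniteResolution (ModuleCat.of R (LinearMap.ker f))) : FiniteResolution M where
  cpx := ChainComplex.augment ρ.cpx (ρ.ε ≫ ModuleCat.ofHom (LinearMap.ker f).subtype) (by
    rw [← Category.assoc, ρ.w, Limits.zero_comp])
  ε := ModuleCat.ofHom f
  w := ModuleCat.hom_ext (LinearMap.ext fun x => (ρ.ε.hom x : LinearMap.ker f).2)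
  finite
    | 0 => inferInstanceAs (Module.Finite R P)
    | i + 1 => ρ.finite i
  projective
    | 0 => inferInstanceAs (Module.Projective R P)
    | i + 1 => ρ.projective i
  bounded := by
    obtain ⟨b, hb⟩ := ρ.bounded
    refine ⟨b + 1, fun i hi => ?_⟩
    obtain ⟨i, rfl⟩ : ∃ j, i = j + 1 := ⟨i - 1, by omega⟩
    exact hb i (by omega)
  surjective := hf
  exact_zero x hx := by
    obtain ⟨y, hy⟩ := ρ.surjective ⟨x, hx⟩
    exact ⟨y, congrArg Subtype.val hy⟩
  exact_succ
    | 0, x, hx => ρ.exact_zero x (Subtype.ext hx)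
    | i + 1, x, hx => ρ.exact_succ i x hx

variable [IsNoetherianRing R]

lemma FiniteResolution.nonempty (d : ℕ) (M : ModuleCat.{u} R) [Module.Finite R M]
    (h : HasProjectiveDimensionLE M d) : Nonempty (FiniteResolution M) := by
  induction d generalizing M with
  | zero =>
    have hM := projective_of_hasProjectiveDimensionLE_zero (N := M) h
    have : Subsingleton (LinearMap.ker (LinearMap.id : M →ₗ[R] M)) :=
      (Submodule.subsingleton_iff_eq_bot).2 LinearMap.ker_id
    exact ⟨FiniteResolution.cons LinearMap.id Function.surjective_id
      (FiniteResolution.ofSubsingleton _)⟩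
  | succ d ih =>
    obtain ⟨n, f, hf⟩ := Module.Finite.exists_fin' R M
    obtain ⟨ρ⟩ := ih (ModuleCat.of R (LinearMap.ker f))
      (hasProjectiveDimensionLE_ker_of_succ hf h)
    exact ⟨FiniteResolution.cons (P := ModuleCat.of R (Fin n → R)) f hf ρ⟩

/-- The associated projective resolution. -/
def FiniteResolution.toProjectiveResolution {M : ModuleCat.{u} R} (ρ : FiniteResolution M) :
    ProjectiveResolution M where
  complex := ρ.cpx
  projective n := (IsProjective.iff_projective (ρ.cpx.X n)).1 (ρ.projective n)
  π := (ChainComplex.toSingle₀Equiv _ _).symm ⟨ρ.ε, ρ.w⟩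
  quasiIso := ⟨fun n => by
    cases n with
    | zero =>
      rw [ChainComplex.quasiIsoAt₀_iff, ShortComplex.quasiIso_iff_of_zeros']
      · refine (ShortComplex.exact_and_epi_g_iff_of_iso
          (S₂ := ShortComplex.mk (ρ.cpx.d 1 0) ρ.ε ρ.w) ?_).2 ⟨?_, ?_⟩
        · exact ShortComplex.isoMk (Iso.refl _) (Iso.refl _) (Iso.refl _)
            (by simp; exact (Category.id_comp _).trans (Category.comp_id _).symm)
            (by simp; exact (Category.id_comp _).trans (Category.comp_id _).symm)
        · exact (ShortComplex.moduleCat_exact_iff _).2 ρ.exact_zero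
        · exact (ModuleCat.epi_iff_surjective _).2 ρ.surjective
      · exact ρ.cpx.shape _ _ (by simp)
      all_goals rfl
    | succ n =>
      rw [quasiIsoAt_iff_exactAt']
      · rw [HomologicalComplex.exactAt_iff' _ (n + 2) (n + 1) n (by simp) (by simp)]
        exact (ShortComplex.moduleCat_exact_iff _).2 (ρ.exact_succ n)
      · apply ChainComplex.exactAt_succ_single_obj⟩

/-- The resolution indexed by `ℕ` is placed in the degrees `-k`, so boundedness and finiteness are
read off there; the terms of positive degree vanish. -/
lemma Resolution.nonempty (hR : HasFiniteProjDims R) (M : Type u) [AddCommGroup M] [Module R M]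
    [Module.Finite R M] : Nonempty (Resolution R M) := by
  obtain ⟨d, hd⟩ := hR M
  obtain ⟨ρ⟩ := FiniteResolution.nonempty d (ModuleCat.of R M) hd
  let P := ρ.toProjectiveResolution
  have hpos : ∀ i : ℤ, 0 < i → Subsingleton (P.cochainComplex.X i) := fun i hi =>
    ModuleCat.isZero_iff_subsingleton.1 (CochainComplex.isZero_of_isStrictlyLE _ 0 _ hi)
  refine ⟨⟨⟨P.cochainComplex, fun i => ?_, fun i => ?_, ?_⟩, P.π', ?_⟩⟩
  · by_cases hi : 0 < i
    · have := hpos i hi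
      infer_instance
    · obtain ⟨k, rfl⟩ := Int.exists_eq_neg_ofNat (not_lt.1 hi)
      have : Module.Finite R (P.complex.X k) := ρ.finite k
      exact Module.Finite.equiv (P.cochainComplexXIso (-k) k).symm.toLinearEquiv
  · exact (IsProjective.iff_projective (P.cochainComplex.X i)).2
      (inferInstanceAs (Projective (P.cochainComplex.X i)))
  · obtain ⟨b, hb⟩ := ρ.bounded
    refine ⟨-b, 0, fun i hi => ?_⟩
    rcases hi with hi | hi
    · obtain ⟨k, rfl⟩ := Int.exists_eq_neg_ofNat (show i ≤ 0 by omega)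
      have : Subsingleton (P.complex.X k) := hb k (by omega)
      exact (P.cochainComplexXIso (-k) k).toLinearEquiv.toEquiv.subsingleton
    · exact hpos i hi
  · have h : QuasiIso P.π' := inferInstance
    exact h

end Existence

end DetFunctor

end

/-! ### Projective modules over semilocal rings, and determinants of contractions after base change.
-/

noncomputable section

open TensorProduct CategoryTheory

namespace DetFunctor

section Semilocal

variable {R : Type u} [CommRing R]

/-- A proper submodule of a finitely generated module lies in a maximal one, `Q`. The quotient by
`Q` is simple, hence killed by a maximal ideal `m`, so `P + m N` would lie in `Q`. -/
lemma Submodule.eq_top_of_forall_sup_smul {N : Type*} [AddCommGroup N] [Module R N]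
    [Module.Finite R N] (P : Submodule R N)
    (h : ∀ (m : Ideal R) [m.IsMaximal], P ⊔ m • (⊤ : Submodule R N) = ⊤) : P = ⊤ := by
  refine (eq_top_or_exists_le_coatom P).resolve_right ?_
  rintro ⟨Q, hQ, hPQ⟩
  have : IsSimpleModule R (N ⧸ Q) := isSimpleModule_iff_isCoatom.2 hQ
  have := IsSimpleModule.annihilator_isMaximal (R := R) (M := N ⧸ Q)
  refine hQ.1 (top_le_iff.1 ?_)
  rw [← h (Module.annihilator R (N ⧸ Q)), sup_le_iff]
  refine ⟨hPQ, Submodule.smul_le.2 fun r hr x _ => ?_⟩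
  rw [← Submodule.Quotient.mk_eq_zero, Submodule.Quotient.mk_smul]
  exact Module.mem_annihilator.1 hr _

lemma finrank_quotient_tensor_eq (m : Ideal R) [m.IsMaximal] {P Q : Type u} [AddCommGroup P]
    [Module R P] [Module.Finite R P] [Module.Projective R P] [AddCommGroup Q] [Module R Q]
    [Module.Finite R Q] [Module.Projective R Q]
    (h : Module.rankAtStalk (R := R) P = Module.rankAtStalk Q) :
    Nonempty (((R ⧸ m) ⊗[R] P) ≃ₗ[R ⧸ m] ((R ⧸ m) ⊗[R] Q)) := by
  letI : Field (R ⧸ m) := Ideal.Quotient.field m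
  refine Module.nonempty_linearEquiv_iff_rank_eq.2 ?_
  have key : ∀ (P : Type u) [AddCommGroup P] [Module R P] [Module.Finite R P]
      [Module.Projective R P], Module.finrank (R ⧸ m) ((R ⧸ m) ⊗[R] P) =
        Module.rankAtStalk P ((⊥ : PrimeSpectrum (R ⧸ m)).comap (algebraMap R (R ⧸ m))) := by
    intro P _ _ _ _
    rw [← Module.rankAtStalk_baseChange, Module.rankAtStalk_eq_finrank_of_free]
    rfl
  rw [← Module.finrank_eq_rank, ← Module.finrank_eq_rank, key, key, h]

/-- Over a semilocal ring, finitely generated projective modules of the same rank are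
isomorphic. -/
lemma nonempty_equiv_of_rankAtStalk_eq [Finite (MaximalSpectrum R)] {P Q : Type u}
    [AddCommGroup P] [Module R P] [Module.Finite R P] [Module.Projective R P] [AddCommGroup Q]
    [Module R Q] [Module.Finite R Q] [Module.Projective R Q]
    (h : Module.rankAtStalk (R := R) P = Module.rankAtStalk Q) : Nonempty (P ≃ₗ[R] Q) := by
  have he : ∀ m : MaximalSpectrum R,
      Nonempty (((R ⧸ m.asIdeal) ⊗[R] P) ≃ₗ[R ⧸ m.asIdeal] ((R ⧸ m.asIdeal) ⊗[R] Q)) := fun m =>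
    have := m.isMaximal
    finrank_quotient_tensor_eq m.asIdeal h
  let e := fun m => (he m).some
  let π (N : Type u) [AddCommGroup N] [Module R N] :
      N →ₗ[R] ∀ m : MaximalSpectrum R, (R ⧸ m.asIdeal) ⊗[R] N :=
    LinearMap.pi fun m => TensorProduct.mk R (R ⧸ m.asIdeal) N 1
  have hπ : Function.Surjective (π Q) := Ideal.pi_tensorProductMk_quotient_surjective Q _
    fun m n hmn => by
      have := m.isMaximal
      have := n.isMaximal
      exact Ideal.isCoprime_of_isMaximal (MaximalSpectrum.ext_iff.ne.mp hmn)
  -- The isomorphisms of all fibres are lifted simultaneously: `Q` surjects onto the product of its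
  -- fibres by the Chinese remainder theorem, and `P` is projective. The lift is onto by Nakayama,
  -- and equality of ranks makes it bijective.
  obtain ⟨f, hf⟩ := Module.projective_lifting_property (π Q)
    ((LinearMap.pi fun m => ((e m).restrictScalars R).toLinearMap ∘ₗ LinearMap.proj m) ∘ₗ π P) hπ
  have hf' : ∀ x (m : MaximalSpectrum R),
      (1 : R ⧸ m.asIdeal) ⊗ₜ[R] f x = e m ((1 : R ⧸ m.asIdeal) ⊗ₜ[R] x) := fun x m =>
    congrFun (LinearMap.congr_fun hf x) m
  have hsurj : Function.Surjective f := by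
    rw [← LinearMap.range_eq_top]
    refine Submodule.eq_top_of_forall_sup_smul _ fun m hm => ?_
    rw [eq_top_iff]
    intro y _
    obtain ⟨x, hx⟩ := TensorProduct.mk_surjective R P (R ⧸ m) Ideal.Quotient.mk_surjective
      ((e ⟨m, hm⟩).symm ((1 : R ⧸ m) ⊗ₜ y))
    have h1 : (1 : R ⧸ m) ⊗ₜ[R] (y - f x) = 0 := by
      rw [TensorProduct.tmul_sub, hf' x ⟨m, hm⟩, sub_eq_zero]
      exact ((LinearEquiv.eq_symm_apply _).1 hx).symm
    have h2 : y - f x ∈ m • (⊤ : Submodule R Q) := by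
      have h3 := TensorProduct.quotTensorEquivQuotSMul_mk_tmul m (1 : R) (y - f x)
      rw [map_one, h1, map_zero, one_smul] at h3
      exact (Submodule.Quotient.mk_eq_zero _).1 h3.symm
    exact Submodule.mem_sup.2 ⟨f x, ⟨x, rfl⟩, _, h2, by abel⟩
  exact ⟨LinearEquiv.ofBijective f (Module.bijective_of_surjective_of_rankAtStalk_eq hsurj
    fun m _ => by rw [h])⟩

end Semilocal

namespace FoldedComplex

variable {R : Type u} [CommRing R]

/-- The reference isomorphism attached to an isomorphism of the odd and the even part. -/
def refOfEquiv {F : FoldedComplex R} (h : F.odd ≃ₗ[R] F.even) :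
    ((VirtObj.one : VirtObj R).pos × F.odd) ≃ₗ[R] (F.even × (VirtObj.one : VirtObj R).neg) where
  toFun x := (h x.2, 0)
  invFun x := (PUnit.unit, h.symm x.1)
  map_add' x y := Prod.ext (map_add h _ _) rfl
  map_smul' a x := Prod.ext (map_smul h _ _) rfl
  left_inv x := Prod.ext (Subsingleton.elim (α := PUnit) _ _) (h.symm_apply_apply _)
  right_inv x := Prod.ext (h.apply_symm_apply _) (Subsingleton.elim (α := PUnit) _ _)

variable {F : FoldedComplex R} (h : F.odd ≃ₗ[R] F.even) {A B : Type u} [CommRing A] [Algebra R A]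
  [CommRing B] [Algebra R B]

/-- The isomorphism attached to a contraction after extension of scalars. -/
def Contraction.tensorEquiv (t : (F.baseChange A).Contraction) :
    (A ⊗[R] F.odd) ≃ₗ[A] (A ⊗[R] F.even) := t.equiv

/-- The determinant of a contraction after extension of scalars, relative to an isomorphism of the
odd and the even part. -/
def Contraction.relDet (t : (F.baseChange A).Contraction) : A :=
  pdet (t.tensorEquiv.trans (LinearEquiv.baseChange R A F.odd F.even h).symm).toLinearMap

lemma Contraction.isUnit_relDet (t : (F.baseChange A).Contraction) : IsUnit (t.relDet h) :=
  isUnit_pdet (t.tensorEquiv.trans (LinearEquiv.baseChange R A F.odd F.even h).symm)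

lemma Contraction.relDet_eq (t t' : (F.baseChange A).Contraction) :
    t.relDet h = t'.relDet h := by
  rw [relDet, Mor.pdet_trans t.tensorEquiv t'.tensorEquiv]
  have h1 : pdet (t.tensorEquiv.trans t'.tensorEquiv.symm).toLinearMap = 1 :=
    Contraction.pdet_equiv_trans_symm t t'
  rw [h1, one_mul, relDet]

lemma Contraction.exists_relDet_eq [Algebra A B] [IsScalarTower R A B]
    (t : (F.baseChange A).Contraction) :
    ∃ t' : (F.baseChange B).Contraction, t'.relDet h = algebraMap A B (t.relDet h) := by
  let e : (B ⊗[A] (A ⊗[R] F.even)) ≃ₗ[B] (B ⊗[R] F.even) :=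
    AlgebraTensorModule.cancelBaseChange R A B B F.even
  let o : (B ⊗[A] (A ⊗[R] F.odd)) ≃ₗ[B] (B ⊗[R] F.odd) :=
    AlgebraTensorModule.cancelBaseChange R A B B F.odd
  have key : ∀ {P Q : Type u} [AddCommGroup P] [Module R P] [AddCommGroup Q] [Module R Q]
      (f : P →ₗ[R] Q) (x : B ⊗[A] (A ⊗[R] P)),
      f.baseChange B (AlgebraTensorModule.cancelBaseChange R A B B P x) =
        AlgebraTensorModule.cancelBaseChange R A B B Q ((f.baseChange A).baseChange B x) := by
    intro P Q _ _ _ _ f x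
    induction x with
    | zero => simp
    | add x y hx hy => simp only [map_add, hx, hy]
    | tmul b y =>
      induction y with
      | zero => simp
      | add x y hx hy => simp only [TensorProduct.tmul_add, map_add, hx, hy]
      | tmul a y => rfl
  let s : ((F.baseChange A).baseChange B).Contraction := t.baseChange B
  refine ⟨Contraction.transport (F' := F.baseChange B) s e o (key F.dEven) (key F.dOdd), ?_⟩
  rw [relDet, relDet, ← pdet_baseChange]
  refine pdet_eq_of_equiv o _ _ fun x => ?_
  rw [LinearEquiv.coe_coe, LinearEquiv.trans_apply, LinearEquiv.symm_apply_eq]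
  have h1 := transport_equiv (F' := F.baseChange B) s e o (key F.dEven) (key F.dOdd) x
  refine Eq.trans h1 ?_
  refine Eq.trans ?_ (key h.toLinearMap _).symm
  refine congrArg e ?_
  have h2 : (s.equiv x : B ⊗[A] (A ⊗[R] F.even)) = t.tensorEquiv.toLinearMap.baseChange B x :=
    LinearMap.congr_fun (Contraction.baseChange_equiv B t) x
  refine h2.trans ?_
  rw [← LinearMap.comp_apply, ← LinearMap.baseChange_comp]
  congr 2
  apply LinearMap.ext
  intro y
  exact ((LinearEquiv.baseChange R A F.odd F.even h).apply_symm_apply (t.tensorEquiv y)).symm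

/-- This lets determinants of unrelated contractions over two different base rings be compared in
any ring over both. -/
lemma Contraction.algebraMap_relDet [Algebra A B] [IsScalarTower R A B]
    (t : (F.baseChange A).Contraction) (t' : (F.baseChange B).Contraction) :
    algebraMap A B (t.relDet h) = t'.relDet h := by
  obtain ⟨s, hs⟩ := t.exists_relDet_eq h (B := B)
  rw [← hs, s.relDet_eq h t']

/-- The modules in `X` are zero, so only the summand `F.odd` contributes, on which the automorphism
is `h⁻¹ (d + s)`. -/
lemma det_triv_of_ref (t : F.Contraction) (X : VirtObj R) [Subsingleton X.pos]
    [Subsingleton X.neg] (h : F.odd ≃ₗ[R] F.even) (ref : (X.pos × F.odd) ≃ₗ[R] (F.even × X.neg))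
    (href : ∀ y, ref (0, y) = (h y, 0)) :
    Mor.det ref (t.triv X) = pdet (t.equiv.trans h.symm).toLinearMap := by
  let E : F.odd ≃ₗ[R] (X.pos × F.odd × (FGProj.zero : FGProj R)) :=
    { toFun := fun x => (0, x, 0)
      invFun := fun x => x.2.1
      map_add' := fun x y => by simp
      map_smul' := fun a x => by simp
      left_inv := fun _ => rfl
      right_inv := fun x => Prod.ext (Subsingleton.elim _ _)
        (Prod.ext rfl (Subsingleton.elim _ _)) }
  rw [Contraction.triv, Mor.det_mk]
  refine pdet_eq_of_equiv E _ _ fun x => ?_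
  have h3 : ref.symm (t.equiv x, 0) = (0, h.symm (t.equiv x)) := by
    rw [LinearEquiv.symm_apply_eq, href, LinearEquiv.apply_symm_apply]
  change ((ref.symm (t.equiv x, 0)).1, (ref.symm (t.equiv x, 0)).2, _) = _
  rw [h3]
  rfl

lemma refBaseChange_refOfEquiv (y : A ⊗[R] F.odd) :
    Mor.refBaseChange A (refOfEquiv h) (0, y) =
      (LinearEquiv.baseChange R A F.odd F.even h y, 0) := by
  let h' := Mor.refBaseChange A (refOfEquiv h)
  change h' (0, y) = _
  induction y with
  | zero => exact (map_zero h').trans (by rw [map_zero]; rfl)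
  | add x y hx hy =>
    have h2 : ((0 : A ⊗[R] (VirtObj.one : VirtObj R).pos), x + y) = (0, x) + (0, y) := by simp
    refine (congrArg h' h2).trans ((map_add h' _ _).trans ?_)
    rw [hx, hy, map_add, Prod.mk_add_mk, add_zero]
  | tmul a y =>
    have h2 : ((0 : A ⊗[R] (VirtObj.one : VirtObj R).pos), a ⊗ₜ[R] y) =
      (a ⊗ₜ[R] 0, a ⊗ₜ[R] y) := by rw [TensorProduct.tmul_zero]
    refine (congrArg h' h2).trans ((Mor.refBaseChange_tmul A _ a _ y).trans ?_)
    refine Prod.ext rfl ?_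
    exact TensorProduct.tmul_zero _ _

lemma det_triv (t : (F.baseChange A).Contraction) :
    Mor.det (X := (VirtObj.one : VirtObj R).baseChange A) (Y := F.det.baseChange A)
      (Mor.refBaseChange A (refOfEquiv h))
      (t.triv ((VirtObj.one : VirtObj R).baseChange A)) = t.relDet h :=
  det_triv_of_ref t ((VirtObj.one : VirtObj R).baseChange A)
    (LinearEquiv.baseChange R A F.odd F.even h) (Mor.refBaseChange A (refOfEquiv h))
    (refBaseChange_refOfEquiv h)

end FoldedComplex

namespace Mor

variable {R : Type u} [CommRing R] {X Y : VirtObj R}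

/-- Take `R` as the auxiliary module and multiply it by `v`. -/
lemma exists_det_eq (h : (X.pos × Y.neg) ≃ₗ[R] (Y.pos × X.neg)) {v : R} (hv : IsUnit v) :
    ∃ c : Mor X Y, det h c = v := by
  obtain ⟨v, rfl⟩ := hv
  let φ : (X.pos × Y.neg × R) ≃ₗ[R] (X.pos × Y.neg × R) :=
    LinearEquiv.prodCongr (LinearEquiv.refl R _)
      (LinearEquiv.prodCongr (LinearEquiv.refl R _) (unitAut v))
  refine ⟨Mor.mk ⟨⟨R⟩, φ.trans (extendRef h R)⟩, ?_⟩
  rw [det_mk]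
  have h1 : ((φ.trans (extendRef h R)).trans (extendRef h R).symm) = φ :=
    LinearEquiv.ext fun x => (extendRef h R).symm_apply_apply _
  refine Eq.trans (congrArg (fun e : (X.pos × Y.neg × R) ≃ₗ[R] (X.pos × Y.neg × R) =>
    pdet e.toLinearMap) h1) ?_
  have h2 : φ.toLinearMap = (LinearMap.id : X.pos →ₗ[R] X.pos).prodMap
    ((LinearMap.id : Y.neg →ₗ[R] Y.neg).prodMap (unitAut v).toLinearMap) := rfl
  rw [h2, pdet_prodMap, pdet_prodMap, pdet_id, pdet_id, one_mul, one_mul, pdet_unitAut]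

end Mor

end DetFunctor

end

/-! ### The canonical trivialisation over regular semilocal rings. -/

noncomputable section

open TensorProduct CategoryTheory

namespace DetFunctor

variable {R : Type u} [CommRing R] [IsNoetherianRing R] {M : Type u} [AddCommGroup M] [Module R M]

namespace Resolution

variable (hR : HasFiniteProjDims R)
  (hM : ∀ (q : Ideal R) [q.IsPrime], q.height ≤ 1 → ¬ Module.annihilator R M ≤ q)
  (ρ : Resolution R M)

include hR hM

lemma nonempty_contraction_atPrime (q : Ideal R) [q.IsPrime] (hq : q.height ≤ 1) :
    Nonempty (ρ.C.fold.baseChange (Localization.AtPrime q)).Contraction := by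
  obtain ⟨r, hr, hrq⟩ := Set.not_subset.1 (hM q hq)
  exact ρ.nonempty_contraction_baseChange _ (hR.localization _) hr
    (IsLocalization.map_units _ (⟨r, hrq⟩ : q.primeCompl))

lemma nonempty_contraction_fractionRing :
    Nonempty (ρ.C.fold.baseChange (FractionRing R)).Contraction := by
  obtain ⟨r, hr, hr'⟩ := exists_mem_nonZeroDivisors hR _ hM
  exact ρ.nonempty_contraction_baseChange _ (hR.localization _) hr
    (IsLocalization.map_units _ (⟨r, hr'⟩ : nonZeroDivisors R))

/-- The rank at a prime equals the rank at a minimal prime below it. Minimal primes have height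
zero, and there the complex is contractible, so the two parts have equal rank. -/
lemma nonempty_odd_equiv_even [Finite (MaximalSpectrum R)] :
    Nonempty (ρ.C.fold.odd ≃ₗ[R] ρ.C.fold.even) := by
  refine nonempty_equiv_of_rankAtStalk_eq (funext fun q => ?_)
  obtain ⟨p, hp, hpq⟩ := Ideal.exists_minimalPrimes_le (bot_le : ⊥ ≤ q.asIdeal)
  have := hp.1.1
  have hp0 : p.height ≤ 1 := (Ideal.height_eq_zero_iff.2 hp).le.trans zero_le_one
  obtain ⟨t⟩ := ρ.nonempty_contraction_atPrime hR hM p hp0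
  have h1 : Module.rankAtStalk (R := R) ρ.C.fold.odd ⟨p, this⟩ =
      Module.rankAtStalk ρ.C.fold.even ⟨p, this⟩ := by
    rw [Module.rankAtStalk_eq_finrank_tensorProduct, Module.rankAtStalk_eq_finrank_tensorProduct]
    exact t.tensorEquiv.finrank_eq
  rw [← Module.rankAtStalk_eq_of_le_of_finite_of_flat _ (show (⟨p, this⟩ : PrimeSpectrum R) ≤ q
    from hpq), h1, Module.rankAtStalk_eq_of_le_of_finite_of_flat _
      (show (⟨p, this⟩ : PrimeSpectrum R) ≤ q from hpq)]

/-- The local determinants at the primes of height at most one come from a unit. -/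
lemma exists_unit_relDet (h : ρ.C.fold.odd ≃ₗ[R] ρ.C.fold.even) :
    ∃ v : R, IsUnit v ∧ ∀ (q : Ideal R) [q.IsPrime], q.height ≤ 1 →
      ∀ t : (ρ.C.fold.baseChange (Localization.AtPrime q)).Contraction,
        t.relDet h = algebraMap R _ v := by
  let K := FractionRing R
  obtain ⟨s⟩ := ρ.nonempty_contraction_fractionRing hR hM
  -- The candidate is the determinant `a/b` over the total ring of fractions; it remains to see that
  -- it lies in `R` and is a unit.
  obtain ⟨a, ⟨b, hb⟩, hab⟩ := IsLocalization.exists_mk'_eq (nonZeroDivisors R) (s.relDet h)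
  rw [eq_comm, IsLocalization.eq_mk'_iff_mul_eq] at hab
  have key : ∀ (q : Ideal R) [q.IsPrime]
      (t : (ρ.C.fold.baseChange (Localization.AtPrime q)).Contraction),
      algebraMap R (Localization.AtPrime q) a = t.relDet h * algebraMap R _ b := by
    intro q _ t
    -- The local determinant and `a/b` are compared in `R_q ⊗ K`, which contains `R_q` because `R_q`
    -- is flat and `R` embeds into `K`.
    let B := Localization.AtPrime q ⊗[R] K
    letI : Algebra K B := Algebra.TensorProduct.rightAlgebra
    have : IsScalarTower R K B := Algebra.TensorProduct.right_isScalarTower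
    have hinj : Function.Injective (algebraMap (Localization.AtPrime q) B) :=
      Algebra.TensorProduct.includeLeft_injective (S := R)
        (FaithfulSMul.algebraMap_injective R K)
    obtain ⟨t', ht'⟩ := t.exists_relDet_eq h (B := B)
    have h1 := s.algebraMap_relDet h t'
    apply hinj
    rw [map_mul, ← ht', ← h1, ← IsScalarTower.algebraMap_apply, ← IsScalarTower.algebraMap_apply,
      IsScalarTower.algebraMap_apply R K B a, ← hab, map_mul, ← IsScalarTower.algebraMap_apply]
  -- Locally at height at most one, `a` is a multiple of the regular element `b`, hence it is
  -- globally.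
  obtain ⟨v, hv⟩ := Ideal.mem_span_singleton'.1 (mem_span_of_height_le_one hR (a := a) (b := b)
    (Or.inr hb) fun q _ hq => by
      obtain ⟨t⟩ := ρ.nonempty_contraction_atPrime hR hM q hq
      exact Ideal.mem_span_singleton'.2 ⟨_, (key q t).symm⟩)
  have hloc : ∀ (q : Ideal R) [q.IsPrime], q.height ≤ 1 →
      ∀ t : (ρ.C.fold.baseChange (Localization.AtPrime q)).Contraction,
        t.relDet h = algebraMap R _ v := by
    intro q _ _ t
    have h1 := key q t
    rw [← hv, map_mul] at h1
    have h2 : algebraMap R (Localization.AtPrime q) b ∈ nonZeroDivisors _ :=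
      IsLocalization.nonZeroDivisors_le_comap q.primeCompl (Localization.AtPrime q) hb
    exact ((mul_cancel_right_mem_nonZeroDivisors h2).1 h1).symm
  refine ⟨v, ?_, hloc⟩
  have hvK : algebraMap R K v = s.relDet h := by
    have hbK : IsUnit (algebraMap R K b) := IsLocalization.map_units K (⟨b, hb⟩ : nonZeroDivisors R)
    rw [← hbK.mul_left_inj, hab, ← map_mul, hv]
  have hvreg : v ∈ nonZeroDivisors R := by
    have h1 : algebraMap R K v ∈ nonZeroDivisors K :=
      (hvK ▸ s.isUnit_relDet h : IsUnit (algebraMap R K v)).mem_nonZeroDivisors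
    refine mem_nonZeroDivisors_iff_right.2 fun x hx => ?_
    apply FaithfulSMul.algebraMap_injective R K
    rw [map_zero]
    refine (mem_nonZeroDivisors_iff_right.1 h1) _ ?_
    rw [← map_mul, hx, map_zero]
  -- The same test shows `1 ∈ (v)`: locally `v` is a determinant of an isomorphism.
  have h1 := mem_span_of_height_le_one hR (a := 1) (b := v) (Or.inr hvreg) fun q _ hq => by
    obtain ⟨t⟩ := ρ.nonempty_contraction_atPrime hR hM q hq
    rw [← hloc q hq t, Ideal.span_singleton_eq_top.2 (t.isUnit_relDet h)]
    trivial
  exact Ideal.span_singleton_eq_top.1 ((Ideal.eq_top_iff_one _).2 h1)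

/-- There is a morphism which at all primes of height at most one is the trivialisation by
acyclicity. -/
lemma exists_locally_triv [Finite (MaximalSpectrum R)] :
    ∃ c : Mor VirtObj.one ρ.C.det, ∀ (q : Ideal R) [q.IsPrime], q.height ≤ 1 →
      ∀ t : (ρ.C.fold.baseChange (Localization.AtPrime q)).Contraction,
        c.baseChange (Localization.AtPrime q) =
          t.triv (VirtObj.one.baseChange (Localization.AtPrime q)) := by
  obtain ⟨h⟩ := ρ.nonempty_odd_equiv_even hR hM
  obtain ⟨v, hv, hloc⟩ := ρ.exists_unit_relDet hR hM h
  obtain ⟨c, hc⟩ := Mor.exists_det_eq (X := VirtObj.one) (Y := ρ.C.det)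
    (FoldedComplex.refOfEquiv h) hv
  refine ⟨c, fun q _ hq t => ?_⟩
  refine Mor.eq_of_det_eq (X := (VirtObj.one : VirtObj R).baseChange (Localization.AtPrime q))
    (Y := ρ.C.det.baseChange (Localization.AtPrime q))
    (Mor.refBaseChange _ (FoldedComplex.refOfEquiv h)) _ _ ?_
  refine (Mor.det_baseChange _ _ c).trans ?_
  rw [hc, ← hloc q hq t]
  exact (FoldedComplex.det_triv h t).symm

/-- Morphisms to the determinant of a resolution which agree at all primes of height at most one
are equal. -/
lemma eq_of_locally_eq [Finite (MaximalSpectrum R)] (c c' : Mor VirtObj.one ρ.C.det)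
    (hcc' : ∀ (q : Ideal R) [q.IsPrime], q.height ≤ 1 →
      c.baseChange (Localization.AtPrime q) = c'.baseChange (Localization.AtPrime q)) :
    c = c' := by
  obtain ⟨h⟩ := ρ.nonempty_odd_equiv_even hR hM
  refine Mor.eq_of_det_eq (X := VirtObj.one) (Y := ρ.C.det) (FoldedComplex.refOfEquiv h) _ _
    (eq_of_height_le_one hR fun q _ hq => ?_)
  rw [← Mor.det_baseChange, ← Mor.det_baseChange, hcc' q hq]

end Resolution

/-- Each resolution has exactly one locally acyclic morphism. Naturality is a consequence: composing
with `d(f)` gives a morphism with the same localisations at height at most one as the one chosen for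
the target. -/
theorem hasCanonicalTrivialization [Finite (MaximalSpectrum R)] [Module.Finite R M]
    (hR : HasFiniteProjDims R)
    (hM : ∀ (q : Ideal R) [q.IsPrime], q.height ≤ 1 → ¬ Module.annihilator R M ≤ q) :
    HasCanonicalTrivialization R M := by
  refine ⟨Resolution.nonempty hR M, ?_⟩
  choose c hc using fun ρ : Resolution R M => ρ.exists_locally_triv hR hM
  refine ⟨c, ⟨fun ρ ρ' f hf => ?_, fun ρ q _ hq => ?_⟩, fun c' hc' => funext fun ρ => ?_⟩
  · obtain ⟨s⟩ := StrictlyPerfect.nonempty_contraction_cone hR f hf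
    refine ⟨s, ρ'.eq_of_locally_eq hR hM _ _ fun q _ hq => ?_⟩
    obtain ⟨t⟩ := ρ.nonempty_contraction_atPrime hR hM q hq
    obtain ⟨t'⟩ := ρ'.nonempty_contraction_atPrime hR hM q hq
    rw [Mor.baseChange_comp, FoldedComplex.detMap_baseChange, hc ρ q hq t, hc ρ' q hq t']
    exact FoldedComplex.Contraction.triv_comp_detMap _ _ t t' _
  · obtain ⟨t⟩ := ρ.nonempty_contraction_atPrime hR hM q hq
    exact ⟨t, hc ρ q hq t⟩
  · refine ρ.eq_of_locally_eq hR hM _ _ fun q _ hq => ?_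
    obtain ⟨t, ht⟩ := hc'.2 ρ q hq
    rw [ht, hc ρ q hq t]

lemma not_annihilator_le_of_two_le_krullCodim [Module.Finite R M] (h : 2 ≤ krullCodim R M)
    (q : Ideal R) [q.IsPrime] (hq : q.height ≤ 1) : ¬ Module.annihilator R M ≤ q := by
  intro hle
  have hsupp : (⟨q, inferInstance⟩ : PrimeSpectrum R) ∈ Module.support R M := by
    rw [Module.support_eq_zeroLocus]
    exact hle
  have h1 : krullCodim R M ≤ q.height := iInf₂_le _ hsupp
  exact absurd ((h.trans h1).trans hq) (by decide)

end DetFunctor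

end

/-! ### Compact rings: lifting properties from the quotient by one element. -/

noncomputable section

open TensorProduct CategoryTheory

namespace DetFunctor

section CompactRing

variable {A : Type*} [CommRing A] [TopologicalSpace A] [IsTopologicalRing A] [CompactSpace A]
  [T2Space A]

lemma isClosed_span_singleton (x : A) : IsClosed (Ideal.span {x} : Set A) := by
  have : (Ideal.span {x} : Set A) = Set.range fun a => a * x := by
    ext y
    simp [Ideal.mem_span_singleton', eq_comm]
  rw [this]
  exact (isCompact_range (by fun_prop)).isClosed

/-- In a compact ring, finitely generated ideals are closed for the `x`-adic topology. -/
lemma mem_of_forall_mem_sup_span_pow {x : A} (hx : ∀ y : A, (∀ n, y ∈ Ideal.span {x ^ n}) → y = 0)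
    {I : Ideal A} (hI : I.FG) {f : A} (hf : ∀ n, f ∈ I ⊔ Ideal.span {x ^ n}) : f ∈ I := by
  obtain ⟨m, p, rfl⟩ := Submodule.fg_iff_exists_fin_generating_family.1 hI
  -- `K n` consists of the coefficient vectors which express `f` modulo `x ^ n`. These sets are
  -- closed, nested and nonempty, so by compactness one vector works for all `n`, and separatedness
  -- makes the expression exact.
  let K : ℕ → Set (Fin m → A) := fun n => {c | f - ∑ i, c i * p i ∈ Ideal.span {x ^ n}}
  have hcl : ∀ n, IsClosed (K n) := fun n =>
    (isClosed_span_singleton (x ^ n)).preimage (by fun_prop)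
  obtain ⟨c, hc⟩ := IsCompact.nonempty_iInter_of_sequence_nonempty_isCompact_isClosed K
    (fun n c (hc : f - ∑ i, c i * p i ∈ Ideal.span {x ^ (n + 1)}) =>
      show f - ∑ i, c i * p i ∈ Ideal.span {x ^ n} from 
      Ideal.span_singleton_le_span_singleton.2 (pow_dvd_pow x n.le_succ) hc)
    (fun n => by
      obtain ⟨a, ha, b, hb, hab⟩ := Submodule.mem_sup.1 (hf n)
      obtain ⟨c, rfl⟩ := (Submodule.mem_span_range_iff_exists_fun A).1 ha
      refine ⟨c, ?_⟩
      change f - ∑ i, c i * p i ∈ Ideal.span {x ^ n}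
      rw [← hab]
      simpa using hb)
    (hcl 0).isCompact hcl
  have h0 := hx (f - ∑ i, c i * p i) fun n => Set.mem_iInter.1 hc n
  rw [sub_eq_zero.1 h0]
  exact Ideal.sum_mem _ fun i _ => Ideal.mul_mem_left _ _ (Ideal.subset_span ⟨i, rfl⟩)

/-- `x a + 1` is coprime to every `x ^ n`, so `1` lies in its ideal modulo every power of `x`, and
therefore in the ideal itself. -/
lemma mem_jacobson_bot_of_separated {x : A}
    (hx : ∀ y : A, (∀ n, y ∈ Ideal.span {x ^ n}) → y = 0) : x ∈ (⊥ : Ideal A).jacobson := by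
  rw [Ideal.mem_jacobson_bot]
  intro a
  rw [← Ideal.span_singleton_eq_top, Ideal.eq_top_iff_one]
  refine mem_of_forall_mem_sup_span_pow hx ⟨{x * a + 1}, by simp⟩ fun n => ?_
  have h : IsCoprime (x * a + 1) (x ^ n) :=
    IsCoprime.pow_right ⟨1, -a, by ring⟩
  obtain ⟨u, v, huv⟩ := h
  have := Submodule.add_mem_sup (S := Ideal.span {x * a + 1}) (T := Ideal.span {x ^ n}) (Ideal.mul_mem_left _ u (Ideal.mem_span_singleton_self _))
    (Ideal.mul_mem_left _ v (Ideal.mem_span_singleton_self _))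
  rwa [huv] at this

/-- A compact ring is noetherian if it is separated for the `x`-adic topology and its quotient by
`x` is noetherian. -/
lemma isNoetherianRing_of_separated {B : Type*} [CommRing B] [IsNoetherianRing B] (f : A →+* B)
    (hf : Function.Surjective f) {x : A} (hker : RingHom.ker f = Ideal.span {x})
    (hx : ∀ y : A, (∀ n, y ∈ Ideal.span {x ^ n}) → y = 0) : IsNoetherianRing A := by
  refine IsNoetherianRing.of_prime fun P hP => ?_
  -- By Cohen's theorem prime ideals suffice. Lifting generators of the image of `P` in the
  -- noetherian quotient approximates `P` modulo `x`.
  obtain ⟨s, hs⟩ : ∃ Q : Ideal A, Q.FG ∧ Q ≤ P ∧ P ≤ Q ⊔ Ideal.span {x} := by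
    obtain ⟨s, hs⟩ := (isNoetherianRing_iff_ideal_fg B).1 inferInstance (P.map f)
    have hmem : ∀ b : s, ∃ a ∈ P, f a = b := fun b =>
      (Ideal.mem_map_iff_of_surjective f hf).1 (hs ▸ Ideal.subset_span b.2)
    choose g hg hfg using hmem
    refine ⟨Ideal.span (Set.range g), Submodule.fg_span (Set.finite_range g), ?_, ?_⟩
    · rw [Ideal.span_le]
      rintro _ ⟨b, rfl⟩
      exact hg b
    · have h1 : P.map f ≤ (Ideal.span (Set.range g)).map f := by
        rw [← hs, Ideal.span_le]
        intro b hb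
        have := Ideal.mem_map_of_mem f
          (Ideal.subset_span (s := Set.range g) ⟨⟨b, hb⟩, rfl⟩)
        rwa [hfg] at this
      have h2 := Ideal.map_le_iff_le_comap.1 h1
      rw [Ideal.comap_map_of_surjective f hf] at h2
      refine h2.trans (sup_le_sup_left ?_ _)
      exact hker.le
  obtain ⟨hfg, hle, hge⟩ := hs
  by_cases hxP : x ∈ P
  · have : P = s ⊔ Ideal.span {x} :=
      le_antisymm hge (sup_le hle ((Ideal.span_singleton_le_iff_mem _).2 hxP))
    rw [this]
    exact Submodule.FG.sup hfg ⟨{x}, by simp⟩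
  -- If `x ∉ P`, the cofactor of `x` in an element of `P` is again in `P`, so the approximation can
  -- be repeated.
  · have key : ∀ n, ∀ a ∈ P, ∃ q ∈ s, ∃ b ∈ P, a = q + x ^ n * b := by
      intro n
      induction n with
      | zero => exact fun a ha => ⟨0, zero_mem _, a, ha, by simp⟩
      | succ n ih =>
        intro a ha
        obtain ⟨q, hq, b, hb, rfl⟩ := ih a ha
        obtain ⟨q', hq', c, hc, rfl⟩ := Submodule.mem_sup.1 (hge hb)
        obtain ⟨d, rfl⟩ := Ideal.mem_span_singleton'.1 hc
        refine ⟨q + x ^ n * q', add_mem hq (Ideal.mul_mem_left _ _ hq'), d, ?_, by ring⟩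
        have : d * x ∈ P := by simpa using sub_mem hb (hle hq')
        exact (hP.mem_or_mem this).resolve_right hxP
    have : P = s := le_antisymm (fun a ha => mem_of_forall_mem_sup_span_pow hx hfg fun n => by
      obtain ⟨q, hq, b, -, rfl⟩ := key n a ha
      exact Submodule.add_mem_sup hq
        (Ideal.mul_mem_right _ _ (Ideal.mem_span_singleton_self _))) hle
    rw [this]
    exact hfg

end CompactRing

lemma finite_maximalSpectrum_of_ker_le_jacobson {A B : Type*} [CommRing A] [CommRing B]
    [Finite (MaximalSpectrum B)] (f : A →+* B) (hf : Function.Surjective f)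
    (hker : RingHom.ker f ≤ (⊥ : Ideal A).jacobson) : Finite (MaximalSpectrum A) := by
  let g : MaximalSpectrum B → MaximalSpectrum A := fun m =>
    ⟨m.asIdeal.comap f, have := m.isMaximal; Ideal.comap_isMaximal_of_surjective f hf⟩
  refine Finite.of_surjective g fun m => ?_
  have hm := m.isMaximal
  have hle : RingHom.ker f ≤ m.asIdeal :=
    hker.trans (sInf_le ⟨bot_le, hm⟩)
  have hcm : (m.asIdeal.map f).comap f = m.asIdeal := by
    rw [Ideal.comap_map_of_surjective f hf]
    exact sup_eq_left.2 hle
  refine ⟨⟨m.asIdeal.map f, ?_⟩, MaximalSpectrum.ext hcm⟩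
  refine (Ideal.map_eq_top_or_isMaximal_of_surjective f hf hm).resolve_left fun h => ?_
  rw [h, Ideal.comap_top] at hcm
  exact hm.ne_top hcm.symm

/-! ### Projective dimension and quotients by a regular element. -/

section ChangeOfRings

open Abelian in
/-- A finitely generated module has finite projective dimension if its quotient by a regular
element of the Jacobson radical has. -/
lemma hasProjectiveDimensionLE_of_quotSMulTop {A : Type u} [CommRing A] [IsNoetherianRing A]
    (M : ModuleCat.{u} A) [Module.Finite A M] {x : A} (reg : IsSMulRegular M x)
    (mem : x ∈ (⊥ : Ideal A).jacobson) (n : ℕ)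
    (h : HasProjectiveDimensionLE (ModuleCat.of A (QuotSMulTop x M)) (n + 1)) :
    HasProjectiveDimensionLE M n := by
  let S := M.smulShortComplex x
  have hS : S.ShortExact := reg.smulShortComplex_shortExact
  apply ModuleCat.hasProjectiveDimensionLT_of_forall_finite
  intro L _
  have zero := HasProjectiveDimensionLT.subsingleton (ModuleCat.of A (QuotSMulTop x M))
    (n + 2) _ (le_refl _) L
  -- As `Ext^(n+2)(M/xM, L)` vanishes, `x` acts surjectively on `Ext^(n+1)(M, L)`. Nakayama then
  -- makes this group zero.
  have exac := Ext.contravariant_sequence_exact₁' hS L (n + 1) (n + 2) (add_comm 1 (n + 1))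
  have epi := exac.epi_f ((@AddCommGrpCat.isZero_of_subsingleton _ zero).eq_zero_of_tgt _)
  rw [AddCommGrpCat.epi_iff_surjective] at epi
  by_contra! ntr
  have : x ∈ (Module.annihilator A (Ext M L (n + 1))).jacobson :=
    Ideal.jacobson_mono bot_le mem
  absurd Submodule.top_ne_pointwise_smul_of_mem_jacobson_annihilator this
  rw [eq_comm, eq_top_iff]
  intro y hy
  obtain ⟨z, hz⟩ := epi y
  have key : ∀ w : Ext M L (n + 1), (Ext.mk₀ (x • 𝟙 M)).comp w (zero_add _) = x • w := fun w => by
    rw [Ext.mk₀_smul, Ext.smul_comp, Ext.mk₀_id_comp]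
  have hz' : x • (show Ext M L (n + 1) from z) = y := (key z).symm.trans hz
  rw [← hz']
  exact Submodule.smul_mem_pointwise_smul (M := Ext M L (n + 1)) z x ⊤ trivial

variable {A B : Type u} [CommRing A] [CommRing B] [Algebra A B]

lemma hasProjectiveDimensionLE_one_of_ker_eq_span (hs : Function.Surjective (algebraMap A B)) {x : A}
    (hx : x ∈ nonZeroDivisors A) (hker : RingHom.ker (algebraMap A B) = Ideal.span {x}) (n : ℕ) :
    HasProjectiveDimensionLE (ModuleCat.of A (Fin n → B)) 1 := by
  let g : (Fin n → A) →ₗ[A] (Fin n → B) := (Algebra.linearMap A B).compLeft (Fin n)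
  let f : (Fin n → A) →ₗ[A] (Fin n → A) := x • LinearMap.id
  have hg : Function.Surjective g := fun y => ⟨fun i => (hs (y i)).choose, funext fun i =>
    (hs (y i)).choose_spec⟩
  have hf : Function.Injective f := fun y z h => funext fun i =>
    (mul_cancel_left_mem_nonZeroDivisors hx).1 (congrFun h i)
  have hfg : Function.Exact f g := by
    intro y
    constructor
    · intro h
      have h1 : ∀ i, ∃ a, a * x = y i := fun i => by
        rw [← Ideal.mem_span_singleton', ← hker]
        exact congrFun h i
      choose a ha using h1
      exact ⟨a, funext fun i => by rw [← ha i]; exact mul_comm _ _⟩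
    · rintro ⟨z, rfl⟩
      refine funext fun i => ?_
      change x * z i ∈ RingHom.ker (algebraMap A B)
      rw [hker]
      exact Ideal.mul_mem_right _ _ (Ideal.mem_span_singleton_self _)
  let S : ShortComplex (ModuleCat.{u} A) :=
    ShortComplex.mk (ModuleCat.ofHom f) (ModuleCat.ofHom g)
      (ModuleCat.hom_ext hfg.linearMap_comp_eq_zero)
  have hS : S.ShortExact :=
    { exact := (ShortComplex.ShortExact.moduleCat_exact_iff_function_exact S).2 hfg
      mono_f := (ModuleCat.mono_iff_injective _).2 hf
      epi_g := (ModuleCat.epi_iff_surjective _).2 hg }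
  have h1 : Projective S.X₁ := ModuleCat.projective_of_free (Pi.basisFun A (Fin n))
  have h2 : Projective S.X₂ := ModuleCat.projective_of_free (Pi.basisFun A (Fin n))
  exact hS.hasProjectiveDimensionLT_X₃ 1
    (projective_iff_hasProjectiveDimensionLT_one.1 h1)
    (hasProjectiveDimensionLT_of_ge S.X₂ 1 2 (by omega))

/-- Change of rings: the projective dimension increases by at most one along the quotient by a
regular element. -/
lemma hasProjectiveDimensionLE_succ_of_ker_eq_span
    (hs : Function.Surjective (algebraMap A B)) {x : A}
    (hx : x ∈ nonZeroDivisors A) (hker : RingHom.ker (algebraMap A B) = Ideal.span {x})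
    [IsNoetherianRing B] (n : ℕ) (M : Type u) [AddCommGroup M] [Module A M] [Module B M]
    [IsScalarTower A B M] [Module.Finite B M]
    (h : HasProjectiveDimensionLE (ModuleCat.of B M) n) :
    HasProjectiveDimensionLE (ModuleCat.of A M) (n + 1) := by
  induction n generalizing M with
  | zero =>
    have := projective_of_hasProjectiveDimensionLE_zero h
    obtain ⟨m, f, hf⟩ := Module.Finite.exists_fin' B M
    obtain ⟨g, hg⟩ := Module.projective_lifting_property f LinearMap.id hf
    have h1 := hasProjectiveDimensionLE_one_of_ker_eq_span hs hx hker m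
    let r : Retract (ModuleCat.of A M) (ModuleCat.of A (Fin m → B)) :=
      { i := ModuleCat.ofHom (g.restrictScalars A)
        r := ModuleCat.ofHom (f.restrictScalars A)
        retract := ModuleCat.hom_ext (LinearMap.ext fun y => LinearMap.congr_fun hg y) }
    exact r.hasProjectiveDimensionLT 2
  | succ n ih =>
    obtain ⟨m, f, hf⟩ := Module.Finite.exists_fin' B M
    have h1 := hasProjectiveDimensionLE_one_of_ker_eq_span hs hx hker m
    have h2 := ih (LinearMap.ker f) (hasProjectiveDimensionLE_ker_of_succ hf h)
    let S : ShortComplex (ModuleCat.{u} A) :=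
      ShortComplex.mk (ModuleCat.ofHom ((LinearMap.ker f).subtype.restrictScalars A))
        (ModuleCat.ofHom (f.restrictScalars A)) (ModuleCat.hom_ext (LinearMap.ext fun y => y.2))
    have hS : S.ShortExact :=
      { exact := (ShortComplex.ShortExact.moduleCat_exact_iff_function_exact S).2 fun y =>
          ⟨fun hy => ⟨⟨y, hy⟩, rfl⟩, by rintro ⟨z, rfl⟩; exact z.2⟩
        mono_f := (ModuleCat.mono_iff_injective _).2 Subtype.val_injective
        epi_g := (ModuleCat.epi_iff_surjective _).2 hf }
    exact hS.hasProjectiveDimensionLT_X₃ (n + 2) h2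
      (@hasProjectiveDimensionLT_of_ge _ _ _ S.X₂ 2 (n + 3) (by omega) h1)

/-- `x` need not be regular on `M`, but it is on the kernel `K` of a free cover. The module `K/xK`,
which is `B ⊗ K`, has finite projective dimension over `B`, hence over `A`; from there one returns
to `K` and then to `M`. -/
lemma HasFiniteProjDims.of_ker_eq_span [IsNoetherianRing A] [IsNoetherianRing B]
    (hB : HasFiniteProjDims B) (hs : Function.Surjective (algebraMap A B)) {x : A}
    (hx : x ∈ nonZeroDivisors A) (hker : RingHom.ker (algebraMap A B) = Ideal.span {x})
    (hjac : x ∈ (⊥ : Ideal A).jacobson) : HasFiniteProjDims A := by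
  intro M _ _ _
  obtain ⟨m, f, hf⟩ := Module.Finite.exists_fin' A M
  let K := LinearMap.ker f
  have hreg : IsSMulRegular K x := fun y z h => Subtype.ext (funext fun i =>
    (mul_cancel_left_mem_nonZeroDivisors hx).1 (congrFun (congrArg Subtype.val h) i))
  obtain ⟨n, hn⟩ := hB (B ⊗[A] K)
  have h1 := hasProjectiveDimensionLE_succ_of_ker_eq_span hs hx hker n (B ⊗[A] K) hn
  let e0 : (A ⧸ Ideal.span {x}) ≃ₗ[A] B :=
    (Submodule.quotEquivOfEq _ _ hker.symm).trans
      ((Algebra.linearMap A B).quotKerEquivOfSurjective hs)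
  let e : (B ⊗[A] K) ≃ₗ[A] QuotSMulTop x K :=
    (TensorProduct.congr e0.symm (LinearEquiv.refl A K)).trans
      (QuotSMulTop.equivQuotTensor x K).symm
  have h2 : HasProjectiveDimensionLE (ModuleCat.of A (QuotSMulTop x K)) (n + 1) :=
    hasProjectiveDimensionLT_of_iso e.toModuleIso (n + 2)
  have h3 : HasProjectiveDimensionLE (ModuleCat.of A K) n :=
    hasProjectiveDimensionLE_of_quotSMulTop (ModuleCat.of A K) hreg hjac n h2
  refine ⟨n + 1, ?_⟩
  have hS : (LinearMap.shortComplexKer f).ShortExact := LinearMap.shortExact_shortComplexKer hf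
  have : Projective (LinearMap.shortComplexKer f).X₂ :=
    ModuleCat.projective_of_free (Pi.basisFun A (Fin m))
  exact (hS.hasProjectiveDimensionLT_X₃_iff n this).2 h3

end ChangeOfRings

/-- The properties of a ring which make the determinant functor well behaved. -/
structure IsRegularSemilocal (R : Type u) [CommRing R] : Prop where
  noetherian : IsNoetherianRing R
  semilocal : Finite (MaximalSpectrum R)
  finiteProjDims : HasFiniteProjDims R

lemma IsRegularSemilocal.of_ker_eq_span {A B : Type u} [CommRing A] [TopologicalSpace A]
    [IsTopologicalRing A] [CompactSpace A] [T2Space A] [CommRing B] (hB : IsRegularSemilocal B)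
    (f : A →+* B) (hf : Function.Surjective f) {x : A} (hx : x ∈ nonZeroDivisors A)
    (hker : RingHom.ker f = Ideal.span {x})
    (hsep : ∀ y : A, (∀ n, y ∈ Ideal.span {x ^ n}) → y = 0) : IsRegularSemilocal A := by
  let := f.toAlgebra
  have := hB.noetherian
  have := hB.semilocal
  have hjac := mem_jacobson_bot_of_separated hsep
  have hA := isNoetherianRing_of_separated f hf hker hsep
  refine ⟨hA, finite_maximalSpectrum_of_ker_le_jacobson f hf ?_,
    hB.finiteProjDims.of_ker_eq_span hf hx hker hjac⟩
  rw [hker, Ideal.span_singleton_le_iff_mem]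
  exact hjac

/-- A prime ideal containing a regular sequence of length two has height at least two. -/
lemma one_lt_height_of_regular {A : Type*} [CommRing A] [IsNoetherianRing A] (q : Ideal A)
    [q.IsPrime] {x y : A} (hxq : x ∈ q) (hyq : y ∈ q) (hx : x ∈ nonZeroDivisors A)
    (hy : ∀ a b : A, y * a = x * b → ∃ c, a = x * c) : 1 < q.height := by
  by_contra! h
  have hle : Ideal.span {x} ≤ q := (Ideal.span_singleton_le_iff_mem _).2 hxq
  -- A prime strictly below `q` would have height zero, and minimal primes contain no
  -- nonzerodivisor. So `q` is minimal over `(x)` and consists of zero divisors modulo `x`, against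
  -- the regularity of `y`.
  have hmin : q ∈ (Ideal.span {x}).minimalPrimes := by
    refine ⟨⟨inferInstance, hle⟩, fun r hr hrq => ?_⟩
    by_contra hqr
    have := hr.1
    have h1 := Ideal.height_add_one_le_of_lt_of_isPrime
      (lt_of_le_of_ne hrq fun h' => hqr h'.ge)
    have h0 : r.height = 0 := by
      have h2 := h1.trans h
      have h3 : r.height + 1 ≤ 0 + 1 := by simpa using h2
      simpa using (ENat.add_le_add_iff_right ENat.one_ne_top).1 h3
    exact notMem_nonZeroDivisors_of_mem_mem_minimalPrimes
      (hr.2 (Ideal.mem_span_singleton_self x)) (Ideal.height_eq_zero_iff.1 h0) hx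
  rw [Ideal.minimalPrimes_eq_comap] at hmin
  obtain ⟨q', hq', rfl⟩ := hmin
  refine notMem_nonZeroDivisors_of_mem_mem_minimalPrimes (Ideal.mem_comap.1 hyq) hq'
    (mem_nonZeroDivisors_iff_left.2 fun a ha => ?_)
  obtain ⟨a, rfl⟩ := Ideal.Quotient.mk_surjective a
  rw [← map_mul, Ideal.Quotient.eq_zero_iff_mem, Ideal.mem_span_singleton] at ha
  obtain ⟨b, hb⟩ := ha
  rw [Ideal.Quotient.eq_zero_iff_mem, Ideal.mem_span_singleton]
  exact hy a b hb

end DetFunctor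

end

/-! ### Iwasawa algebras: finite levels, functoriality, compactness and `p`-adic separatedness. -/

noncomputable section

open TensorProduct CategoryTheory

namespace Iwasawa

section CoeffTopology

variable (p : ℕ) [Fact p.Prime] (Q : Type*)

/-- The topology of coefficientwise convergence on a group algebra over `ℤ_p`. -/
abbrev coeffTopology : TopologicalSpace (MonoidAlgebra ℤ_[p] Q) :=
  TopologicalSpace.induced (fun f q => f.coeff q) inferInstance

attribute [local instance] coeffTopology

variable {p Q}

lemma continuous_coeff (q : Q) : Continuous fun f : MonoidAlgebra ℤ_[p] Q => f.coeff q :=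
  (continuous_apply q).comp (continuous_induced_dom (f := fun f : MonoidAlgebra ℤ_[p] Q =>
    (fun q => f.coeff q)))

lemma continuous_of_coeff {X : Type*} [TopologicalSpace X] {f : X → MonoidAlgebra ℤ_[p] Q}
    (h : ∀ q, Continuous fun x => (f x).coeff q) : Continuous f :=
  continuous_induced_rng.2 (continuous_pi h)

variable (p Q) in
/-- A group algebra of a finite group is homeomorphic to a power of `ℤ_p`. -/
def coeffHomeomorph [Finite Q] : MonoidAlgebra ℤ_[p] Q ≃ₜ (Q → ℤ_[p]) :=
  Equiv.toHomeomorphOfIsInducing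
    (MonoidAlgebra.coeffEquiv.trans Finsupp.equivFunOnFinite) ⟨rfl⟩

lemma compactSpace_monoidAlgebra [Finite Q] : CompactSpace (MonoidAlgebra ℤ_[p] Q) :=
  (coeffHomeomorph p Q).symm.compactSpace

lemma t2Space_monoidAlgebra [Finite Q] : T2Space (MonoidAlgebra ℤ_[p] Q) :=
  (coeffHomeomorph p Q).symm.t2Space

lemma isTopologicalRing_monoidAlgebra [Group Q] [Finite Q] :
    IsTopologicalRing (MonoidAlgebra ℤ_[p] Q) where
  continuous_add := continuous_of_coeff fun q =>
    ((continuous_coeff q).comp continuous_fst).add ((continuous_coeff q).comp continuous_snd)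
  continuous_neg := continuous_of_coeff fun q => (continuous_coeff q).neg
  continuous_mul := continuous_of_coeff fun q => by
    have := Fintype.ofFinite Q
    have h : ∀ x : MonoidAlgebra ℤ_[p] Q × MonoidAlgebra ℤ_[p] Q, (x.1 * x.2).coeff q =
        ∑ r : Q, x.1.coeff r * x.2.coeff (r⁻¹ * q) := fun x => by
      rw [MonoidAlgebra.coeff_mul_apply_left, Finsupp.sum_fintype _ _ (by simp)]
    simp only [h]
    exact continuous_finsetSum _ fun r _ => ((continuous_coeff r).comp continuous_fst).mul
      ((continuous_coeff _).comp continuous_snd)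

lemma coeff_mapDomain_apply {Q' : Type*} [Fintype Q] [DecidableEq Q'] {R : Type*} [Semiring R]
    (f : Q → Q')
    (x : MonoidAlgebra R Q) (c : Q') : (MonoidAlgebra.mapDomain f x).coeff c =
      ∑ q, if f q = c then x.coeff q else 0 := by
  change Finsupp.mapDomain f x.coeff c = _
  rw [Finsupp.mapDomain, Finsupp.sum_fintype _ _ (by simp), Finsupp.finsetSum_apply]
  simp [Finsupp.single_apply]

lemma continuous_mapDomain {Q' : Type*} [Finite Q] (f : Q → Q') :
    Continuous (MonoidAlgebra.mapDomain f : MonoidAlgebra ℤ_[p] Q → MonoidAlgebra ℤ_[p] Q') := by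
  classical
  have := Fintype.ofFinite Q
  refine continuous_of_coeff fun c => ?_
  simp only [coeff_mapDomain_apply]
  exact continuous_finsetSum _ fun q _ => by
    split_ifs
    · exact continuous_coeff q
    · exact continuous_const

end CoeffTopology

attribute [local instance] coeffTopology compactSpace_monoidAlgebra t2Space_monoidAlgebra
  isTopologicalRing_monoidAlgebra

variable {p : ℕ} [Fact p.Prime] {G H : Type*} [CommGroup G] [TopologicalSpace G]
  [CommGroup H] [TopologicalSpace H]

lemma ext_proj {f g : IwasawaAlgebra p G} (h : ∀ U, proj p G U f = proj p G U g) : f = g :=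
  Subtype.ext (funext h)

lemma transition_proj {U V : OpenSubgroup G} (h : U ≤ V) (f : IwasawaAlgebra p G) :
    transition p G U V h (proj p G U f) = proj p G V f :=
  f.2 U V h

lemma transition_self (U : OpenSubgroup G) (x : MonoidAlgebra ℤ_[p] (G ⧸ (U : Subgroup G))) :
    transition p G U U le_rfl x = x := by
  refine MonoidAlgebra.coeff_injective ?_
  have h : QuotientGroup.map (U : Subgroup G) (U : Subgroup G) (MonoidHom.id G) le_rfl =
    MonoidHom.id _ := QuotientGroup.map_id _
  exact (congrArg (fun ψ : _ →* _ => Finsupp.mapDomain ψ _) h).trans Finsupp.mapDomain_id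

section Functoriality

variable (p G) in
/-- The map `ℤ_p[G] → Λ(G)`. -/
def ofGroupAlgebra : MonoidAlgebra ℤ_[p] G →+* IwasawaAlgebra p G :=
  (RingHom.pi fun U : OpenSubgroup G =>
    MonoidAlgebra.mapDomainRingHom ℤ_[p] (QuotientGroup.mk' (U : Subgroup G))).codRestrict _
    fun x U V h => by
      have : (transition p G U V h).comp (MonoidAlgebra.mapDomainRingHom ℤ_[p]
          (QuotientGroup.mk' (U : Subgroup G))) =
          MonoidAlgebra.mapDomainRingHom ℤ_[p] (QuotientGroup.mk' (V : Subgroup G)) := by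
        rw [transition, ← MonoidAlgebra.mapDomainRingHom_comp]
        rfl
      exact RingHom.congr_fun this x

lemma proj_ofGroupAlgebra (U : OpenSubgroup G) (x : MonoidAlgebra ℤ_[p] G) :
    proj p G U (ofGroupAlgebra p G x) =
      MonoidAlgebra.mapDomain (QuotientGroup.mk' (U : Subgroup G)) x := rfl

variable (p) in
/-- The group-like element of `Λ(G)` defined by an element of `G`. -/
def gp (g : G) : IwasawaAlgebra p G := ofGroupAlgebra p G (MonoidAlgebra.single g 1)

/-- The constants in `Λ(G)`. -/
def const : ℤ_[p] →+* IwasawaAlgebra p G :=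
  (ofGroupAlgebra p G).comp MonoidAlgebra.singleOneRingHom

@[simp]
lemma proj_gp (U : OpenSubgroup G) (g : G) :
    proj p G U (gp p g) = MonoidAlgebra.single (g : G ⧸ (U : Subgroup G)) 1 := by
  simp [gp, proj_ofGroupAlgebra]

@[simp]
lemma proj_const (U : OpenSubgroup G) (c : ℤ_[p]) :
    proj p G U (const c) = MonoidAlgebra.single 1 c := by
  simp [const, proj_ofGroupAlgebra]

@[simp]
lemma gp_one : gp p (1 : G) = 1 := (ofGroupAlgebra p G).map_one

lemma proj_surjective (U : OpenSubgroup G) : Function.Surjective (proj p G U) := by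
  intro x
  obtain ⟨y, rfl⟩ : ∃ y, MonoidAlgebra.mapDomainRingHom ℤ_[p]
      (QuotientGroup.mk' (U : Subgroup G)) y = x := by
    induction x using MonoidAlgebra.induction_linear with
    | zero => exact ⟨0, map_zero _⟩
    | add x y hx hy =>
      obtain ⟨x, rfl⟩ := hx
      obtain ⟨y, rfl⟩ := hy
      exact ⟨x + y, map_add _ _ _⟩
    | single q r =>
      obtain ⟨g, rfl⟩ := QuotientGroup.mk'_surjective _ q
      exact ⟨MonoidAlgebra.single g r, by simp⟩
  exact ⟨ofGroupAlgebra p G y, rfl⟩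

/-- The map of finite level group algebras induced by a continuous homomorphism. -/
def mapLevel (φ : G →ₜ* H) (U : OpenSubgroup G) (W : OpenSubgroup H)
    (h : U ≤ W.comap φ.toMonoidHom φ.continuous_toFun) :
    MonoidAlgebra ℤ_[p] (G ⧸ (U : Subgroup G)) →+* MonoidAlgebra ℤ_[p] (H ⧸ (W : Subgroup H)) :=
  MonoidAlgebra.mapDomainRingHom ℤ_[p] (QuotientGroup.map _ _ φ.toMonoidHom h)

lemma transition_comp_mapLevel (φ : G →ₜ* H) {U U' : OpenSubgroup G} {W W' : OpenSubgroup H}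
    (hU : U' ≤ U) (hW : W' ≤ W) (h : U ≤ W.comap φ.toMonoidHom φ.continuous_toFun)
    (h' : U' ≤ W'.comap φ.toMonoidHom φ.continuous_toFun) :
    (transition p H W' W hW).comp (mapLevel φ U' W' h') =
      (mapLevel φ U W h).comp (transition p G U' U hU) := by
  rw [transition, transition, mapLevel, mapLevel, ← MonoidAlgebra.mapDomainRingHom_comp,
    ← MonoidAlgebra.mapDomainRingHom_comp]
  congr 1
  ext x
  rfl

variable (p) in
/-- Functoriality of the Iwasawa algebra. -/
def map (φ : G →ₜ* H) : IwasawaAlgebra p G →+* IwasawaAlgebra p H :=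
  (RingHom.pi fun W : OpenSubgroup H =>
    (mapLevel φ (W.comap φ.toMonoidHom φ.continuous_toFun) W le_rfl).comp
      (proj p G (W.comap φ.toMonoidHom φ.continuous_toFun))).codRestrict _
    fun f W' W h => by
      have := RingHom.congr_fun (transition_comp_mapLevel (p := p) φ
        (U := W.comap φ.toMonoidHom φ.continuous_toFun)
        (U' := W'.comap φ.toMonoidHom φ.continuous_toFun) (fun x hx => h hx) h le_rfl le_rfl)
        (proj p G (W'.comap φ.toMonoidHom φ.continuous_toFun) f)
      exact this.trans (congrArg (mapLevel φ _ W le_rfl) (transition_proj _ f))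

/-- `map` is defined with the full preimage of `W`, but any smaller level `U` computes the same
projection, which frees later arguments to choose `U`. -/
lemma proj_map (φ : G →ₜ* H) (U : OpenSubgroup G) (W : OpenSubgroup H)
    (h : U ≤ W.comap φ.toMonoidHom φ.continuous_toFun) (f : IwasawaAlgebra p G) :
    proj p H W (map p φ f) = mapLevel φ U W h (proj p G U f) := by
  have := RingHom.congr_fun (transition_comp_mapLevel (p := p) φ h (le_refl W) le_rfl h)
    (proj p G U f)
  rw [RingHom.comp_apply, RingHom.comp_apply, transition_proj] at this
  exact this.symm.trans (transition_self W _)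

lemma mapLevel_single (φ : G →ₜ* H) (U : OpenSubgroup G) (W : OpenSubgroup H)
    (h : U ≤ W.comap φ.toMonoidHom φ.continuous_toFun) (g : G) (c : ℤ_[p]) :
    mapLevel φ U W h (MonoidAlgebra.single (g : G ⧸ (U : Subgroup G)) c) =
      MonoidAlgebra.single (φ g : H ⧸ (W : Subgroup H)) c :=
  MonoidAlgebra.mapDomain_single

lemma map_gp (φ : G →ₜ* H) (g : G) : map p φ (gp p g) = gp p (φ g) :=
  ext_proj fun W => by
    rw [proj_map φ _ W le_rfl, proj_gp, proj_gp, mapLevel_single]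

lemma map_const (φ : G →ₜ* H) (c : ℤ_[p]) : map p φ (const c) = const c :=
  ext_proj fun W => by
    rw [proj_map φ _ W le_rfl, proj_const, proj_const]
    exact (mapLevel_single φ _ W le_rfl 1 c).trans (by rw [map_one]; rfl)

lemma map_map {K : Type*} [CommGroup K] [TopologicalSpace K] (ψ : H →ₜ* K) (φ : G →ₜ* H)
    (f : IwasawaAlgebra p G) : map p ψ (map p φ f) = map p (ψ.comp φ) f :=
  ext_proj fun W => by
    rw [proj_map ψ _ W le_rfl, proj_map φ _ _ le_rfl, proj_map (ψ.comp φ) _ W le_rfl, mapLevel,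
      mapLevel, mapLevel, ← RingHom.comp_apply, ← MonoidAlgebra.mapDomainRingHom_comp]
    congr 2
    ext x
    rfl

lemma map_id (f : IwasawaAlgebra p G) : map p (ContinuousMonoidHom.id G) f = f :=
  ext_proj fun W => (proj_map _ W W le_rfl f).trans (transition_self W _)

lemma map_map_of_rightInverse {π : G →ₜ* H} {s : H →ₜ* G} (hs : ∀ h, π (s h) = h) (f : IwasawaAlgebra p H) :
    map p π (map p s f) = f := by
  rw [map_map]
  have : π.comp s = ContinuousMonoidHom.id H := ContinuousMonoidHom.ext hs
  rw [this, map_id]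

end Functoriality

section Topology

variable [IsTopologicalGroup G] [CompactSpace G] [IsTopologicalGroup H] [CompactSpace H]

lemma continuous_proj (U : OpenSubgroup G) : Continuous (proj p G U) :=
  (continuous_apply U).comp continuous_subtype_val

lemma compactSpace_iwasawaAlgebra : CompactSpace (IwasawaAlgebra p G) := by
  refine isCompact_iff_compactSpace.1 (IsClosed.isCompact ?_)
  have : ((iwasawaSubring p G : Subring _) : Set (∀ U : OpenSubgroup G,
      MonoidAlgebra ℤ_[p] (G ⧸ (U : Subgroup G)))) =
      ⋂ (U) (V) (h : U ≤ V), {x | transition p G U V h (x U) = x V} := by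
    ext x
    simp only [Set.mem_iInter]
    rfl
  rw [this]
  exact isClosed_iInter fun U => isClosed_iInter fun V => isClosed_iInter fun h =>
    isClosed_eq ((continuous_mapDomain _).comp (continuous_apply U)) (continuous_apply V)

lemma continuous_map (φ : G →ₜ* H) : Continuous (map p φ) :=
  Continuous.subtype_mk (continuous_pi fun _ => (continuous_mapDomain _).comp
    (continuous_proj _)) _

attribute [local instance] compactSpace_iwasawaAlgebra

/-- The solutions at the various levels form a directed family of nonempty closed sets in a compact
space, so divisibility can be tested at finite level. -/
lemma exists_mul_eq_of_forall_proj (y f : IwasawaAlgebra p G)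
    (h : ∀ V, ∃ g, proj p G V (y * g) = proj p G V f) : ∃ g, y * g = f := by
  let K : OpenSubgroup G → Set (IwasawaAlgebra p G) := fun V =>
    {g | proj p G V (y * g) = proj p G V f}
  have hcl : ∀ V, IsClosed (K V) := fun V =>
    isClosed_eq ((continuous_proj V).comp (continuous_const.mul continuous_id)) continuous_const
  have hmono : ∀ U V, U ≤ V → K U ⊆ K V := fun U V hUV g hg => by
    change proj p G V (y * g) = proj p G V f
    rw [← transition_proj hUV, ← transition_proj hUV f]
    exact congrArg _ hg
  obtain ⟨g, hg⟩ := IsCompact.nonempty_iInter_of_directed_nonempty_isCompact_isClosed K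
    (fun U V => ⟨U ⊓ V, hmono _ _ inf_le_left, hmono _ _ inf_le_right⟩) h
    (fun V => (hcl V).isCompact) hcl
  exact ⟨g, ext_proj fun V => Set.mem_iInter.1 hg V⟩

end Topology

section Separation

lemma coeff_proj_const_mul (U : OpenSubgroup G) (c : ℤ_[p]) (f : IwasawaAlgebra p G)
    (q : G ⧸ (U : Subgroup G)) :
    (proj p G U (const c * f)).coeff q = c * (proj p G U f).coeff q := by
  rw [map_mul, proj_const, MonoidAlgebra.coeff_single_one_mul]

lemma coeff_proj_gp_mul (U : OpenSubgroup G) (g : G) (f : IwasawaAlgebra p G)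
    (q : G ⧸ (U : Subgroup G)) :
    (proj p G U (gp p g * f)).coeff q = (proj p G U f).coeff ((g : G ⧸ (U : Subgroup G))⁻¹ * q) := by
  rw [map_mul, proj_gp, MonoidAlgebra.coeff_single_mul_apply, one_mul]

lemma ext_coeff {f g : IwasawaAlgebra p G}
    (h : ∀ U q, (proj p G U f).coeff q = (proj p G U g).coeff q) : f = g :=
  ext_proj fun U => MonoidAlgebra.coeff_injective (Finsupp.ext (h U))

lemma eq_zero_of_forall_pow_dvd {c : ℤ_[p]} (h : ∀ n : ℕ, (p : ℤ_[p]) ^ n ∣ c) : c = 0 := by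
  by_contra hc
  have := (PadicInt.mem_span_pow_iff_le_valuation c hc (c.valuation + 1)).1
    (Ideal.mem_span_singleton.2 (h _))
  omega

lemma p_mem_nonZeroDivisors : (p : IwasawaAlgebra p G) ∈ nonZeroDivisors (IwasawaAlgebra p G) := by
  rw [mem_nonZeroDivisors_iff_left]
  intro f hf
  refine ext_coeff fun U q => ?_
  have := coeff_proj_const_mul U p f q
  rw [map_natCast, hf] at this
  have hp : (p : ℤ_[p]) ≠ 0 := Nat.cast_ne_zero.2 (Fact.out (p := p.Prime)).ne_zero
  rw [map_zero] at this ⊢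
  exact (mul_eq_zero.1 this.symm).resolve_left hp

lemma eq_zero_of_forall_mem_span_pow (f : IwasawaAlgebra p G)
    (hf : ∀ n, f ∈ Ideal.span {(p : IwasawaAlgebra p G) ^ n}) : f = 0 := by
  refine ext_coeff fun U q => ?_
  rw [map_zero]
  refine eq_zero_of_forall_pow_dvd fun n => ?_
  obtain ⟨g, rfl⟩ := Ideal.mem_span_singleton.1 (hf n)
  have := coeff_proj_const_mul U (p ^ n) g q
  rw [map_pow, map_natCast] at this
  exact ⟨_, this⟩

lemma dvd_of_forall_coeff [IsTopologicalGroup G] [CompactSpace G] {f : IwasawaAlgebra p G}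
    (h : ∀ U q, (p : ℤ_[p]) ∣ (proj p G U f).coeff q) : (p : IwasawaAlgebra p G) ∣ f := by
  obtain ⟨g, hg⟩ := exists_mul_eq_of_forall_proj (const (p : ℤ_[p])) f fun V => by
    choose d hd using h V
    obtain ⟨g, hg⟩ := proj_surjective V (.ofCoeff (Finsupp.equivFunOnFinite.symm d))
    refine ⟨g, MonoidAlgebra.coeff_injective (Finsupp.ext fun q => ?_)⟩
    rw [coeff_proj_const_mul, hg, hd]
    rfl
  exact ⟨g, by rw [← hg, map_natCast]⟩

end Separation

end Iwasawa

end

/-! ### The element `γ - 1` attached to a direct factor `ℤ_p`. -/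

noncomputable section

open TensorProduct CategoryTheory

namespace Iwasawa

attribute [local instance] coeffTopology compactSpace_monoidAlgebra t2Space_monoidAlgebra
  isTopologicalRing_monoidAlgebra compactSpace_iwasawaAlgebra

/-- The kernel of the homomorphism of group algebras induced by the quotient by a cyclic group is
generated by `c - 1`, for a generator `c` of that group. -/
lemma sub_one_dvd_of_mapDomain_eq_zero {R Q Q' : Type*} [CommRing R] [CommGroup Q] [Finite Q]
    [CommGroup Q'] (φ : Q →* Q') {c : Q} (hc : φ.ker ≤ Subgroup.zpowers c)
    {x : MonoidAlgebra R Q} (hx : MonoidAlgebra.mapDomain φ x = 0) :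
    MonoidAlgebra.single c 1 - 1 ∣ x := by
  let σ : Q' → Q := Function.invFun φ
  have hσ : ∀ q, φ (σ (φ q)) = φ q := fun q => Function.invFun_eq ⟨q, rfl⟩
  have key : ∀ y : MonoidAlgebra R Q, MonoidAlgebra.single c 1 - 1 ∣
      y - MonoidAlgebra.mapDomain σ (MonoidAlgebra.mapDomain φ y) := by
    intro y
    induction y using MonoidAlgebra.induction_linear with
    | zero => simp
    | add y z hy hz =>
      rw [MonoidAlgebra.mapDomain_add, MonoidAlgebra.mapDomain_add, add_sub_add_comm]
      exact dvd_add hy hz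
    | single q r =>
      have h1 : (σ (φ q))⁻¹ * q ∈ Subgroup.zpowers c := hc (by
        rw [MonoidHom.mem_ker, map_mul, map_inv, hσ, inv_mul_cancel])
      -- `σ` is a set-theoretic section, so `q` and `σ (φ q)` differ by an element of the kernel.
      -- Finiteness of `Q` makes it a power of `c` with natural exponent, and `c - 1` divides `c ^ i
      -- - 1`.
      obtain ⟨i, hi⟩ := mem_powers_iff_mem_zpowers.2 h1
      have h2 : q = σ (φ q) * c ^ i := by
        simp only at hi
        rw [hi, mul_inv_cancel_left]
      rw [MonoidAlgebra.mapDomain_single, MonoidAlgebra.mapDomain_single]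
      have h3 : MonoidAlgebra.single q r - MonoidAlgebra.single (σ (φ q)) r =
          MonoidAlgebra.single (σ (φ q)) r * (MonoidAlgebra.single c 1 ^ i - 1 ^ i) := by
        rw [one_pow, mul_sub, mul_one, MonoidAlgebra.single_pow, MonoidAlgebra.single_mul_single,
          ← h2, one_pow, mul_one]
      rw [h3]
      exact (sub_dvd_pow_sub_pow _ _ i).mul_left _
  have := key x
  rwa [hx, MonoidAlgebra.mapDomain_zero, sub_zero] at this

section Generator

variable {p : ℕ} [Fact p.Prime] {G H : Type*} [CommGroup G] [TopologicalSpace G]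
  [CommGroup H] [TopologicalSpace H]

variable (p) in
/-- The kernel of `π` is a free pro-`p` group of rank one, topologically generated by `γ`. -/
structure IsKerGenerator (π : G →ₜ* H) (γ : G) : Prop where
  map_eq_one : π γ = 1
  ker_le : ∀ V : OpenSubgroup G, γ ∈ V → π.toMonoidHom.ker ≤ V
  pow_mem : ∀ V : OpenSubgroup G, ∃ a, γ ^ p ^ a ∈ V
  exists_notMem : ∀ j, ∃ V : OpenSubgroup G, γ ^ p ^ j ∉ V

variable [IsTopologicalGroup G] {π : G →ₜ* H} {γ : G}

/-- The open subgroup generated by an open subgroup and an element. -/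
def adjoinElem (V : OpenSubgroup G) (g : G) : OpenSubgroup G :=
  ⟨(V : Subgroup G) ⊔ Subgroup.zpowers g, Subgroup.isOpen_mono le_sup_left V.isOpen⟩

lemma le_adjoinElem (V : OpenSubgroup G) (g : G) : V ≤ adjoinElem V g :=
  le_sup_left (a := (V : Subgroup G))

lemma mem_adjoinElem (V : OpenSubgroup G) (g : G) : g ∈ adjoinElem V g :=
  (le_sup_right (a := (V : Subgroup G)) : _) (Subgroup.mem_zpowers g)

lemma ker_map_adjoinElem_le (V : OpenSubgroup G) (g : G) :
    (QuotientGroup.map (V : Subgroup G) (adjoinElem V g : Subgroup G) (MonoidHom.id G)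
      (le_adjoinElem V g)).ker ≤ Subgroup.zpowers (g : G ⧸ (V : Subgroup G)) := by
  intro x hx
  obtain ⟨x, rfl⟩ := QuotientGroup.mk_surjective x
  have hx' : x ∈ (V : Subgroup G) ⊔ Subgroup.zpowers g := (QuotientGroup.eq_one_iff _).1 hx
  obtain ⟨v, hv, w, ⟨i, rfl⟩, rfl⟩ := Subgroup.mem_sup.1 hx'
  refine ⟨i, ?_⟩
  have : (v : G ⧸ (V : Subgroup G)) = 1 := (QuotientGroup.eq_one_iff _).2 hv
  simp [this]

variable [CompactSpace G]

/-- If `c ≡ 1` modulo `p`, then `γ - c` is regular modulo `p`. -/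
lemma IsKerGenerator.dvd_of_dvd_mul (hγ : IsKerGenerator p π γ) {c : ℤ_[p]}
    (hc : (p : ℤ_[p]) ∣ c - 1) {f : IwasawaAlgebra p G}
    (hf : (p : IwasawaAlgebra p G) ∣ (gp p γ - const c) * f) : (p : IwasawaAlgebra p G) ∣ f := by
  classical
  refine dvd_of_forall_coeff fun U q => ?_
  -- The coefficients at level `U` are computed through two finer levels: `V`, which does not
  -- contain `δ = γ ^ p ^ a`, and `V' = V ⟨δ⟩`, which still lies in `U`.
  obtain ⟨a, ha⟩ := hγ.pow_mem U
  obtain ⟨V₀, hV₀⟩ := hγ.exists_notMem a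
  set δ := γ ^ p ^ a with hδ
  let V := U ⊓ V₀
  let V' := adjoinElem V δ
  have hV'U : V' ≤ U := by
    change (V : Subgroup G) ⊔ Subgroup.zpowers δ ≤ (U : Subgroup G)
    exact sup_le (inf_le_left : V ≤ U) (by simpa using ha)
  set F := (proj p G V f).coeff with hF
  -- Since `c ≡ 1`, the coefficients at level `V` are invariant under `γ` modulo `p`.
  have hinv : ∀ x, (p : ℤ_[p]) ∣ F ((γ : G ⧸ (V : Subgroup G))⁻¹ * x) - F x := by
    intro x
    obtain ⟨g, hg⟩ := hf
    have h1 := congrArg (fun z => (proj p G V z).coeff x) hg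
    have h2 := coeff_proj_const_mul V p g x
    rw [map_natCast] at h2
    simp only [sub_mul, map_sub, MonoidAlgebra.coeff_sub, Finsupp.sub_apply, coeff_proj_gp_mul,
      coeff_proj_const_mul, h2] at h1
    have h3 : F ((γ : G ⧸ (V : Subgroup G))⁻¹ * x) - F x =
        p * (proj p G V g).coeff x + (c - 1) * F x := by
      rw [← h1]
      ring
    rw [h3]
    exact dvd_add (dvd_mul_right _ _) (hc.mul_right _)
  have hinvpow : ∀ (i : ℕ) x, (p : ℤ_[p]) ∣ F ((γ ^ i : G ⧸ (V : Subgroup G))⁻¹ * x) - F x := by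
    intro i
    induction i with
    | zero => simp
    | succ i ih =>
      intro x
      have h1 := hinv (((γ : G ⧸ (V : Subgroup G)) ^ i)⁻¹ * x)
      rw [← mul_assoc, ← mul_inv, ← pow_succ'] at h1
      have := dvd_add h1 (ih x)
      rwa [sub_add_sub_cancel] at this
  let φ := QuotientGroup.map (V : Subgroup G) (V' : Subgroup G) (MonoidHom.id G)
    (le_adjoinElem V δ)
  -- The kernel of `G/V → G/V'` contains the class of `δ`, which is nontrivial of `p`-power order.
  have hker : p ∣ Nat.card φ.ker := by
    have hmem : (δ : G ⧸ (V : Subgroup G)) ∈ φ.ker :=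
      (QuotientGroup.eq_one_iff _).2 (mem_adjoinElem V δ)
    obtain ⟨b, hb⟩ := hγ.pow_mem V
    let d : φ.ker := ⟨_, hmem⟩
    have hd1 : d ^ p ^ b = 1 := Subtype.ext (by
      change ((δ ^ p ^ b : G) : G ⧸ (V : Subgroup G)) = 1
      rw [QuotientGroup.eq_one_iff, hδ, ← pow_mul, mul_comm, pow_mul]
      exact _root_.pow_mem hb _)
    have hd2 : d ≠ 1 := fun h => hV₀ ((QuotientGroup.eq_one_iff _).1
      (congrArg Subtype.val h) : δ ∈ V).2
    obtain ⟨k, -, hk⟩ := (Nat.dvd_prime_pow Fact.out).1 (orderOf_dvd_of_pow_eq_one hd1)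
    have hk0 : k ≠ 0 := by
      rintro rfl
      exact hd2 (orderOf_eq_one_iff.1 (by simpa using hk))
    exact ((dvd_pow_self p hk0).trans (dvd_of_eq hk.symm)).trans (orderOf_dvd_natCard d)
  have hV' : ∀ q', (p : ℤ_[p]) ∣ (proj p G V' f).coeff q' := by
    intro q'
    have := Fintype.ofFinite (G ⧸ (V : Subgroup G))
    -- A coefficient at level `V'` is a sum over one coset of the kernel. The terms agree modulo `p`
    -- and their number is divisible by `p`.
    have h1 : (proj p G V' f).coeff q' = ∑ x, if φ x = q' then F x else 0 := by
      rw [← transition_proj (le_adjoinElem V δ) f]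
      exact coeff_mapDomain_apply _ _ _
    obtain ⟨x₀, rfl⟩ : ∃ x₀, φ x₀ = q' := by
      obtain ⟨g, rfl⟩ := QuotientGroup.mk_surjective q'
      exact ⟨(g : G ⧸ (V : Subgroup G)), rfl⟩
    have hcard : (Finset.univ.filter fun x => φ x = φ x₀).card = Nat.card φ.ker := by
      have h3 : (Finset.univ.filter fun x => φ x = φ x₀) =
          (Finset.univ.filter fun x => x ∈ φ.ker).map (Equiv.mulLeft x₀).toEmbedding := by
        ext x
        simp only [Finset.mem_filter, Finset.mem_univ, true_and, Finset.mem_map,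
          MonoidHom.mem_ker, Equiv.coe_toEmbedding, Equiv.coe_mulLeft]
        constructor
        · intro h
          exact ⟨x₀⁻¹ * x, by rw [map_mul, map_inv, h, inv_mul_cancel], by simp⟩
        · rintro ⟨y, hy, rfl⟩
          rw [map_mul, hy, mul_one]
      rw [h3, Finset.card_map, Nat.card_eq_fintype_card, Fintype.card_subtype]
    have h2 : ∑ x, (if φ x = φ x₀ then F x else 0) =
        (∑ x ∈ Finset.univ.filter (fun x => φ x = φ x₀), (F x - F x₀)) +
          (Nat.card φ.ker : ℤ_[p]) * F x₀ := by
      rw [← Finset.sum_filter, Finset.sum_sub_distrib, Finset.sum_const, hcard, nsmul_eq_mul]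
      ring
    rw [h1, h2]
    refine dvd_add (Finset.dvd_sum fun x hx => ?_) (Dvd.dvd.mul_right ?_ _)
    · have hx' : φ x = φ x₀ := (Finset.mem_filter.1 hx).2
      have h3 : x₀ * x⁻¹ ∈ Subgroup.zpowers (δ : G ⧸ (V : Subgroup G)) :=
        ker_map_adjoinElem_le V δ (by
          change φ (x₀ * x⁻¹) = 1
          rw [map_mul, map_inv, hx', mul_inv_cancel])
      obtain ⟨i, hi⟩ := mem_powers_iff_mem_zpowers.2 h3
      have h4 := hinvpow (p ^ a * i) x₀
      have h5 : (γ ^ (p ^ a * i) : G ⧸ (V : Subgroup G)) = x₀ * x⁻¹ := by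
        rw [← hi, hδ, pow_mul]
        rfl
      rwa [h5, mul_inv, inv_inv, mul_comm x₀⁻¹, inv_mul_cancel_right] at h4
    · obtain ⟨m, hm⟩ := hker
      exact ⟨m, by rw [hm, Nat.cast_mul]⟩
  rw [← transition_proj hV'U f]
  have := Fintype.ofFinite (G ⧸ (V' : Subgroup G))
  have h1 := coeff_mapDomain_apply (QuotientGroup.map (V' : Subgroup G) (U : Subgroup G)
    (MonoidHom.id G) hV'U) (proj p G V' f) q
  refine (Finset.dvd_sum fun x _ => ?_).trans (dvd_of_eq h1.symm)
  split_ifs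
  · exact hV' x
  · exact dvd_zero _

/-- An annihilated `f` is divisible by `p`, and since `p` is regular the quotient is annihilated as
well. Repeating, `f` is divisible by every power of `p`. -/
lemma IsKerGenerator.sub_const_mem_nonZeroDivisors (hγ : IsKerGenerator p π γ) {c : ℤ_[p]}
    (hc : (p : ℤ_[p]) ∣ c - 1) :
    gp p γ - const c ∈ nonZeroDivisors (IwasawaAlgebra p G) := by
  refine mem_nonZeroDivisors_iff_left.2 fun f hf => ?_
  have key : ∀ n : ℕ, ∃ g, f = p ^ n * g ∧ (gp p γ - const c) * g = 0 := by
    intro n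
    induction n with
    | zero => exact ⟨f, by simp, hf⟩
    | succ n ih =>
      obtain ⟨g, hg, hg0⟩ := ih
      obtain ⟨g', rfl⟩ := hγ.dvd_of_dvd_mul hc (hg0 ▸ dvd_zero _)
      refine ⟨g', by rw [hg]; ring, ?_⟩
      rw [mul_left_comm] at hg0
      exact (mul_right_mem_nonZeroDivisors_eq_zero_iff p_mem_nonZeroDivisors).1
        ((mul_comm _ _).trans hg0)
  refine eq_zero_of_forall_mem_span_pow f fun n => ?_
  obtain ⟨g, hg, -⟩ := key n
  exact Ideal.mem_span_singleton.2 ⟨g, hg⟩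

/-- At a level containing `γ ^ p ^ a`, the binomial expansion shows that `(γ - 1) ^ p ^ a` becomes
divisible by `p`. Hence high powers of `γ - 1` are `p`-adically small at each finite level. -/
lemma IsKerGenerator.separated (hγ : IsKerGenerator p π γ) (f : IwasawaAlgebra p G)
    (hf : ∀ n, f ∈ Ideal.span {(gp p γ - 1) ^ n}) : f = 0 := by
  refine ext_coeff fun U q => ?_
  rw [map_zero]
  refine eq_zero_of_forall_pow_dvd fun n => ?_
  obtain ⟨a, ha⟩ := hγ.pow_mem U
  obtain ⟨g, rfl⟩ := Ideal.mem_span_singleton.1 (hf (p ^ a * n))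
  obtain ⟨r, hr⟩ := exists_add_pow_prime_pow_eq (Fact.out (p := p.Prime)) (gp p γ - 1) 1 a
  have h1 : proj p G U (gp p γ ^ p ^ a) = 1 := by
    rw [map_pow, proj_gp, MonoidAlgebra.single_pow, one_pow, ← QuotientGroup.mk_pow,
      (QuotientGroup.eq_one_iff _).2 ha]
    rfl
  have h2 : proj p G U ((gp p γ - 1) ^ p ^ a) = proj p G U (p * -((gp p γ - 1) * r)) := by
    rw [sub_add_cancel, one_pow] at hr
    rw [hr] at h1
    simp only [map_add, map_one, map_mul, map_natCast] at h1
    simp only [map_mul, map_natCast, map_neg]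
    linear_combination h1
  have h3 : proj p G U ((gp p γ - 1) ^ (p ^ a * n) * g) =
      proj p G U (const (p ^ n) * ((-((gp p γ - 1) * r)) ^ n * g)) := by
    rw [pow_mul, map_mul, map_pow, h2, ← map_pow, ← map_mul]
    congr 1
    rw [map_pow, map_natCast, mul_pow, mul_assoc]
  rw [h3, coeff_proj_const_mul]
  exact dvd_mul_right _ _

variable {s : H →ₜ* G}

/-- At level `V`, pass to `V' = V ⟨γ⟩`. It contains the kernel of `π`, so `G/V'` embeds into a
finite quotient of `H`, where `f` vanishes; the kernel of `G/V → G/V'` is cyclic, generated by `γ`.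
Compactness combines the levels. -/
lemma IsKerGenerator.exists_of_map_eq_zero (hγ : IsKerGenerator p π γ) (hs : ∀ h, π (s h) = h)
    {f : IwasawaAlgebra p G} (hf : map p π f = 0) : ∃ g, (gp p γ - 1) * g = f := by
  refine exists_mul_eq_of_forall_proj _ _ fun V => ?_
  let V' := adjoinElem V γ
  have hle : π.toMonoidHom.ker ≤ V' := hγ.ker_le V' (mem_adjoinElem V γ)
  let W : OpenSubgroup H := V'.comap s.toMonoidHom s.continuous_toFun
  have hmem : ∀ g, g ∈ V' ↔ s (π g) ∈ V' := fun g => by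
    have h1 : g * (s (π g))⁻¹ ∈ V' := hle (by
      change π (g * (s (π g))⁻¹) = 1
      rw [map_mul, map_inv, hs, mul_inv_cancel])
    constructor
    · intro h
      simpa using mul_mem (inv_mem h1) h
    · intro h
      simpa using mul_mem h1 h
  have hW : V' ≤ W.comap π.toMonoidHom π.continuous_toFun := fun g hg => (hmem g).1 hg
  have h0 : proj p G V' f = 0 := by
    have h1 : mapLevel π V' W hW (proj p G V' f) = 0 := by
      rw [← proj_map, hf, map_zero]
    have hinj : Function.Injective (QuotientGroup.map (V' : Subgroup G) (W : Subgroup H)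
        π.toMonoidHom hW) := by
      rw [injective_iff_map_eq_one]
      intro x hx
      obtain ⟨x, rfl⟩ := QuotientGroup.mk_surjective x
      exact (QuotientGroup.eq_one_iff _).2 ((hmem x).2
        ((QuotientGroup.eq_one_iff (N := (W : Subgroup H)) (π x)).1 hx))
    refine MonoidAlgebra.mapDomain_injective hinj (h1.trans ?_)
    exact (MonoidAlgebra.mapDomain_zero _).symm
  obtain ⟨y, hy⟩ := sub_one_dvd_of_mapDomain_eq_zero _ (ker_map_adjoinElem_le V γ)
    ((transition_proj (le_adjoinElem V γ) f).trans h0)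
  obtain ⟨g, rfl⟩ := proj_surjective V y
  refine ⟨g, ?_⟩
  rw [hy, map_mul, map_sub, proj_gp, map_one]

lemma IsKerGenerator.ker_map (hγ : IsKerGenerator p π γ) (hs : ∀ h, π (s h) = h) :
    RingHom.ker (map p π) = Ideal.span {gp p γ - 1} := by
  ext f
  rw [RingHom.mem_ker, Ideal.mem_span_singleton]
  constructor
  · intro hf
    obtain ⟨g, rfl⟩ := hγ.exists_of_map_eq_zero hs hf
    exact dvd_mul_right _ _
  · rintro ⟨g, rfl⟩
    rw [map_mul, map_sub, map_gp, hγ.map_eq_one, gp_one, map_one, sub_self, zero_mul]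

end Generator

lemma IsKerGenerator.isRegularSemilocal {p : ℕ} [Fact p.Prime] {G H : Type u} [CommGroup G]
    [TopologicalSpace G] [IsTopologicalGroup G] [CompactSpace G] [CommGroup H]
    [TopologicalSpace H] {π : G →ₜ* H} {γ : G} {s : H →ₜ* G} (hγ : IsKerGenerator p π γ)
    (hs : ∀ h, π (s h) = h) (hH : DetFunctor.IsRegularSemilocal (IwasawaAlgebra p H)) :
    DetFunctor.IsRegularSemilocal (IwasawaAlgebra p G) := by
  refine hH.of_ker_eq_span (map p π) (fun f => ⟨_, map_map_of_rightInverse hs f⟩) ?_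
    (hγ.ker_map hs) hγ.separated
  have := hγ.sub_const_mem_nonZeroDivisors (c := 1) (by simp)
  rwa [map_one] at this

end Iwasawa

end

/-! ### Regularity of the Iwasawa algebra by induction on the rank. -/

noncomputable section

open TensorProduct CategoryTheory

namespace Iwasawa

section FiniteGroup

variable {p : ℕ} [Fact p.Prime]

/-- The group algebra over `𝔽_p` of a finite abelian group of order prime to `p` is semisimple. -/
lemma isRegularSemilocal_monoidAlgebra_zmod {Q : Type u} [CommGroup Q] [Finite Q]
    (hQ : (Nat.card Q).Coprime p) :
    DetFunctor.IsRegularSemilocal (MonoidAlgebra (ZMod p) Q) := by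
  have : NeZero (Nat.card Q : ZMod p) := ⟨fun h => by
    rw [ZMod.natCast_eq_zero_iff] at h
    exact (Fact.out (p := p.Prime)).one_lt.ne'
      (Nat.dvd_one.1 (hQ ▸ Nat.dvd_gcd h dvd_rfl))⟩
  have hfin : Finite (MonoidAlgebra (ZMod p) Q) :=
    Finite.of_equiv _ (MonoidAlgebra.coeffEquiv.trans Finsupp.equivFunOnFinite).symm
  refine ⟨inferInstance, Finite.of_injective
    (fun m : MaximalSpectrum (MonoidAlgebra (ZMod p) Q) =>
      (m.asIdeal : Set (MonoidAlgebra (ZMod p) Q)))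
    fun m n h => MaximalSpectrum.ext (SetLike.coe_injective h), fun M _ _ _ => ⟨0, ?_⟩⟩
  have : Module.Projective (MonoidAlgebra (ZMod p) Q) M := Module.projective_of_isSemisimpleRing _ _
  exact projective_iff_hasProjectiveDimensionLT_one.1
    ((IsProjective.iff_projective M).1 inferInstance)

variable {G : Type u} [CommGroup G] [TopologicalSpace G] [IsTopologicalGroup G]

attribute [local instance] coeffTopology compactSpace_monoidAlgebra t2Space_monoidAlgebra
  isTopologicalRing_monoidAlgebra compactSpace_iwasawaAlgebra

/-- Here the element divided out is `p`, and the quotient is the group algebra over `𝔽_p`,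
semisimple by Maschke's theorem. -/
lemma isRegularSemilocal_of_finite [DiscreteTopology G] [Finite G] (hG : (Nat.card G).Coprime p) :
    DetFunctor.IsRegularSemilocal (IwasawaAlgebra p G) := by
  let B : OpenSubgroup G := ⟨⊥, isOpen_discrete _⟩
  have hcard : Nat.card (G ⧸ (B : Subgroup G)) = Nat.card G := Subgroup.index_bot
  let f : IwasawaAlgebra p G →+* MonoidAlgebra (ZMod p) (G ⧸ (B : Subgroup G)) :=
    (MonoidAlgebra.mapRingHom _ PadicInt.toZMod).comp (proj p G B)
  have hf : Function.Surjective f :=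
    (MonoidAlgebra.map_surjective _ (ZMod.ringHom_surjective PadicInt.toZMod)).comp
      (proj_surjective B)
  have hmem : ∀ x : ℤ_[p], PadicInt.toZMod x = 0 ↔ (p : ℤ_[p]) ∣ x := fun x => by
    rw [← RingHom.mem_ker, PadicInt.ker_toZMod, PadicInt.maximalIdeal_eq_span_p,
      Ideal.mem_span_singleton]
  refine (isRegularSemilocal_monoidAlgebra_zmod (hcard ▸ hG)).of_ker_eq_span f hf
    p_mem_nonZeroDivisors ?_ eq_zero_of_forall_mem_span_pow
  ext x
  rw [RingHom.mem_ker, Ideal.mem_span_singleton]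
  constructor
  · intro hx
    -- The trivial subgroup `B` is open and is the finest level, so divisibility there passes to
    -- every `U`.
    refine dvd_of_forall_coeff fun U q => ?_
    have h1 : ∀ r, (p : ℤ_[p]) ∣ (proj p G B x).coeff r := fun r => by
      rw [← hmem]
      have := congrArg (fun y => y.coeff r) hx
      exact (MonoidAlgebra.coeff_mapRingHom _ _ _).symm.trans this
    classical
    have := Fintype.ofFinite (G ⧸ (B : Subgroup G))
    have hle : B ≤ U := (bot_le : (⊥ : Subgroup G) ≤ U)
    rw [← transition_proj hle x]
    refine (Finset.dvd_sum fun r _ => ?_).trans (dvd_of_eq (coeff_mapDomain_apply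
      (QuotientGroup.map (B : Subgroup G) (U : Subgroup G) (MonoidHom.id G) hle)
      (proj p G B x) q).symm)
    split_ifs
    · exact h1 r
    · exact dvd_zero _
  · rintro ⟨y, rfl⟩
    rw [map_mul, map_natCast]
    have : ((p : ℕ) : MonoidAlgebra (ZMod p) (G ⧸ (B : Subgroup G))) = 0 := by
      rw [MonoidAlgebra.natCast_def, CharP.cast_eq_zero, MonoidAlgebra.single_zero]
    rw [this, zero_mul]

end FiniteGroup

section Structure

variable {p : ℕ} [Fact p.Prime] {G H : Type*} [CommGroup G] [TopologicalSpace G]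
  [CommGroup H] [TopologicalSpace H] {π : G →ₜ* H}

/-- Density of `ℕ` in `ℤ_p` shows that an open subgroup containing `ψ(1)` contains the image of `ψ`.
Also `p ^ n → 0`, and pulling back `p ^ (j + 1) ℤ_p` along `τ` gives an open subgroup without `ψ(1)
^ p ^ j`. -/
lemma isKerGenerator_of_retract [IsTopologicalGroup G] (ψ : Multiplicative ℤ_[p] →ₜ* G)
    (τ : G →ₜ* Multiplicative ℤ_[p])
    (hτ : ∀ z, τ (ψ z) = z) (hπ : ∀ z, π (ψ z) = 1) (hker : ∀ g, π g = 1 → ∃ z, ψ z = g) :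
    IsKerGenerator p π (ψ (.ofAdd 1)) := by
  have hpow : ∀ n : ℕ, ψ (.ofAdd 1) ^ n = ψ (.ofAdd (n : ℤ_[p])) := fun n => by
    rw [← map_pow, ← ofAdd_nsmul, nsmul_one]
  have hcont : Continuous fun z : ℤ_[p] => ψ (.ofAdd z) := ψ.continuous_toFun
  refine ⟨hπ _, fun V hV g hg => ?_, fun V => ?_, fun j => ?_⟩
  · obtain ⟨z, rfl⟩ := hker g hg
    have hcl : IsClosed {z : ℤ_[p] | ψ (.ofAdd z) ∈ V} := V.isClosed.preimage hcont
    have huniv : {z : ℤ_[p] | ψ (.ofAdd z) ∈ V} = Set.univ := by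
      refine hcl.closure_eq.symm.trans (Dense.closure_eq
        (PadicInt.denseRange_natCast.mono ?_))
      rintro _ ⟨n, rfl⟩
      change ψ (.ofAdd (n : ℤ_[p])) ∈ V
      rw [← hpow]
      exact pow_mem hV n
    exact huniv.ge (Set.mem_univ z.toAdd)
  · have h1 : Filter.Tendsto (fun n : ℕ => (p : ℤ_[p]) ^ n) Filter.atTop (nhds 0) :=
      tendsto_pow_atTop_nhds_zero_of_norm_lt_one (by
        rw [PadicInt.norm_p]
        exact inv_lt_one_of_one_lt₀ (Nat.one_lt_cast.2 (Fact.out (p := p.Prime)).one_lt))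
    have h2 : {z : ℤ_[p] | ψ (.ofAdd z) ∈ V} ∈ nhds 0 :=
      (V.isOpen.preimage hcont).mem_nhds (by
        change ψ 1 ∈ V
        rw [map_one]
        exact one_mem V)
    obtain ⟨a, ha⟩ := (h1.eventually h2).exists
    refine ⟨a, ?_⟩
    rw [hpow, Nat.cast_pow]
    exact ha
  · let S : AddSubgroup ℤ_[p] := (Ideal.span {(p : ℤ_[p]) ^ (j + 1)}).toAddSubgroup
    have hS : IsOpen (S : Set ℤ_[p]) := by
      have : (S : Set ℤ_[p]) = {x | ‖x‖ < (p : ℝ) ^ (-((j + 1 : ℕ) : ℤ) + 1)} := by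
        ext x
        rw [Set.mem_ofPred_eq, PadicInt.norm_lt_pow_iff_norm_le_pow_sub_one,
          add_sub_cancel_right, PadicInt.norm_le_pow_iff_mem_span_pow]
        rfl
      rw [this]
      exact isOpen_lt continuous_norm continuous_const
    let V : OpenSubgroup (Multiplicative ℤ_[p]) := ⟨AddSubgroup.toSubgroup S, hS⟩
    refine ⟨V.comap τ.toMonoidHom τ.continuous_toFun, fun h => ?_⟩
    have h1 : τ (ψ (.ofAdd 1) ^ p ^ j) ∈ V := h
    rw [hpow, hτ] at h1
    have h2 : ((p ^ j : ℕ) : ℤ_[p]) ∈ Ideal.span {(p : ℤ_[p]) ^ (j + 1)} := h1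
    rw [Ideal.mem_span_singleton, Nat.cast_pow] at h2
    have h3 := (pow_dvd_pow_iff (Nat.cast_ne_zero.2 (Fact.out (p := p.Prime)).ne_zero)
      PadicInt.prime_p.not_isUnit).1 h2
    omega

/-- In each finite quotient `γ` has `p`-power order, so `γ` and `γ ^ m` generate the same subgroup.
The case `m = p - 1` is used to make values of characters congruent to `1` modulo `p`. -/
lemma IsKerGenerator.pow {γ : G} (hγ : IsKerGenerator p π γ) {m : ℕ} (hm : m.Coprime p) :
    IsKerGenerator p π (γ ^ m) := by
  have hgcd : ∀ (V : OpenSubgroup G) (a b : ℕ), γ ^ a ∈ V → γ ^ b ∈ V → γ ^ a.gcd b ∈ V := by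
    intro V a b ha hb
    have ha' : (γ : G ⧸ (V : Subgroup G)) ^ a = 1 := (QuotientGroup.eq_one_iff _).2 ha
    have hb' : (γ : G ⧸ (V : Subgroup G)) ^ b = 1 := (QuotientGroup.eq_one_iff _).2 hb
    exact (QuotientGroup.eq_one_iff (N := (V : Subgroup G)) _).1
      (pow_gcd_eq_one.2 ⟨ha', hb'⟩)
  refine ⟨by rw [map_pow, hγ.map_eq_one, one_pow], fun V hV => hγ.ker_le V ?_, fun V => ?_,
    fun j => ?_⟩
  · obtain ⟨a, ha⟩ := hγ.pow_mem V
    have := hgcd V _ _ hV ha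
    rwa [Nat.Coprime.gcd_eq_one (hm.pow_right a), pow_one] at this
  · obtain ⟨a, ha⟩ := hγ.pow_mem V
    refine ⟨a, ?_⟩
    rw [← pow_mul, mul_comm, pow_mul]
    exact _root_.pow_mem ha m
  · obtain ⟨V, hV⟩ := hγ.exists_notMem j
    refine ⟨V, fun h => hV ?_⟩
    obtain ⟨a, ha⟩ := hγ.pow_mem V
    rw [← pow_mul] at h
    have h1 : γ ^ (p ^ a * p ^ j) ∈ V := by
      rw [pow_mul]
      exact _root_.pow_mem ha _
    have := hgcd V _ _ h h1
    rwa [Nat.gcd_mul_right, Nat.Coprime.gcd_eq_one (hm.pow_right a), one_mul] at this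

variable {Δ : Type*} [CommGroup Δ] [TopologicalSpace Δ]

lemma exists_isKerGenerator [IsTopologicalGroup G] {k : ℕ}
    (e : G ≃ₜ* Multiplicative (Fin (k + 1) → ℤ_[p]) × Δ) :
    ∃ (π : G →ₜ* Multiplicative (Fin k → ℤ_[p]) × Δ)
      (s : Multiplicative (Fin k → ℤ_[p]) × Δ →ₜ* G) (γ : G),
      (∀ h, π (s h) = h) ∧ IsKerGenerator p π γ := by
  let π₀ : Multiplicative (Fin (k + 1) → ℤ_[p]) × Δ →ₜ* Multiplicative (Fin k → ℤ_[p]) × Δ :=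
    { toFun := fun x => (.ofAdd fun i => x.1.toAdd i.succ, x.2)
      map_one' := rfl
      map_mul' := fun _ _ => rfl
      continuous_toFun := by
        refine Continuous.prodMk ?_ continuous_snd
        exact continuous_pi fun i => (continuous_apply i.succ).comp continuous_fst }
  let s₀ : Multiplicative (Fin k → ℤ_[p]) × Δ →ₜ* Multiplicative (Fin (k + 1) → ℤ_[p]) × Δ :=
    { toFun := fun x => (.ofAdd (Fin.cons 0 x.1.toAdd), x.2)
      map_one' := Prod.ext (funext fun i => by refine Fin.cases rfl (fun _ => rfl) i) rfl
      map_mul' := fun x y => Prod.ext (funext fun i => by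
        refine Fin.cases ?_ (fun _ => rfl) i
        exact (add_zero (0 : ℤ_[p])).symm) rfl
      continuous_toFun := by
        refine Continuous.prodMk ?_ continuous_snd
        refine continuous_pi fun i => ?_
        refine Fin.cases ?_ (fun j => ?_) i
        · exact continuous_const
        · exact (continuous_apply j).comp continuous_fst }
  let ψ₀ : Multiplicative ℤ_[p] →ₜ* Multiplicative (Fin (k + 1) → ℤ_[p]) × Δ :=
    { toFun := fun z => (.ofAdd (Fin.cons z.toAdd 0), 1)
      map_one' := Prod.ext (funext fun i => by refine Fin.cases rfl (fun _ => rfl) i) rfl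
      map_mul' := fun x y => Prod.ext (funext fun i => by
        refine Fin.cases rfl (fun _ => ?_) i
        exact (add_zero (0 : ℤ_[p])).symm) (mul_one _).symm
      continuous_toFun := by
        refine Continuous.prodMk ?_ continuous_const
        refine continuous_pi fun i => ?_
        refine Fin.cases ?_ (fun j => ?_) i
        · exact continuous_id
        · exact continuous_const }
  let τ₀ : Multiplicative (Fin (k + 1) → ℤ_[p]) × Δ →ₜ* Multiplicative ℤ_[p] :=
    { toFun := fun x => .ofAdd (x.1.toAdd 0)
      map_one' := rfl
      map_mul' := fun _ _ => rfl
      continuous_toFun := (continuous_apply 0).comp continuous_fst }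
  let e₁ : G →ₜ* Multiplicative (Fin (k + 1) → ℤ_[p]) × Δ := e
  let e₂ : Multiplicative (Fin (k + 1) → ℤ_[p]) × Δ →ₜ* G := e.symm
  have h12 : ∀ x, e₁ (e₂ x) = x := e.apply_symm_apply
  have h21 : ∀ x, e₂ (e₁ x) = x := e.symm_apply_apply
  refine ⟨π₀.comp e₁, e₂.comp s₀, _, fun h => ?_,
    isKerGenerator_of_retract (e₂.comp ψ₀) (τ₀.comp e₁) (fun z => ?_) (fun z => ?_)
      fun g hg => ?_⟩
  · change π₀ (e₁ (e₂ (s₀ h))) = h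
    rw [h12]
    rfl
  · change τ₀ (e₁ (e₂ (ψ₀ z))) = z
    rw [h12]
    rfl
  · change π₀ (e₁ (e₂ (ψ₀ z))) = 1
    rw [h12]
    rfl
  · refine ⟨τ₀ (e₁ g), ?_⟩
    change e₂ (ψ₀ (τ₀ (e₁ g))) = g
    rw [← h21 g]
    congr 1
    rw [h12]
    have hg' : π₀ (e₁ g) = 1 := hg
    refine Prod.ext (funext fun i => ?_) (congrArg Prod.snd hg').symm
    refine Fin.cases rfl (fun j => ?_) i
    exact (congrFun (congrArg Prod.fst hg') j).symm

end Structure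

/-- Splitting off one coordinate presents the algebra for `k` as the quotient of the one for `k + 1`
by `γ - 1`; the induction starts from a finite group of order prime to `p`. -/
lemma isRegularSemilocal_iwasawaAlgebra {p : ℕ} [Fact p.Prime] {Δ : Type u} [CommGroup Δ]
    [Finite Δ] [TopologicalSpace Δ] [DiscreteTopology Δ] (hΔ : (Nat.card Δ).Coprime p) (k : ℕ)
    {G : Type u} [CommGroup G] [TopologicalSpace G] [IsTopologicalGroup G]
    (e : G ≃ₜ* Multiplicative (Fin k → ℤ_[p]) × Δ) :
    DetFunctor.IsRegularSemilocal (IwasawaAlgebra p G) := by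
  induction k generalizing G with
  | zero =>
    have : Finite (Multiplicative (Fin 0 → ℤ_[p])) := inferInstanceAs (Finite (Fin 0 → ℤ_[p]))
    have : DiscreteTopology (Multiplicative (Fin 0 → ℤ_[p])) :=
      inferInstanceAs (DiscreteTopology (Fin 0 → ℤ_[p]))
    have h1 : Finite G := Finite.of_equiv _ e.toEquiv.symm
    have h2 : DiscreteTopology G := e.toHomeomorph.symm.discreteTopology
    refine isRegularSemilocal_of_finite ?_
    have h3 : Nat.card (Multiplicative (Fin 0 → ℤ_[p])) = 1 :=
      Nat.card_unique (α := Fin 0 → ℤ_[p])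
    rwa [Nat.card_congr e.toEquiv, Nat.card_prod, h3, one_mul]
  | succ k ih =>
    obtain ⟨π, s, γ, hs, hγ⟩ := exists_isKerGenerator e
    have : CompactSpace (Multiplicative (Fin (k + 1) → ℤ_[p])) :=
      inferInstanceAs (CompactSpace (Fin (k + 1) → ℤ_[p]))
    have : CompactSpace G := e.toHomeomorph.symm.compactSpace
    exact hγ.isRegularSemilocal hs (ih (ContinuousMulEquiv.refl _))

end Iwasawa

end

/-! ### Twisted evaluation and division by `γ - c`. -/

noncomputable section

open TensorProduct CategoryTheory

namespace Iwasawa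

attribute [local instance] coeffTopology compactSpace_monoidAlgebra t2Space_monoidAlgebra
  isTopologicalRing_monoidAlgebra compactSpace_iwasawaAlgebra

section Evaluation

variable {p : ℕ} [Fact p.Prime] {G H : Type*} [CommGroup G] [TopologicalSpace G]
  [CommGroup H] [TopologicalSpace H] {π : G →ₜ* H} {s : H →ₜ* G} {γ : G}

/-- The homomorphism `g ↦ χ(g) π(g)` with values in the group algebra of `H / W` over `ℤ / p ^ n`. -/
def evalGroup (π : G →ₜ* H) (χ : G →ₜ* ℤ_[p]ˣ) (W : OpenSubgroup H) (n : ℕ) :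
    G →* MonoidAlgebra (ZMod (p ^ n)) (H ⧸ (W : Subgroup H)) :=
  MonoidAlgebra.singleHom.comp
    ((charMod χ n).prod ((QuotientGroup.mk' (W : Subgroup H)).comp π.toMonoidHom))

/-- The finite level at which `evalGroup` factors. -/
def evalLevel (π : G →ₜ* H) (χ : G →ₜ* ℤ_[p]ˣ) (W : OpenSubgroup H) (n : ℕ) : OpenSubgroup G :=
  charKer χ n ⊓ W.comap π.toMonoidHom π.continuous_toFun

lemma evalGroup_eq_one (π : G →ₜ* H) (χ : G →ₜ* ℤ_[p]ˣ) (W : OpenSubgroup H) (n : ℕ) {g : G}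
    (hg : g ∈ evalLevel π χ W n) : evalGroup π χ W n g = 1 := by
  have h1 : charMod χ n g = 1 := congrArg Units.val hg.1
  have h2 : ((π g : H) : H ⧸ (W : Subgroup H)) = 1 := (QuotientGroup.eq_one_iff _).2 hg.2
  change MonoidAlgebra.single ((π g : H) : H ⧸ (W : Subgroup H)) (charMod χ n g) = 1
  rw [h1, h2]
  rfl

/-- The homomorphism of finite level group algebras extending `g ↦ χ(g) π(g)`. -/
def evalLevelHom (π : G →ₜ* H) (χ : G →ₜ* ℤ_[p]ˣ) (W : OpenSubgroup H) (n : ℕ) :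
    MonoidAlgebra ℤ_[p] (G ⧸ (evalLevel π χ W n : Subgroup G)) →+*
      MonoidAlgebra (ZMod (p ^ n)) (H ⧸ (W : Subgroup H)) :=
  MonoidAlgebra.liftNCRingHom
    (MonoidAlgebra.singleOneRingHom.comp (PadicInt.toZModPow (p := p) n))
    (QuotientGroup.lift _ (evalGroup π χ W n) fun _ h => evalGroup_eq_one π χ W n h)
    fun _ _ => Commute.all _ _

lemma evalLevelHom_single (π : G →ₜ* H) (χ : G →ₜ* ℤ_[p]ˣ) (W : OpenSubgroup H) (n : ℕ) (g : G)
    (c : ℤ_[p]) :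
    evalLevelHom π χ W n (MonoidAlgebra.single (g : G ⧸ (evalLevel π χ W n : Subgroup G)) c) =
      MonoidAlgebra.single ((π g : H) : H ⧸ (W : Subgroup H))
        (PadicInt.toZModPow n (c * ((χ g : ℤ_[p]ˣ) : ℤ_[p]))) := by
  refine (MonoidAlgebra.liftNC_single _ _ _ _).trans ?_
  change MonoidAlgebra.single 1 (PadicInt.toZModPow n c) *
    MonoidAlgebra.single ((π g : H) : H ⧸ (W : Subgroup H))
      (PadicInt.toZModPow n (χ g : ℤ_[p]ˣ)) = _
  rw [MonoidAlgebra.single_mul_single, one_mul, map_mul]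

/-- The ideal generated by `γ - χ(γ)` meets the Iwasawa algebra of `H` trivially. -/
lemma eq_zero_of_map_eq_mul (hs : ∀ h, π (s h) = h) (hγ : π γ = 1) (χ : G →ₜ* ℤ_[p]ˣ)
    (hχ : ∀ h, χ (s h) = 1) {f : IwasawaAlgebra p H} {g : IwasawaAlgebra p G}
    (hfg : map p s f = (gp p γ - const (χ γ : ℤ_[p]ˣ)) * g) : f = 0 := by
  refine ext_coeff fun W q => ?_
  rw [map_zero]
  refine eq_zero_of_forall_pow_dvd fun n => ?_
  let U := evalLevel π χ W n
  have hle : W ≤ U.comap s.toMonoidHom s.continuous_toFun := fun h hh =>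
    ⟨Units.ext (by
      change PadicInt.toZModPow (p := p) n (χ (s h) : ℤ_[p]ˣ) = 1
      rw [hχ, Units.val_one, map_one]), by
      change π (s h) ∈ W
      rwa [hs]⟩
  -- As `χ` is trivial on `s(H)`, the evaluation `g ↦ χ(g) π(g)` restricts to reduction modulo `p ^
  -- n` on `Λ(H)`, while it kills `γ - χ(γ)`. So every coefficient of `f` is divisible by `p ^ n`.
  have hcomp : (evalLevelHom π χ W n).comp (mapLevel s W U hle) =
      MonoidAlgebra.mapRingHom _ (PadicInt.toZModPow (p := p) n) := by
    have key : ∀ (h : H) (c : ℤ_[p]), evalLevelHom π χ W n (mapLevel s W U hle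
        (MonoidAlgebra.single (h : H ⧸ (W : Subgroup H)) c)) =
        MonoidAlgebra.single (h : H ⧸ (W : Subgroup H)) (PadicInt.toZModPow n c) := fun h c => by
      rw [mapLevel_single, evalLevelHom_single, hs, hχ, Units.val_one, mul_one]
    apply MonoidAlgebra.ringHom_ext
    · intro c
      exact (key 1 c).trans (MonoidAlgebra.mapRingHom_single _ _ _).symm
    · intro x
      obtain ⟨h, rfl⟩ := QuotientGroup.mk_surjective x
      exact (key h 1).trans (MonoidAlgebra.mapRingHom_single _ _ _).symm
  have h0 : evalLevelHom π χ W n (proj p G U (gp p γ - const (χ γ : ℤ_[p]ˣ))) = 0 := by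
    rw [map_sub, proj_gp, proj_const, map_sub, evalLevelHom_single, hγ]
    have := evalLevelHom_single π χ W n 1 (χ γ : ℤ_[p]ˣ)
    rw [map_one, map_one, Units.val_one, mul_one] at this
    rw [one_mul, sub_eq_zero]
    exact this.symm
  have h1 := RingHom.congr_fun hcomp (proj p H W f)
  rw [RingHom.comp_apply, ← proj_map, hfg, map_mul, map_mul, h0, zero_mul] at h1
  have h2 : PadicInt.toZModPow n ((proj p H W f).coeff q) = 0 :=
    (MonoidAlgebra.coeff_mapRingHom _ _ _).symm.trans
      (congrArg (fun y => y.coeff q) h1.symm)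
  rwa [← RingHom.mem_ker, PadicInt.ker_toZModPow, Ideal.mem_span_singleton] at h2

variable [IsTopologicalGroup G] [CompactSpace G] [IsTopologicalGroup H] [CompactSpace H]

/-- Division by `γ - c`, for `c ≡ 1` modulo `p`. -/
lemma IsKerGenerator.exists_eq_add_mul (hγ : IsKerGenerator p π γ) (hs : ∀ h, π (s h) = h)
    {c : ℤ_[p]} (hc : (p : ℤ_[p]) ∣ c - 1) (f : IwasawaAlgebra p G) :
    ∃ (h : IwasawaAlgebra p H) (g : IwasawaAlgebra p G),
      f = map p s h + (gp p γ - const c) * g := by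
  obtain ⟨d, hd⟩ := hc
  -- Division by `γ - 1` is possible because it generates the kernel of `map p π`. Replacing `1` by
  -- `c` costs a multiple of `p`, which is divided again; compactness provides the limit.
  have step : ∀ f : IwasawaAlgebra p G, ∃ (h : IwasawaAlgebra p H) (g f' : IwasawaAlgebra p G),
      f = map p s h + (gp p γ - const c) * g + (p : IwasawaAlgebra p G) * f' := by
    intro f
    obtain ⟨g, hg⟩ := hγ.exists_of_map_eq_zero hs (f := f - map p s (map p π f)) (by
      rw [map_sub, map_map_of_rightInverse hs, sub_self])
    refine ⟨map p π f, g, const d * g, ?_⟩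
    have h1 : (const c : IwasawaAlgebra p G) = 1 + (p : IwasawaAlgebra p G) * const d := by
      rw [← map_natCast (const (p := p) (G := G)) p, ← map_mul, ← hd, map_sub, map_one]
      ring
    rw [h1]
    linear_combination -hg
  have iter : ∀ (n : ℕ) (f : IwasawaAlgebra p G), ∃ (h : IwasawaAlgebra p H) (g f' : IwasawaAlgebra p G),
      f = map p s h + (gp p γ - const c) * g + (p : IwasawaAlgebra p G) ^ n * f' := by
    intro n
    induction n with
    | zero => exact fun f => ⟨0, 0, f, by simp⟩
    | succ n ih =>
      intro f
      obtain ⟨h, g, f', hf⟩ := ih f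
      obtain ⟨h', g', f'', hf'⟩ := step f'
      refine ⟨h + (p : IwasawaAlgebra p H) ^ n * h', g + (p : IwasawaAlgebra p G) ^ n * g', f'', ?_⟩
      rw [hf, hf', map_add, map_mul, map_pow, map_natCast]
      ring
  let K : ℕ → Set (IwasawaAlgebra p H × IwasawaAlgebra p G) := fun n =>
    {x | f - (map p s x.1 + (gp p γ - const c) * x.2) ∈
      Ideal.span {(p : IwasawaAlgebra p G) ^ n}}
  have hcl : ∀ n, IsClosed (K n) := fun n => by
    refine (DetFunctor.isClosed_span_singleton ((p : IwasawaAlgebra p G) ^ n)).preimage ?_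
    exact continuous_const.sub (((continuous_map s).comp continuous_fst).add
      (continuous_const.mul continuous_snd))
  obtain ⟨x, hx⟩ := IsCompact.nonempty_iInter_of_sequence_nonempty_isCompact_isClosed K
    (fun n x hx => Ideal.span_singleton_le_span_singleton.2 (pow_dvd_pow _ n.le_succ) hx)
    (fun n => by
      obtain ⟨h, g, f', hf⟩ := iter n f
      refine ⟨(h, g), Ideal.mem_span_singleton.2 ⟨f', ?_⟩⟩
      change f - (map p s h + (gp p γ - const c) * g) = _
      rw [← sub_eq_zero, hf]
      ring)
    (hcl 0).isCompact hcl
  exact ⟨x.1, x.2, sub_eq_zero.1 (eq_zero_of_forall_mem_span_pow _ fun n =>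
    Set.mem_iInter.1 hx n)⟩

/-- If `x ∈ Λ(H)` is regular, then it is regular modulo `γ - χ(γ)`. -/
lemma IsKerGenerator.regular_mod (hγ : IsKerGenerator p π γ) (hs : ∀ h, π (s h) = h)
    (χ : G →ₜ* ℤ_[p]ˣ) (hχ : ∀ h, χ (s h) = 1) (hc : (p : ℤ_[p]) ∣ (χ γ : ℤ_[p]ˣ) - 1)
    {x : IwasawaAlgebra p H} (hx : x ∈ nonZeroDivisors (IwasawaAlgebra p H))
    {a b : IwasawaAlgebra p G}
    (hab : map p s x * a = (gp p γ - const (χ γ : ℤ_[p]ˣ)) * b) :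
    ∃ d, a = (gp p γ - const (χ γ : ℤ_[p]ˣ)) * d := by
  obtain ⟨h, g, rfl⟩ := hγ.exists_eq_add_mul hs hc a
  have h1 : map p s (x * h) = (gp p γ - const (χ γ : ℤ_[p]ˣ)) * (b - map p s x * g) := by
    rw [map_mul]
    linear_combination hab
  have h2 := eq_zero_of_map_eq_mul hs hγ.map_eq_one χ hχ h1
  have h3 : h = 0 := mem_nonZeroDivisors_iff_left.1 hx h h2
  exact ⟨g, by rw [h3, map_zero, zero_add]⟩

end Evaluation

/-! ### The annihilator of `ℤ_p(r)`. -/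

section Twist

variable {p : ℕ} [Fact p.Prime] {G : Type u} [CommGroup G] [TopologicalSpace G]

lemma toZModPow_charHom (χ : G →ₜ* ℤ_[p]ˣ) (n : ℕ) (f : IwasawaAlgebra p G) :
    PadicInt.toZModPow n (charHom χ f) = charHomMod χ n f :=
  RingHom.congr_fun (PadicInt.lift_spec (fun m n h => charHomMod_compat χ m n h) n) f

lemma charHom_gp (χ : G →ₜ* ℤ_[p]ˣ) (g : G) : charHom χ (gp p g) = (χ g : ℤ_[p]ˣ) := by
  refine PadicInt.ext_of_toZModPow.1 fun n => ?_
  rw [toZModPow_charHom, charHomMod, RingHom.comp_apply, proj_gp]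
  refine (MonoidAlgebra.liftNC_single _ _ _ _).trans ?_
  rw [AddMonoidHom.coe_coe, map_one, one_mul]
  rfl

lemma charHom_const (χ : G →ₜ* ℤ_[p]ˣ) (c : ℤ_[p]) : charHom χ (const c) = c := by
  refine PadicInt.ext_of_toZModPow.1 fun n => ?_
  rw [toZModPow_charHom, charHomMod, RingHom.comp_apply, proj_const]
  refine (MonoidAlgebra.liftNC_single _ _ _ _).trans ?_
  rw [map_one, mul_one]
  rfl

lemma finite_tateTwist (κ : G →ₜ* ℤ_[p]ˣ) (r : ℤ) :
    Module.Finite (IwasawaAlgebra p G) (TateTwist κ r) := by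
  refine Module.Finite.of_surjective
    (LinearMap.toSpanSingleton (IwasawaAlgebra p G) (TateTwist κ r) (ULift.up 1 : ULift ℤ_[p]))
    fun z => ⟨const (ULift.down (show ULift ℤ_[p] from z)), ?_⟩
  refine ULift.ext _ _ ?_
  change charHom (κ ^ r) (const _) * 1 = _
  rw [charHom_const, mul_one]

lemma ker_charHom_le_annihilator (κ : G →ₜ* ℤ_[p]ˣ) (r : ℤ) :
    RingHom.ker (charHom (κ ^ r)) ≤ Module.annihilator (IwasawaAlgebra p G) (TateTwist κ r) := by
  intro x hx
  rw [Module.mem_annihilator]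
  intro z
  refine ULift.ext _ _ ?_
  change charHom (κ ^ r) x * _ = 0
  rw [(RingHom.mem_ker).1 hx, zero_mul]

lemma dvd_pow_sub_one (u : ℤ_[p]ˣ) : (p : ℤ_[p]) ∣ ((u ^ (p - 1) : ℤ_[p]ˣ) : ℤ_[p]) - 1 := by
  rw [← Ideal.mem_span_singleton, ← PadicInt.maximalIdeal_eq_span_p, ← PadicInt.ker_toZMod,
    RingHom.mem_ker, map_sub, map_one, sub_eq_zero, Units.val_pow_eq_pow_val, map_pow]
  exact ZMod.pow_card_sub_one_eq_one (u.isUnit.map _).ne_zero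

/-- Rank at least two provides a generator `δ` of one factor `ℤ_p` and a generator `δ'` of a second
one inside the complement `H`. The elements `δ - χ(δ)` and `s(δ') - χ(s(δ'))` lie in the kernel of
`χ` and form a regular sequence. -/
lemma one_lt_height_of_ker_charHom_le {Δ : Type*} [CommGroup Δ] [Finite Δ] [TopologicalSpace Δ]
    [DiscreteTopology Δ] [IsTopologicalGroup G] [IsNoetherianRing (IwasawaAlgebra p G)] {k : ℕ}
    (e : G ≃ₜ* Multiplicative (Fin (k + 2) → ℤ_[p]) × Δ) (χ : G →ₜ* ℤ_[p]ˣ)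
    (q : Ideal (IwasawaAlgebra p G)) [q.IsPrime] (hq : RingHom.ker (charHom χ) ≤ q) :
    1 < q.height := by
  obtain ⟨π, s, γ, hs, hγ⟩ := exists_isKerGenerator e
  obtain ⟨π', -, γ', -, hγ'⟩ := exists_isKerGenerator
    (ContinuousMulEquiv.refl (Multiplicative (Fin (k + 1) → ℤ_[p]) × Δ))
  have : CompactSpace (Multiplicative (Fin (k + 1) → ℤ_[p])) :=
    inferInstanceAs (CompactSpace (Fin (k + 1) → ℤ_[p]))
  have : CompactSpace (Multiplicative (Fin (k + 2) → ℤ_[p])) :=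
    inferInstanceAs (CompactSpace (Fin (k + 2) → ℤ_[p]))
  have : CompactSpace G := e.toHomeomorph.symm.compactSpace
  have hp : (p - 1).Coprime p :=
    (Nat.coprime_self_sub_left (Fact.out (p := p.Prime)).one_lt.le).2 (Nat.coprime_one_left p)
  -- By Fermat, `(p - 1)`-st powers have character values congruent to `1` modulo `p`, as the
  -- division argument requires.
  replace hγ := hγ.pow hp
  replace hγ' := hγ'.pow hp
  set δ := γ ^ (p - 1)
  set δ' := γ' ^ (p - 1)
  -- Dividing out the part of `χ` coming from `H` makes it trivial on `s(H)` and leaves its value at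
  -- `δ` unchanged, since `π(δ) = 1`.
  let χ' : G →ₜ* ℤ_[p]ˣ := χ / (χ.comp (s.comp π))
  have hχ' : ∀ h, χ' (s h) = 1 := fun h => by
    change χ (s h) / χ (s (π (s h))) = 1
    rw [hs, div_self']
  have hχδ : χ' δ = χ δ := by
    change χ δ / χ (s (π δ)) = χ δ
    rw [hγ.map_eq_one, map_one, map_one, div_one]
  have hc : (p : ℤ_[p]) ∣ (χ δ : ℤ_[p]ˣ) - 1 := by
    rw [map_pow]
    exact dvd_pow_sub_one _
  have hc' : (p : ℤ_[p]) ∣ (χ (s δ') : ℤ_[p]ˣ) - 1 := by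
    rw [map_pow, map_pow]
    exact dvd_pow_sub_one _
  refine DetFunctor.one_lt_height_of_regular q (x := gp p δ - const (χ δ : ℤ_[p]ˣ))
    (y := map p s (gp p δ' - const (χ (s δ') : ℤ_[p]ˣ))) (hq ?_) (hq ?_)
    (hγ.sub_const_mem_nonZeroDivisors hc) fun a b hab => ?_
  · rw [RingHom.mem_ker, map_sub, charHom_gp, charHom_const, sub_self]
  · rw [RingHom.mem_ker, map_sub, map_gp, map_const, map_sub, charHom_gp, charHom_const, sub_self]
  · have := hγ.regular_mod hs χ' hχ' (hχδ.symm ▸ hc) (hγ'.sub_const_mem_nonZeroDivisors hc')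
      (a := a) (b := b) (by rwa [hχδ])
    rwa [hχδ] at this

end Twist

end Iwasawa

end

/-! ### The theorem for `G ≅ ℤ_p^k × Δ`. -/

noncomputable section

open TensorProduct

theorem lemma2p1 (p : ℕ) [Fact p.Prime] (k : ℕ) (hk : 2 ≤ k)
    (Δ : Type*) [CommGroup Δ] [Finite Δ] [TopologicalSpace Δ] [DiscreteTopology Δ]
    (hΔ : (Nat.card Δ).Coprime p)
    (G : Type u) [CommGroup G] [TopologicalSpace G] [IsTopologicalGroup G]
    (e : G ≃ₜ* Multiplicative (Fin k → ℤ_[p]) × Δ) :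
    (∀ (κ : G →ₜ* ℤ_[p]ˣ) (r : ℤ),
      DetFunctor.HasCanonicalTrivialization (Iwasawa.IwasawaAlgebra p G)
        (Iwasawa.TateTwist κ r)) ∧
    (∀ (M : Type u) [AddCommGroup M] [Module (Iwasawa.IwasawaAlgebra p G) M]
      [Module.Finite (Iwasawa.IwasawaAlgebra p G) M],
      2 ≤ DetFunctor.krullCodim (Iwasawa.IwasawaAlgebra p G) M →
        DetFunctor.HasCanonicalTrivialization (Iwasawa.IwasawaAlgebra p G) M) := by
  -- `Δ` may live in any universe; being finite, it is replaced by a copy in the universe of `G`.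
  have hsmall : Small.{u} Δ := Countable.toSmall Δ
  have hd : DiscreteTopology (Shrink.{u} Δ) := (Shrink.homeomorph.{u} Δ).discreteTopology
  have hfin : Finite (Shrink.{u} Δ) := Finite.of_equiv _ (equivShrink.{u} Δ)
  let m : Δ ≃* Shrink.{u} Δ := (Shrink.mulEquiv : Shrink.{u} Δ ≃* Δ).symm
  let e' : G ≃ₜ* Multiplicative (Fin k → ℤ_[p]) × Shrink.{u} Δ := e.trans
    { (MulEquiv.refl (Multiplicative (Fin k → ℤ_[p]))).prodCongr m with
      continuous_toFun := continuous_id.prodMap (continuous_of_discreteTopology (f := m))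
      continuous_invFun := continuous_id.prodMap (continuous_of_discreteTopology (f := m.symm)) }
  have hR : DetFunctor.IsRegularSemilocal (Iwasawa.IwasawaAlgebra p G) :=
    Iwasawa.isRegularSemilocal_iwasawaAlgebra (Δ := Shrink.{u} Δ)
      (by rwa [Nat.card_congr (equivShrink.{u} Δ).symm]) k e'
  have := hR.noetherian
  have := hR.semilocal
  refine ⟨fun κ r => ?_, fun M _ _ _ hM =>
    DetFunctor.hasCanonicalTrivialization hR.finiteProjDims
      (DetFunctor.not_annihilator_le_of_two_le_krullCodim hM)⟩
  have := Iwasawa.finite_tateTwist κ r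
  obtain ⟨k, rfl⟩ := Nat.exists_eq_add_of_le' hk
  -- A prime containing the annihilator of `ℤ_p(r)` contains the kernel of `κ ^ r`, hence has height
  -- greater than one; the general criterion applies directly.
  exact DetFunctor.hasCanonicalTrivialization hR.finiteProjDims fun q _ hq hle =>
    absurd (Iwasawa.one_lt_height_of_ker_charHom_le e (κ ^ r) q
      ((Iwasawa.ker_charHom_le_annihilator κ r).trans hle)) (not_lt_of_ge hq)

end
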